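/- **Setting.** Consider a real analytic planar constrained system $\delta\,\dot x=P$, $\delta\,\dot y=Q$ near a point $p$ of a $2$-manifold with corners, in local analytic coordinates $(x,y)$ centred at $p$ and adapted to the boundary (each boundary component through $p$ is $\{x=0\}$ or $\{y=0\}$, the manifold lies in $\{x\ge 0\}$, resp. $\{y\ge 0\}$, and the component is invariant by the adjoint field $X=P\partial_x+Q\partial_y$). Assume that $P,Q$ have no common factor and that $\delta$ has no multiple factor in the ring of analytic germs at $p$. Let $\Delta=\{\delta=0\}$. The point $p$ is *singular* if $X(p)=0$, or $p\in\Delta$ and $d\delta(p)=0$, or $p\in\Delta$ and $d\delta(X)(p)=0$. The system is *elementary* at $p$ if $p$ is not singular, or $p\notin\Delta$ is a semi-hyperbolic equilibrium point of $X$ (the linearization has an eigenvalue with nonzero real part), or $p\in\Delta$ is such an equilibrium point and $\Delta$ is near $p$ a smooth curve (with $d\delta(p)\neq0$) invariant by $X$. Write the auxiliary field as $\delta X=\sum x^ry^s(a_{r,s}\,x\partial_x+b_{r,s}\,y\partial_y)$. Its Newton polygon $\mathcal P$ is the convex hull of $\{(r,s): (a_{r,s},b_{r,s})\ne 0\}+\mathbb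 R_{\ge0}^2$. The main vertex is the lower end of the vertical left side of $\mathcal P$, the height is the second coordinate of the main vertex, and the main segment is the side following the vertical one. The polygon is *controllable* if the main vertex lies in $\{0\}\times\mathbb N$ or $\{-1\}\times\mathbb N$. An *admissible change of coordinates* is a finite composition of changes $(x,y)\mapsto(x,y-\alpha x^\beta)$ with $\alpha\in\mathbb R$, $\beta\ge1$ an integer (allowed only if $\{y=0\}$ is not a boundary component). For positive integers $\omega_1,\omega_2$, the weighted blow-up of $p$ is $(\bar x,\bar y,\tau)\mapsto(\tau^{\omega_1}\bar x,\tau^{\omega_2}\bar y)$ on $\mathbb S^1\times\mathbb R_{\ge0}$, restricted to the part over the manifold, with exceptional divisor $\{\tau=0\}$. In the directional charts with exceptional divisor $\{u=0\}$, the *strict transform* is obtained by pulling back $\delta$ and dividing it by the largest possible power of $u$, and by pulling back $X$ and dividing it by the largest power of $u$ for which the result is analytic and tangent to $\{u=0\}$. **Theorem.** Assume that the Newton polygon of $\delta X$ in the given coordinates is controllable. 1. There is a finite sequence of weighted blow-ups, the first one centred at $p$ and the following ones at points of the exceptional divisor, after which the strict transform is elementary at every point of the exceptional divisor (the sequence is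 empty only if the system is elementary at $p$). The sequence can be chosen so that each blow-up is performed in coordinates obtained by an admissible change from the given ones (resp. from the chart coordinates centred at the point), in which the polygon is controllable, with weights $(\omega_1,\omega_2)$ the primitive positive integer normal vector to the main segment; if the main segment is horizontal, the weights may be any positive integers. 2. Suppose that $\{y=0\}$ is not a boundary component and that there is an infinite sequence of changes $y_{n+1}=y_n-\alpha_nx^{\beta_n}$, $n\ge0$, $y_0=y$, $\beta_n\ge1$, such that for every $n$ the polygon in the coordinates $(x,y_n)$ has positive height, its main segment has normal vector $(1,\beta_n)$, and after the blow-up $x=u$, $y_n=u^{\beta_n}v$ the polygon of the strict transform at the point $(u,v)=(0,\alpha_n)$ has the same height. Then $\varphi(x)=\sum_n\alpha_nx^{\beta_n}$ converges near $0$ to an analytic function, and in the coordinates $(x,y-\varphi(x))$ the polygon is controllable with horizontal main segment. -/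

import Mathlib

open Filter Topology

noncomputable section

/-- Germ at the origin of a planar real analytic diagonalized constrained system
`δ ẋ = P, δ ẏ = Q`, in local coordinates of a 2-manifold with corners that are centred at the
point and adapted to the boundary. The flag `divX` (resp. `divY`) says that `{x = 0}`
(resp. `{y = 0}`) is a component of the boundary; the manifold is then locally contained in
`{x ≥ 0}` (resp. `{y ≥ 0}`). The boundary is invariant. -/
structure ConstrainedGerm where
  δ : ℝ × ℝ → ℝ
  P : ℝ × ℝ → ℝ
  Q : ℝ × ℝ → ℝ
  divX : Prop
  divY : Prop
  analytic_δ : AnalyticAt ℝ δ 0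
  analytic_P : AnalyticAt ℝ P 0
  analytic_Q : AnalyticAt ℝ Q 0
  invariant_x : divX → ∀ᶠ y in 𝓝 (0 : ℝ), P (0, y) = 0
  invariant_y : divY → ∀ᶠ x in 𝓝 (0 : ℝ), Q (x, 0) = 0

namespace ConstrainedGerm

/-- The adjoint vector field. -/
def X (S : ConstrainedGerm) (q : ℝ × ℝ) : ℝ × ℝ := (S.P q, S.Q q)

/-- `P` and `Q` have no common factor (a non-unit) in the ring of analytic germs. -/
def NoCommonFactor (S : ConstrainedGerm) : Prop :=
  ¬ ∃ f g h : ℝ × ℝ → ℝ, AnalyticAt ℝ f 0 ∧ AnalyticAt ℝ g 0 ∧ AnalyticAt ℝ h 0 ∧ f 0 = 0 ∧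
    (∀ᶠ q in 𝓝 (0 : ℝ × ℝ), S.P q = f q * g q) ∧ (∀ᶠ q in 𝓝 (0 : ℝ × ℝ), S.Q q = f q * h q)

/-- `δ` is reduced: it has no multiple factor in the ring of analytic germs
(in particular it is not identically zero). -/
def Reduced (S : ConstrainedGerm) : Prop :=
  ¬ ∃ f g : ℝ × ℝ → ℝ, AnalyticAt ℝ f 0 ∧ AnalyticAt ℝ g 0 ∧ f 0 = 0 ∧
    ∀ᶠ q in 𝓝 (0 : ℝ × ℝ), S.δ q = f q ^ 2 * g q

/-! ### Singular and elementary points -/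

/-- The origin is a singularity: an equilibrium point of the adjoint field, a non-smooth point of
the impasse set, or a point of tangency between the adjoint field and the impasse set. -/
def IsSingular (S : ConstrainedGerm) : Prop :=
  S.X 0 = 0 ∨ (S.δ 0 = 0 ∧ fderiv ℝ S.δ 0 = 0) ∨ (S.δ 0 = 0 ∧ fderiv ℝ S.δ 0 (S.X 0) = 0)

/-- The origin is an equilibrium point of the adjoint field at which the linearization has an
eigenvalue with nonzero real part. -/
def IsSemiHyperbolic (S : ConstrainedGerm) : Prop :=
  S.X 0 = 0 ∧ ∃ μ : ℂ, μ.re ≠ 0 ∧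
    Polynomial.aeval μ (fderiv ℝ S.X 0 : (ℝ × ℝ) →ₗ[ℝ] (ℝ × ℝ)).charpoly = 0

/-- Near the origin the impasse set is a smooth curve through the origin that is invariant by the
adjoint field. -/
def ImpasseIsSeparatrix (S : ConstrainedGerm) : Prop :=
  S.δ 0 = 0 ∧ fderiv ℝ S.δ 0 ≠ 0 ∧
    ∀ᶠ q in 𝓝 (0 : ℝ × ℝ), S.δ q = 0 → fderiv ℝ S.δ q (S.X q) = 0

/-- The system is elementary at the origin. -/
def IsElementary (S : ConstrainedGerm) : Prop :=
  ¬ S.IsSingular ∨ (S.IsSemiHyperbolic ∧ S.δ 0 ≠ 0) ∨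
    (S.IsSemiHyperbolic ∧ S.ImpasseIsSeparatrix)

/-! ### The Newton polygon of the auxiliary vector field `δ X` -/

/-- The coefficient of `x ^ k * y ^ l` in the Taylor expansion at the origin. -/
def taylorCoeff (f : ℝ × ℝ → ℝ) (k l : ℕ) : ℝ :=
  iteratedDeriv k (fun x => iteratedDeriv l (fun y => f (x, y)) 0) 0 /
    ((k.factorial : ℝ) * (l.factorial : ℝ))

/-- The support of the auxiliary field, written in the logarithmic basis: with
`δ P = (∑ a r s x^r y^s) x` and `δ Q = (∑ b r s x^r y^s) y`, the set of `(r, s)` for which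
`a r s` and `b r s` are not both zero. -/
def support (S : ConstrainedGerm) : Set (ℤ × ℤ) :=
  {p | ∃ k l : ℕ,
    (p = ((k : ℤ) - 1, (l : ℤ)) ∧ taylorCoeff (fun q => S.δ q * S.P q) k l ≠ 0) ∨
    (p = ((k : ℤ), (l : ℤ) - 1) ∧ taylorCoeff (fun q => S.δ q * S.Q q) k l ≠ 0)}

/-- The Newton polygon: the convex hull of `support + (ℝ_{≥ 0})²`. -/
def newtonPolygon (S : ConstrainedGerm) : Set (ℝ × ℝ) :=
  convexHull ℝ {w | ∃ p ∈ S.support, (p.1 : ℝ) ≤ w.1 ∧ (p.2 : ℝ) ≤ w.2}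

/-- The main vertex: the lower end of the leftmost (vertical) side of the polygon. Its second
coordinate is the height of the polygon. -/
def IsMainVertex (S : ConstrainedGerm) (v : ℝ × ℝ) : Prop :=
  v ∈ S.newtonPolygon ∧ ∀ w ∈ S.newtonPolygon, v.1 ≤ w.1 ∧ (w.1 = v.1 → v.2 ≤ w.2)

/-- The polygon is controllable: its main vertex lies in `{0} × ℕ` or `{-1} × ℕ`. -/
def Controllable (S : ConstrainedGerm) : Prop :=
  ∃ h : ℕ, S.IsMainVertex (0, (h : ℝ)) ∨ S.IsMainVertex (-1, (h : ℝ))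

/-- The main segment (the side that follows the vertical one) is horizontal: the polygon has no
point below the main vertex. -/
def MainSegmentHorizontal (S : ConstrainedGerm) : Prop :=
  ∃ v, S.IsMainVertex v ∧ ∀ w ∈ S.newtonPolygon, v.2 ≤ w.2

/-- The main segment is not horizontal and `(ω₁, ω₂)` is the primitive vector of positive integers
normal to it: the line `ω₁ r + ω₂ s = R` supports the polygon along a segment that starts at the
main vertex. -/
def IsMainWeight (S : ConstrainedGerm) (ω₁ ω₂ : ℕ) : Prop :=
  0 < ω₁ ∧ 0 < ω₂ ∧ Nat.Coprime ω₁ ω₂ ∧ ∃ v, S.IsMainVertex v ∧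
    (∀ w ∈ S.newtonPolygon, (ω₁ : ℝ) * v.1 + ω₂ * v.2 ≤ ω₁ * w.1 + ω₂ * w.2) ∧
    ∃ w ∈ S.newtonPolygon, w ≠ v ∧ (ω₁ : ℝ) * w.1 + ω₂ * w.2 = ω₁ * v.1 + ω₂ * v.2

/-! ### Changes of coordinates -/

theorem analyticAt_shear {f : ℝ × ℝ → ℝ} {φ : ℝ → ℝ} (hf : AnalyticAt ℝ f 0)
    (hφ : AnalyticAt ℝ φ 0) (h0 : φ 0 = 0) :
    AnalyticAt ℝ (fun q : ℝ × ℝ => f (q.1, q.2 + φ q.1)) 0 := by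
  have h1 : AnalyticAt ℝ (fun q : ℝ × ℝ => φ q.1) 0 :=
    AnalyticAt.fun_comp (f := Prod.fst) (g := φ) hφ analyticAt_fst
  have h2 : AnalyticAt ℝ (fun q : ℝ × ℝ => (q.1, q.2 + φ q.1)) 0 :=
    analyticAt_fst.prod (analyticAt_snd.add h1)
  refine AnalyticAt.fun_comp_of_eq hf h2 ?_
  ext <;> simp [h0]

/-- The system in the coordinates `(x, y - φ x)`. The axis `{y = 0}` is not preserved, so it must
not be a boundary component. -/
def shear (S : ConstrainedGerm) (φ : ℝ → ℝ) (hφ : AnalyticAt ℝ φ 0) (h0 : φ 0 = 0)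
    (hy : ¬ S.divY) : ConstrainedGerm where
  δ q := S.δ (q.1, q.2 + φ q.1)
  P q := S.P (q.1, q.2 + φ q.1)
  Q q := S.Q (q.1, q.2 + φ q.1) - deriv φ q.1 * S.P (q.1, q.2 + φ q.1)
  divX := S.divX
  divY := S.divY
  analytic_δ := analyticAt_shear S.analytic_δ hφ h0
  analytic_P := analyticAt_shear S.analytic_P hφ h0
  analytic_Q := (analyticAt_shear S.analytic_Q hφ h0).sub
    ((AnalyticAt.fun_comp (f := Prod.fst) (g := deriv φ) hφ.deriv analyticAt_fst).mul
      (analyticAt_shear S.analytic_P hφ h0))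
  invariant_x h := by simpa [h0] using S.invariant_x h
  invariant_y h := absurd h hy

/-- The elementary admissible change of coordinates `(x, y) ↦ (x, y - α x ^ β)`, `β ≥ 1`. -/
def monomialShear (S : ConstrainedGerm) (α : ℝ) (β : ℕ) (hβ : 0 < β) (hy : ¬ S.divY) :
    ConstrainedGerm :=
  S.shear (fun x => α * x ^ β) (analyticAt_const.mul (analyticAt_id.pow β))
    (by simp [hβ.ne']) hy

/-- `T` is obtained from `S` by an admissible change of coordinates, i.e. a finite composition of
changes `(x, y) ↦ (x, y - α x ^ β)`. -/
inductive AdmissibleChange : ConstrainedGerm → ConstrainedGerm → Prop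
  | refl (S : ConstrainedGerm) : AdmissibleChange S S
  | step (S T : ConstrainedGerm) (α : ℝ) (β : ℕ) (hβ : 0 < β) (hy : ¬ S.divY) :
      AdmissibleChange (S.monomialShear α β hβ hy) T → AdmissibleChange S T

/-- Exchange of the two coordinates. -/
def swap (S : ConstrainedGerm) : ConstrainedGerm where
  δ q := S.δ q.swap
  P q := S.Q q.swap
  Q q := S.P q.swap
  divX := S.divY
  divY := S.divX
  analytic_δ := AnalyticAt.fun_comp (by simpa using S.analytic_δ) (analyticAt_snd.prod analyticAt_fst)
  analytic_P := AnalyticAt.fun_comp (by simpa using S.analytic_Q) (analyticAt_snd.prod analyticAt_fst)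
  analytic_Q := AnalyticAt.fun_comp (by simpa using S.analytic_P) (analyticAt_snd.prod analyticAt_fst)
  invariant_x h := S.invariant_y h
  invariant_y h := S.invariant_x h

/-! ### Weighted blow-ups -/

/-- The weighted blow-up in the direction `± x`, with coordinates `(u, v)` centred at the point
`(0, ξ)` of the exceptional divisor `{u = 0}`. -/
def xBlowUp (ω₁ ω₂ : ℕ) (σ : ℤˣ) (ξ : ℝ) (q : ℝ × ℝ) : ℝ × ℝ :=
  (((σ : ℤ) : ℝ) * q.1 ^ ω₁, q.1 ^ ω₂ * (ξ + q.2))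

/-- `T` is the strict transform of `S` at the point `(0, ξ)` of the `± x` directional chart.
The impasse function is pulled back and divided by the largest possible power of `u`. The adjoint
field is pulled back and divided by the largest power of `u` such that the result is analytic and
leaves the exceptional divisor invariant, that is, such that both coefficients of the field in the
logarithmic basis `u ∂/∂u, ∂/∂v` are analytic. -/
structure IsXTransform (S : ConstrainedGerm) (ω₁ ω₂ : ℕ) (σ : ℤˣ) (ξ : ℝ)
    (T : ConstrainedGerm) : Prop where
  impasse : ∃ d : ℕ, ∀ᶠ q in 𝓝 (0 : ℝ × ℝ), S.δ (xBlowUp ω₁ ω₂ σ ξ q) = q.1 ^ d * T.δ q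
  impasse_primitive : ∃ᶠ v in 𝓝 (0 : ℝ), T.δ (0, v) ≠ 0
  field : ∃ d : ℤ, ∀ᶠ q in 𝓝 (0 : ℝ × ℝ), q.1 ≠ 0 →
    S.X (xBlowUp ω₁ ω₂ σ ξ q) = q.1 ^ d • fderiv ℝ (xBlowUp ω₁ ω₂ σ ξ) q (T.X q)
  field_primitive :
    ∃ᶠ v in 𝓝 (0 : ℝ), deriv (fun u => T.P (u, v)) 0 ≠ 0 ∨ T.Q (0, v) ≠ 0
  divX : T.divX
  divY : T.divY ↔ S.divY ∧ ξ = 0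

/-- The points of the exceptional circle of a weighted blow-up: the points `(0, ξ)` of the
directional charts `± x`, and the two remaining points, the origins of the charts `± y`. -/
inductive DivisorPoint
  | x (σ : ℤˣ) (ξ : ℝ)
  | y (σ : ℤˣ)

/-- The point of the exceptional circle lies over the manifold with corners. -/
def OnDivisor (S : ConstrainedGerm) : DivisorPoint → Prop
  | .x σ ξ => (S.divX → σ = 1) ∧ (S.divY → 0 ≤ ξ)
  | .y σ => S.divY → σ = 1

/-- `T` is the strict transform of `S` at the given point of the exceptional divisor of the blow-up
with weights `(ω₁, ω₂)`. The `y` direction is the `x` direction for exchanged coordinates. -/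
def IsStrictTransform (S : ConstrainedGerm) (ω₁ ω₂ : ℕ) :
    DivisorPoint → ConstrainedGerm → Prop
  | .x σ ξ, T => S.IsXTransform ω₁ ω₂ σ ξ T
  | .y σ, T => S.swap.IsXTransform ω₂ ω₁ σ 0 T.swap

/-- The germ is resolved by `n` successive weighted blow-ups of points over the origin: with `n = 0`
the system is elementary at the origin; otherwise the origin is blown up, in coordinates that are
obtained by an admissible change and make the polygon controllable, with weights given by the main
segment (any weights, if the main segment is horizontal), all but finitely many points of the
exceptional divisor are elementary for the strict transform, and the remaining ones are resolved by
further blow-ups of the same kind. -/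
inductive ResolvedBy : ℕ → ConstrainedGerm → Prop
  | elementary (S : ConstrainedGerm) : S.IsElementary → ResolvedBy 0 S
  | blowUp (S S' : ConstrainedGerm) (ω₁ ω₂ : ℕ) (T : DivisorPoint → ConstrainedGerm)
      (F : Finset DivisorPoint) (c : DivisorPoint → ℕ)
      (change : AdmissibleChange S S') (controllable : S'.Controllable)
      (weight : S'.IsMainWeight ω₁ ω₂ ∨ (S'.MainSegmentHorizontal ∧ 0 < ω₁ ∧ 0 < ω₂))
      (transform : ∀ q, S'.OnDivisor q → S'.IsStrictTransform ω₁ ω₂ q (T q))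
      (elementary_off : ∀ q, S'.OnDivisor q → q ∉ F → (T q).IsElementary)
      (centers : ∀ q ∈ F, S'.OnDivisor q)
      (resolved : ∀ q ∈ F, ResolvedBy (c q) (T q)) :
      ResolvedBy (1 + ∑ q ∈ F, c q) S

/-- The height is positive, the main segment has normal `(1, β)`, and after the corresponding
blow-up the polygon at the point `(0, α)` of the `x` direction has the same height. -/
def HeightStalls (S : ConstrainedGerm) (α : ℝ) (β : ℕ) : Prop :=
  S.IsMainWeight 1 β ∧ ∃ (T : ConstrainedGerm) (v w : ℝ × ℝ),
    S.IsStrictTransform 1 β (.x 1 α) T ∧ S.IsMainVertex v ∧ T.IsMainVertex w ∧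
    0 < v.2 ∧ w.2 = v.2

end ConstrainedGerm

end

/-! Why it is true. Fix a line ω₁r + ω₂s = m supporting the polygon at the main vertex, of height h.
In the chart x = σ the part of δX on this line gives two polynomials in one variable, `polyA` and
`polyB`. Up to a constant they are the u∂/∂u and ∂/∂v components of the blown up auxiliary field on
the exceptional divisor. So the main vertex of the strict transform at (0, ξ) is (0, s), with s the
largest integer for which (X - ξ)^s divides A and (X - ξ)^(s+1) divides B
(`IsXTransform.exists_height`). If s ≤ 0 the point is elementary. Controllability makes the origins
of the ± y charts elementary (`isElementary_of_y_transform`), so only the finitely many common roots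
of A and B remain. The degrees of A and B are at most h and h + 1, hence s ≤ h, and s = h only when
A = a(X - ξ)^h and B = b(X - ξ)^(h+1): the height stalls. The proof is an induction on h, and only
stalling points need work.

For a main segment that is not horizontal, stalling with h > 0 forces ξ ≠ 0 and ω₁ = 1, and the
shear y ↦ y - αx^β with α = ξσ^β keeps the main vertex while pushing the rest of the support off the
line (`shear_of_stalls`). The exponents β therefore increase strictly. Either finitely many shears
lead to coordinates in which no height stalls, or at least every stalling point can be resolved, or
the shears continue forever.

The infinite case rests on `Tame`: some x^N lies in the ideal (P, Q) and some x^N' in (δ, ∂δ/∂y).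
Unlike the factor hypotheses, these relations pass to strict transforms and shears. With them,
polygons of ever smaller slope force δ and Q to vanish to ever higher order along the sheared axis,
and force h = 1 (`vanishesTo_of_above`). The implicit function theorem, after a rescaling, gives an
exact analytic root φ of δ near a partial sum of the shears, and the Bézout relation shows that all
partial sums approximate it. So ∑ αₙx^βₙ converges to φ, whose graph is an invariant curve inside
the impasse set (`Tame.exists_invariant_curve`). A stalling point of height one lying on such a
curve is elementary (`IsXTransform.isElementary_of_curve`). Hence a single blow-up in the original
coordinates already suffices, which ends the induction, and straightening the curve makes the main
segment horizontal, which is the second assertion.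

If {y = 0} is a boundary component no shear is allowed, but a stalling point has ξ ≠ 0, hence is off
that component, and the previous case applies there at the same height (`resolvesHeight`).

The Bézout relations come from Weierstrass preparation, Gauss's lemma over the integrally closed
ring of germs in x, and the fact that a nonzero germ in x is a power of x times a unit
(`NoCommonFactor.fieldBezout`, `Reduced.impasseBezout`). -/

noncomputable section

/-! ### Double power series -/

/-- On the bidisc of radius `r` the function `f` is the sum of an absolutely convergent double
power series with coefficients `a`. -/
structure HasDoubleSeries (f : ℝ × ℝ → ℝ) (a : ℕ × ℕ → ℝ) (r : ℝ) : Prop where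
  pos : 0 < r
  summable : Summable fun k : ℕ × ℕ => |a k| * r ^ (k.1 + k.2)
  hasSum : ∀ x y, |x| ≤ r → |y| ≤ r → HasSum (fun k : ℕ × ℕ => a k * (x ^ k.1 * y ^ k.2)) (f (x, y))

/-- The homogeneous monomial `x ^ k * y ^ (n - k)` as a multilinear map. -/
def monoMultilinear (n k : ℕ) : ContinuousMultilinearMap ℝ (fun _ : Fin n => ℝ × ℝ) ℝ :=
  (ContinuousMultilinearMap.mkPiAlgebraFin ℝ n ℝ).compContinuousLinearMap
    (fun i => if i.1 < k then ContinuousLinearMap.fst ℝ ℝ ℝ else ContinuousLinearMap.snd ℝ ℝ ℝ)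

theorem monoMultilinear_norm_le (n k : ℕ) : ‖monoMultilinear n k‖ ≤ 1 := by
  refine (ContinuousMultilinearMap.norm_compContinuousLinearMap_le _ _).trans ?_
  rw [ContinuousMultilinearMap.norm_mkPiAlgebraFin, one_mul]
  refine Finset.prod_le_one (fun _ _ => norm_nonneg _) fun i _ => ?_
  split_ifs
  · exact ContinuousLinearMap.norm_fst_le ..
  · exact ContinuousLinearMap.norm_snd_le ..

theorem monoMultilinear_apply (k l : ℕ) (q : ℝ × ℝ) :
    monoMultilinear (k + l) k (fun _ => q) = q.1 ^ k * q.2 ^ l := by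
  simp only [monoMultilinear, ContinuousMultilinearMap.compContinuousLinearMap_apply,
    ContinuousMultilinearMap.mkPiAlgebraFin_apply, List.prod_ofFn]
  rw [Fin.prod_univ_add]
  simp

theorem HasSum.antidiagonal_sum {g : ℕ × ℕ → ℝ} {s : ℝ} (h : HasSum g s) :
    HasSum (fun n => ∑ k ∈ Finset.HasAntidiagonal.antidiagonal n, g k) s := by
  have h1 := (Finset.HasAntidiagonal.sigmaAntidiagonalEquivProd (A := ℕ)).hasSum_iff.2 h
  refine h1.sigma fun n => ?_
  have := Finset.hasSum (Finset.HasAntidiagonal.antidiagonal n) g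
  exact this

theorem summable_of_antidiagonal {g : ℕ × ℕ → ℝ} (h0 : ∀ k, 0 ≤ g k)
    (h : Summable (fun n => ∑ k ∈ Finset.HasAntidiagonal.antidiagonal n, g k)) : Summable g := by
  rw [← (Finset.HasAntidiagonal.sigmaAntidiagonalEquivProd (A := ℕ)).summable_iff]
  refine (summable_sigma_of_nonneg (f := g ∘ Finset.HasAntidiagonal.sigmaAntidiagonalEquivProd)
    (fun _ => h0 _)).2 ⟨fun n => (Finset.summable (Finset.HasAntidiagonal.antidiagonal n) g), ?_⟩
  convert h using 2 with n
  exact Finset.tsum_subtype (Finset.HasAntidiagonal.antidiagonal n) g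

theorem summable_abs_mul_pow_antidiagonal {a : ℕ × ℕ → ℝ} {r : ℝ}
    (h : Summable fun k : ℕ × ℕ => |a k| * r ^ (k.1 + k.2)) :
    Summable fun n => (∑ k ∈ Finset.HasAntidiagonal.antidiagonal n, |a k|) * r ^ n := by
  convert h.hasSum.antidiagonal_sum.summable using 2 with n
  rw [Finset.sum_mul]
  refine Finset.sum_congr rfl fun k hk => ?_
  rw [Finset.HasAntidiagonal.mem_antidiagonal.1 hk]

/-- Grouping by total degree, the degree n part is a multilinear form of norm at most the sum of the
|a k| of that degree, so absolute convergence on the bidisc bounds the radius of the formal series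
from below. -/
theorem HasDoubleSeries.analyticAt {f : ℝ × ℝ → ℝ} {a : ℕ × ℕ → ℝ} {r : ℝ}
    (h : HasDoubleSeries f a r) : AnalyticAt ℝ f 0 := by
  let p : FormalMultilinearSeries ℝ (ℝ × ℝ) ℝ := fun n =>
    ∑ k ∈ Finset.HasAntidiagonal.antidiagonal n, a k • monoMultilinear n k.1
  have hp : ∀ n, ‖p n‖ ≤ ∑ k ∈ Finset.HasAntidiagonal.antidiagonal n, |a k| := fun n => by
    refine (norm_sum_le _ _).trans (Finset.sum_le_sum fun k _ => ?_)
    rw [norm_smul, Real.norm_eq_abs]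
    exact mul_le_of_le_one_right (abs_nonneg _) (monoMultilinear_norm_le _ _)
  lift r to NNReal using h.pos.le
  have hs := summable_abs_mul_pow_antidiagonal h.summable
  refine (HasFPowerSeriesOnBall.analyticAt (p := p) (r := (r : ENNReal)) ⟨?_, ?_, ?_⟩)
  · refine p.le_radius_of_bound (∑' n, (∑ k ∈ Finset.HasAntidiagonal.antidiagonal n, |a k|) * (r : ℝ) ^ n) fun n => ?_
    refine (mul_le_mul_of_nonneg_right (hp n) (by positivity)).trans ?_
    exact hs.le_tsum n fun _ _ => by positivity
  · exact_mod_cast h.pos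
  · rintro ⟨x, y⟩ hq
    have hq' : ‖((x, y) : ℝ × ℝ)‖ < r := by simpa using hq
    have hx : |x| ≤ r := (norm_fst_le ((x, y) : ℝ × ℝ)).trans hq'.le
    have hy : |y| ≤ r := (norm_snd_le ((x, y) : ℝ × ℝ)).trans hq'.le
    rw [zero_add]
    have hfun : (fun n => p n fun _ => (x, y)) = fun n =>
        ∑ k ∈ Finset.HasAntidiagonal.antidiagonal n, a k * (x ^ k.1 * y ^ k.2) := by
      funext n
      change (∑ k ∈ Finset.HasAntidiagonal.antidiagonal n, a k • monoMultilinear n k.1)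
        (fun _ => (x, y)) = _
      rw [sum_apply]
      simp only [smul_apply, smul_eq_mul]
      refine Finset.sum_congr rfl fun k hk => ?_
      rw [← Finset.HasAntidiagonal.mem_antidiagonal.1 hk, monoMultilinear_apply]
    rw [hfun]
    exact (h.hasSum x y hx hy).antidiagonal_sum

theorem multilinear_pair_expand {n : ℕ} (p : ContinuousMultilinearMap ℝ (fun _ : Fin n => ℝ × ℝ) ℝ)
    (x y : ℝ) : p (fun _ => (x, y)) = ∑ k ∈ Finset.HasAntidiagonal.antidiagonal n,
      (∑ s ∈ Finset.powersetCard k.1 (Finset.univ : Finset (Fin n)),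
        p (s.piecewise (fun _ => (1, 0)) (fun _ => (0, 1)))) * (x ^ k.1 * y ^ k.2) := by
  classical
  have h0 : (fun _ : Fin n => (x, y)) =
      (fun _ : Fin n => x • ((1, 0) : ℝ × ℝ)) + (fun _ : Fin n => y • ((0, 1) : ℝ × ℝ)) := by
    ext i <;> simp
  rw [h0, p.map_add_univ, Finset.Nat.sum_antidiagonal_eq_sum_range_succ_mk,
    ← Finset.powerset_univ, Finset.sum_powerset, Finset.card_univ, Fintype.card_fin]
  refine Finset.sum_congr rfl fun k hk => ?_
  rw [Finset.sum_mul]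
  refine Finset.sum_congr rfl fun s hs => ?_
  have hcard := (Finset.mem_powersetCard.1 hs).2
  have h1 : s.piecewise (fun _ : Fin n => x • ((1, 0) : ℝ × ℝ)) (fun _ => y • ((0, 1) : ℝ × ℝ)) =
      fun i => (s.piecewise (fun _ => x) (fun _ => y) i) •
        (s.piecewise (fun _ : Fin n => ((1, 0) : ℝ × ℝ)) (fun _ => (0, 1)) i) := by
    funext i
    by_cases hi : i ∈ s <;> simp [hi]
  rw [h1, p.map_smul_univ, smul_eq_mul, mul_comm, Finset.prod_piecewise]
  simp [hcard, Finset.card_sdiff]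

theorem AnalyticAt.exists_hasDoubleSeries {f : ℝ × ℝ → ℝ} (hf : AnalyticAt ℝ f 0) :
    ∃ a r, HasDoubleSeries f a r := by
  classical
  obtain ⟨p, R, hp⟩ := hf
  obtain ⟨ρ, hρ0, hρR⟩ := ENNReal.lt_iff_exists_nnreal_btwn.1 hp.r_pos
  have hρ : 0 < (ρ : ℝ) := by exact_mod_cast hρ0
  have hsum : Summable fun n => ‖p n‖ * (ρ : ℝ) ^ n :=
    p.summable_norm_mul_pow (hρR.trans_le hp.r_le)
  let b : ℕ → ℕ → ℝ := fun n k => ∑ s ∈ Finset.powersetCard k (Finset.univ : Finset (Fin n)),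
        p n (s.piecewise (fun _ => (1, 0)) (fun _ => (0, 1)))
  let a : ℕ × ℕ → ℝ := fun k => b (k.1 + k.2) k.1
  have hexp : ∀ n x y, p n (fun _ => (x, y)) =
      ∑ k ∈ Finset.HasAntidiagonal.antidiagonal n, a k * (x ^ k.1 * y ^ k.2) := fun n x y => by
    rw [multilinear_pair_expand]
    refine Finset.sum_congr rfl fun k hk => ?_
    simp only [a, b]
    rw [Finset.HasAntidiagonal.mem_antidiagonal.1 hk]
  have hb : ∀ n, ∑ k ∈ Finset.HasAntidiagonal.antidiagonal n, |a k| ≤ 2 ^ n * ‖p n‖ := fun n => by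
    have h1 : ∑ k ∈ Finset.HasAntidiagonal.antidiagonal n, |a k| ≤ ∑ k ∈ Finset.HasAntidiagonal.antidiagonal n,
        (n.choose k.1 : ℝ) * ‖p n‖ := by
      refine Finset.sum_le_sum fun k hk => ?_
      simp only [a, b]
      rw [Finset.HasAntidiagonal.mem_antidiagonal.1 hk]
      refine (Finset.abs_sum_le_sum_abs _ _).trans ?_
      have hc : (n.choose k.1 : ℝ) =
          ((Finset.powersetCard k.1 (Finset.univ : Finset (Fin n))).card : ℝ) := by
        rw [Finset.card_powersetCard, Finset.card_univ, Fintype.card_fin]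
      rw [hc, ← nsmul_eq_mul]
      refine Finset.sum_le_card_nsmul _ _ _ fun s _ => ?_
      refine ((p n).le_opNorm _).trans (mul_le_of_le_one_right (norm_nonneg _) ?_)
      refine Finset.prod_le_one (fun _ _ => norm_nonneg _) fun i _ => ?_
      by_cases hi : i ∈ s <;> simp [hi, Prod.norm_def]
    refine h1.trans (le_of_eq ?_)
    rw [← Finset.sum_mul, Finset.Nat.sum_antidiagonal_eq_sum_range_succ_mk]
    congr 1
    exact_mod_cast Nat.sum_range_choose n
  -- Expanding the degree n form in coordinates costs a factor 2 ^ n, which halving the radius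
  -- absorbs.
  have hr : 0 < (ρ : ℝ) / 2 := by positivity
  have hS : Summable fun k : ℕ × ℕ => |a k| * (ρ / 2 : ℝ) ^ (k.1 + k.2) := by
    refine summable_of_antidiagonal (fun _ => by positivity) ?_
    refine Summable.of_nonneg_of_le (fun n => Finset.sum_nonneg fun _ _ => by positivity)
      (fun n => ?_) hsum
    calc ∑ k ∈ Finset.HasAntidiagonal.antidiagonal n, |a k| * (ρ / 2 : ℝ) ^ (k.1 + k.2)
        = (∑ k ∈ Finset.HasAntidiagonal.antidiagonal n, |a k|) * (ρ / 2 : ℝ) ^ n := by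
          rw [Finset.sum_mul]
          exact Finset.sum_congr rfl fun k hk => by rw [Finset.HasAntidiagonal.mem_antidiagonal.1 hk]
      _ ≤ (2 ^ n * ‖p n‖) * (ρ / 2 : ℝ) ^ n := by gcongr; exact hb n
      _ = ‖p n‖ * (ρ : ℝ) ^ n := by rw [div_pow]; field_simp
  refine ⟨a, ρ / 2, hr, hS, fun x y hx hy => ?_⟩
  have hs1 : Summable (fun k : ℕ × ℕ => a k * (x ^ k.1 * y ^ k.2)) := by
    refine Summable.of_norm_bounded hS fun k => ?_
    rw [Real.norm_eq_abs, abs_mul, abs_mul, abs_pow, abs_pow, pow_add]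
    gcongr
  have h2 := hs1.hasSum.antidiagonal_sum
  have hmem : ((x, y) : ℝ × ℝ) ∈ Metric.eball (0 : ℝ × ℝ) R := by
    refine Metric.eball_subset_eball hρR.le ?_
    have : ‖((x, y) : ℝ × ℝ)‖ < ρ := by
      refine max_lt ?_ ?_
      · exact lt_of_le_of_lt hx (by linarith)
      · exact lt_of_le_of_lt hy (by linarith)
    simpa using this
  have h3 := hp.hasSum hmem
  rw [zero_add] at h3
  have h4 : (fun n => p n (fun _ => (x, y))) =
      fun n => ∑ k ∈ Finset.HasAntidiagonal.antidiagonal n, a k * (x ^ k.1 * y ^ k.2) := by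
    funext n; exact hexp n x y
  rw [h4] at h3
  rw [h3.unique h2]
  exact hs1.hasSum

theorem iteratedDeriv_eq_of_hasSum {g : ℝ → ℝ} {c : ℕ → ℝ}
    (h : ∀ᶠ y in 𝓝 (0 : ℝ), HasSum (fun l => c l * y ^ l) (g y)) (l : ℕ) :
    iteratedDeriv l g 0 = l.factorial * c l := by
  have h1 : HasFPowerSeriesAt g (FormalMultilinearSeries.ofScalars ℝ c) 0 := by
    rw [hasFPowerSeriesAt_iff]
    filter_upwards [h] with y hy
    simpa [FormalMultilinearSeries.coeff_ofScalars, mul_comm] using hy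
  have h2 := h1.analyticAt.hasFPowerSeriesAt
  have h3 := h1.eq_formalMultilinearSeries h2
  have h4 := congrArg (fun p => FormalMultilinearSeries.coeff p l) h3
  simp only [FormalMultilinearSeries.coeff_ofScalars] at h4
  rw [h4]
  field_simp

theorem HasSum.congr_left {ι : Type*} {f g : ι → ℝ} {s : ℝ} (h : HasSum g s)
    (e : ∀ k, f k = g k) : HasSum f s := by
  rwa [funext e]

/-! ### Operations on double power series -/

namespace HasDoubleSeries

variable {f g : ℝ × ℝ → ℝ} {a b : ℕ × ℕ → ℝ} {r : ℝ}

theorem summable_term (h : HasDoubleSeries f a r) {x y : ℝ} (hx : |x| ≤ r) (hy : |y| ≤ r) :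
    Summable (fun k : ℕ × ℕ => a k * (x ^ k.1 * y ^ k.2)) :=
  (h.hasSum x y hx hy).summable

theorem of_summable (hr : 0 < r) (h : Summable fun k : ℕ × ℕ => |a k| * r ^ (k.1 + k.2)) :
    HasDoubleSeries (fun q => ∑' k : ℕ × ℕ, a k * (q.1 ^ k.1 * q.2 ^ k.2)) a r := by
  refine ⟨hr, h, fun x y hx hy => Summable.hasSum ?_⟩
  refine Summable.of_norm_bounded h fun k => ?_
  rw [Real.norm_eq_abs, abs_mul, abs_mul, abs_pow, abs_pow, pow_add]
  gcongr

theorem hasSum_rows (h : HasDoubleSeries f a r) {x y : ℝ} (hx : |x| ≤ r) (hy : |y| ≤ r) :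
    HasSum (fun l => (∑' k, a (k, l) * x ^ k) * y ^ l) (f (x, y)) := by
  have h1 := (Equiv.prodComm ℕ ℕ).hasSum_iff.2 (h.hasSum x y hx hy)
  refine h1.prod_fiberwise fun l => ?_
  have h2 := h1.summable.prod_factor l
  simp only [Function.comp_def, Equiv.prodComm_apply, Prod.swap_prod_mk, ← mul_assoc] at h2 ⊢
  rw [← tsum_mul_right]
  exact h2.hasSum

theorem summable_row (h : HasDoubleSeries f a r) {x : ℝ} (hx : |x| ≤ r) (l : ℕ) :
    Summable (fun k => a (k, l) * x ^ k) := by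
  have h1 := h.summable_term hx (y := r) (by rw [abs_of_pos h.pos])
  have h2 := ((Equiv.prodComm ℕ ℕ).summable_iff.2 h1).prod_factor l
  simp only [Function.comp_def, Equiv.prodComm_apply, Prod.swap_prod_mk, ← mul_assoc] at h2
  have := h2.mul_right ((r ^ l)⁻¹)
  have hr : r ^ l ≠ 0 := (pow_pos h.pos l).ne'
  simpa [mul_assoc, hr] using this

theorem eventually_abs_le (h : HasDoubleSeries f a r) : ∀ᶠ x in 𝓝 (0 : ℝ), |x| ≤ r := by
  filter_upwards [Metric.ball_mem_nhds (0 : ℝ) h.pos] with x hx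
  have : |x| < r := by simpa using hx
  exact this.le

theorem eventually_abs_le_prod (h : HasDoubleSeries f a r) :
    ∀ᶠ q in 𝓝 (0 : ℝ × ℝ), |q.1| ≤ r ∧ |q.2| ≤ r := by
  have h1 := h.eventually_abs_le.prod_mk h.eventually_abs_le
  rwa [← nhds_prod_eq] at h1

/-- Summation by rows turns the inner derivative at y = 0 into l! times a power series in x;
uniqueness of one-variable power series is then applied once in each variable. -/
theorem taylorCoeff_eq (h : HasDoubleSeries f a r) (k l : ℕ) :
    ConstrainedGerm.taylorCoeff f k l = a (k, l) := by
  have h1 : ∀ᶠ x in 𝓝 (0 : ℝ), iteratedDeriv l (fun y => f (x, y)) 0 =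
      l.factorial * ∑' k, a (k, l) * x ^ k := by
    filter_upwards [h.eventually_abs_le] with x hx
    refine iteratedDeriv_eq_of_hasSum (c := fun l => ∑' k, a (k, l) * x ^ k) ?_ l
    filter_upwards [h.eventually_abs_le] with y hy
    exact h.hasSum_rows hx hy
  have h2 : iteratedDeriv k (fun x => iteratedDeriv l (fun y => f (x, y)) 0) 0 =
      k.factorial * (l.factorial * a (k, l)) := by
    refine iteratedDeriv_eq_of_hasSum (c := fun k => l.factorial * a (k, l)) ?_ k
    filter_upwards [h1, h.eventually_abs_le] with x hx hxr
    rw [hx]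
    simpa [mul_assoc] using (h.summable_row hxr l).hasSum.mul_left (l.factorial : ℝ)
  rw [ConstrainedGerm.taylorCoeff, h2]
  field_simp

theorem eq_zero (h : HasDoubleSeries f a r) (ha : ∀ k, a k = 0) : ∀ᶠ q in 𝓝 (0 : ℝ × ℝ), f q = 0 := by
  filter_upwards [h.eventually_abs_le_prod] with q ⟨hqx, hqy⟩
  have := h.hasSum q.1 q.2 hqx hqy
  simp only [ha, zero_mul] at this
  exact this.unique hasSum_zero

theorem swap (h : HasDoubleSeries f a r) :
    HasDoubleSeries (fun q => f q.swap) (fun k => a k.swap) r := by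
  refine ⟨h.pos, ?_, fun x y hx hy => ?_⟩
  · have := (Equiv.prodComm ℕ ℕ).summable_iff.2 h.summable
    simpa [Function.comp_def, add_comm] using this
  · have := (Equiv.prodComm ℕ ℕ).hasSum_iff.2 (h.hasSum y x hy hx)
    simpa [Function.comp_def, mul_comm] using this

theorem x_pow_mul (h : HasDoubleSeries f a r) (K : ℕ) :
    HasDoubleSeries (fun q => q.1 ^ K * f q)
      (fun k => if K ≤ k.1 then a (k.1 - K, k.2) else 0) r := by
  have hi : Function.Injective (fun k : ℕ × ℕ => (k.1 + K, k.2)) := by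
    rintro ⟨a, b⟩ ⟨c, d⟩ h; simpa using h
  have hz : ∀ k : ℕ × ℕ, k ∉ Set.range (fun k : ℕ × ℕ => (k.1 + K, k.2)) → ¬ K ≤ k.1 := by
    intro k hk hK
    exact hk ⟨(k.1 - K, k.2), by ext <;> simp; omega⟩
  refine ⟨h.pos, ?_, fun x y hx hy => ?_⟩
  · rw [← hi.summable_iff (fun k hk => by simp [hz k hk])]
    refine (summable_congr fun k => ?_).2 (h.summable.mul_left (r ^ K))
    simp only [Function.comp_apply, le_add_iff_nonneg_left, zero_le, if_true, Nat.add_sub_cancel]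
    ring
  · rw [← hi.hasSum_iff (fun k hk => by simp [hz k hk])]
    refine HasSum.congr_left ((h.hasSum x y hx hy).mul_left (x ^ K)) fun k => ?_
    simp only [Function.comp_apply, le_add_iff_nonneg_left, zero_le, if_true, Nat.add_sub_cancel]
    ring

theorem y_pow_mul (h : HasDoubleSeries f a r) (L : ℕ) :
    HasDoubleSeries (fun q => q.2 ^ L * f q)
      (fun k => if L ≤ k.2 then a (k.1, k.2 - L) else 0) r := by
  simpa using (h.swap.x_pow_mul L).swap

theorem shift (h : HasDoubleSeries f a r) (K L : ℕ) :
    Summable fun k : ℕ × ℕ => |a (k.1 + K, k.2 + L)| * r ^ (k.1 + k.2) := by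
  have hi : Function.Injective (fun k : ℕ × ℕ => (k.1 + K, k.2 + L)) := by
    rintro ⟨a, b⟩ ⟨c, d⟩ h; simpa using h
  have h1 := (h.summable.comp_injective hi).mul_left ((r ^ (K + L))⁻¹)
  refine (summable_congr fun k => ?_).2 h1
  have : r ^ (K + L) ≠ 0 := (pow_pos h.pos _).ne'
  simp only [Function.comp_apply]
  field_simp
  ring

/-- Splitting off the monomials of a rectangle. -/
theorem exists_decomposition (h : HasDoubleSeries f a r) (K L : ℕ) :
    ∃ F G : ℝ × ℝ → ℝ, AnalyticAt ℝ F 0 ∧ AnalyticAt ℝ G 0 ∧ ∀ᶠ q in 𝓝 (0 : ℝ × ℝ),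
      f q = ∑ k ∈ Finset.range K ×ˢ Finset.range L, a k * (q.1 ^ k.1 * q.2 ^ k.2) +
        q.1 ^ K * F q + q.2 ^ L * G q := by
  have hF := of_summable h.pos (h.shift K 0)
  -- F takes all indices with K ≤ k.1, so G may only take those with k.1 < K: the rectangle and the
  -- two tails are disjoint.
  have hs : Summable fun k : ℕ × ℕ => |if k.1 < K then a (k.1, k.2 + L) else 0| * r ^ (k.1 + k.2) := by
    refine Summable.of_nonneg_of_le (fun k => mul_nonneg (abs_nonneg _) (pow_nonneg h.pos.le _))
      (fun k => ?_) (h.shift 0 L)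
    have := pow_nonneg h.pos.le (k.1 + k.2)
    split_ifs
    · simp
    · simpa using mul_nonneg (abs_nonneg _) this
  have hG := of_summable h.pos hs
  refine ⟨_, _, hF.analyticAt, hG.analyticAt, ?_⟩
  filter_upwards [h.eventually_abs_le_prod] with q ⟨hqx, hqy⟩
  have h1 := (hF.x_pow_mul K).hasSum q.1 q.2 hqx hqy
  have h2 := (hG.y_pow_mul L).hasSum q.1 q.2 hqx hqy
  have h3 := h.hasSum q.1 q.2 hqx hqy
  have h4 : HasSum (fun k : ℕ × ℕ => if k ∈ Finset.range K ×ˢ Finset.range L then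
      a k * (q.1 ^ k.1 * q.2 ^ k.2) else 0)
      (∑ k ∈ Finset.range K ×ˢ Finset.range L, a k * (q.1 ^ k.1 * q.2 ^ k.2)) := by
    have := hasSum_sum_of_ne_finset_zero (f := fun k : ℕ × ℕ =>
      if k ∈ Finset.range K ×ˢ Finset.range L then a k * (q.1 ^ k.1 * q.2 ^ k.2) else 0)
      (s := Finset.range K ×ˢ Finset.range L) (fun k hk => if_neg hk)
      (L := SummationFilter.unconditional _)
    rwa [Finset.sum_congr rfl (fun k hk => if_pos hk)] at this
  have h5 := (h4.add h1).add h2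
  refine h3.unique ?_
  refine HasSum.congr_left h5 fun k => ?_
  by_cases hK : K ≤ k.1
  · have : ¬ k.1 < K := by omega
    simp [hK, this]
  · have hK' : k.1 < K := by omega
    by_cases hL : L ≤ k.2
    · have : ¬ k.2 < L := by omega
      simp [hK, hK', hL, this]
    · have hL' : k.2 < L := by omega
      simp [hK, hK', hL, hL']

/-- A series without terms of degree less than `K` in `x` is divisible by `x ^ K`. -/
theorem exists_eq_x_pow_mul (h : HasDoubleSeries f a r) {K : ℕ}
    (ha : ∀ k l, k < K → a (k, l) = 0) :
    ∃ F : ℝ × ℝ → ℝ, AnalyticAt ℝ F 0 ∧ ∀ᶠ q in 𝓝 (0 : ℝ × ℝ), f q = q.1 ^ K * F q := by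
  have hF := of_summable h.pos (h.shift K 0)
  refine ⟨_, hF.analyticAt, ?_⟩
  filter_upwards [h.eventually_abs_le_prod] with q ⟨hqx, hqy⟩
  have h1 := (hF.x_pow_mul K).hasSum q.1 q.2 hqx hqy
  refine (h.hasSum q.1 q.2 hqx hqy).unique ?_
  refine HasSum.congr_left h1 fun k => ?_
  by_cases hK : K ≤ k.1
  · simp [hK]
  · simp [hK, ha k.1 k.2 (by omega)]

end HasDoubleSeries

theorem AnalyticAt.hasDoubleSeries {f : ℝ × ℝ → ℝ} (hf : AnalyticAt ℝ f 0) :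
    ∃ r, HasDoubleSeries f (fun k => ConstrainedGerm.taylorCoeff f k.1 k.2) r := by
  obtain ⟨a, r, h⟩ := hf.exists_hasDoubleSeries
  refine ⟨r, ?_⟩
  convert h using 1
  funext k
  exact h.taylorCoeff_eq k.1 k.2

/-! ### Taylor coefficients of plane germs -/

namespace ConstrainedGerm

variable {f g : ℝ × ℝ → ℝ}

theorem eventually_eq_zero_of_taylorCoeff (hf : AnalyticAt ℝ f 0)
    (h : ∀ k l, taylorCoeff f k l = 0) : ∀ᶠ q in 𝓝 (0 : ℝ × ℝ), f q = 0 := by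
  obtain ⟨r, hr⟩ := hf.hasDoubleSeries
  exact hr.eq_zero fun k => h k.1 k.2

theorem taylorCoeff_congr (h : f =ᶠ[𝓝 0] g) (k l : ℕ) : taylorCoeff f k l = taylorCoeff g k l := by
  have h1 : ∀ᶠ x in 𝓝 (0 : ℝ), iteratedDeriv l (fun y => f (x, y)) 0 =
      iteratedDeriv l (fun y => g (x, y)) 0 := by
    have h2 : ∀ᶠ p in 𝓝 (0 : ℝ) ×ˢ 𝓝 (0 : ℝ), f p = g p := by rw [← nhds_prod_eq]; exact h
    filter_upwards [h2.curry] with x hx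
    exact Filter.EventuallyEq.iteratedDeriv_eq l hx
  rw [taylorCoeff, taylorCoeff, Filter.EventuallyEq.iteratedDeriv_eq k h1]

theorem taylorCoeff_swap (hf : AnalyticAt ℝ f 0) (k l : ℕ) :
    taylorCoeff (fun q => f q.swap) k l = taylorCoeff f l k := by
  obtain ⟨r, hr⟩ := hf.hasDoubleSeries
  exact hr.swap.taylorCoeff_eq k l

theorem taylorCoeff_x_mul (hf : AnalyticAt ℝ f 0) (k l : ℕ) :
    taylorCoeff (fun q => q.1 * f q) (k + 1) l = taylorCoeff f k l := by
  obtain ⟨r, hr⟩ := hf.hasDoubleSeries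
  simpa using (hr.x_pow_mul 1).taylorCoeff_eq (k + 1) l

theorem taylorCoeff_x_zero (h : ∀ᶠ y in 𝓝 (0 : ℝ), f (0, y) = 0) (l : ℕ) :
    taylorCoeff f 0 l = 0 := by
  have : iteratedDeriv l (fun y => f (0, y)) 0 = iteratedDeriv l (fun _ : ℝ => (0 : ℝ)) 0 :=
    Filter.EventuallyEq.iteratedDeriv_eq l h
  simp [taylorCoeff, this]

theorem exists_eq_x_mul (hf : AnalyticAt ℝ f 0) (h : ∀ᶠ y in 𝓝 (0 : ℝ), f (0, y) = 0) :
    ∃ F : ℝ × ℝ → ℝ, AnalyticAt ℝ F 0 ∧ ∀ᶠ q in 𝓝 (0 : ℝ × ℝ), f q = q.1 * F q := by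
  obtain ⟨r, hr⟩ := hf.hasDoubleSeries
  simpa using hr.exists_eq_x_pow_mul (K := 1) fun k l hk => by
    obtain rfl : k = 0 := by omega
    exact taylorCoeff_x_zero h l

theorem analyticAt_swap (hf : AnalyticAt ℝ f 0) : AnalyticAt ℝ (fun q : ℝ × ℝ => f q.swap) 0 :=
  AnalyticAt.fun_comp (by simpa using hf) (analyticAt_snd.prod analyticAt_fst)

theorem eventually_swap {p : ℝ × ℝ → Prop} (h : ∀ᶠ q in 𝓝 (0 : ℝ × ℝ), p q) :
    ∀ᶠ q in 𝓝 (0 : ℝ × ℝ), p q.swap :=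
  (continuous_swap.tendsto (0 : ℝ × ℝ)).eventually (by simpa using h)

theorem exists_eq_y_mul (hf : AnalyticAt ℝ f 0) (h : ∀ᶠ x in 𝓝 (0 : ℝ), f (x, 0) = 0) :
    ∃ F : ℝ × ℝ → ℝ, AnalyticAt ℝ F 0 ∧ ∀ᶠ q in 𝓝 (0 : ℝ × ℝ), f q = q.2 * F q := by
  obtain ⟨F, hF, hFe⟩ := exists_eq_x_mul (analyticAt_swap hf) h
  refine ⟨_, analyticAt_swap hF, ?_⟩
  filter_upwards [eventually_swap hFe] with q hq
  simpa using hq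

end ConstrainedGerm

attribute [fun_prop] analyticAt_fst analyticAt_snd

namespace ConstrainedGerm

/-! ### Germs along the exceptional divisor -/

theorem dense_fst_ne_zero : Dense {q : ℝ × ℝ | q.1 ≠ 0} :=
  (dense_compl_singleton (0 : ℝ)).preimage isOpenMap_fst

/-- The complement of the divisor is dense and both functions are continuous near p. Strict
transforms are only constrained where u ≠ 0, so this is how identities are carried over to u = 0. -/
theorem eventuallyEq_of_off_divisor {g₁ g₂ : ℝ × ℝ → ℝ} {p : ℝ × ℝ} (h₁ : AnalyticAt ℝ g₁ p)
    (h₂ : AnalyticAt ℝ g₂ p) (h : ∀ᶠ q in 𝓝 p, q.1 ≠ 0 → g₁ q = g₂ q) : g₁ =ᶠ[𝓝 p] g₂ := by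
  filter_upwards [h₁.eventually_analyticAt, h₂.eventually_analyticAt, h.eventually_nhds]
    with q hq₁ hq₂ hq
  have : (𝓝[{q : ℝ × ℝ | q.1 ≠ 0}] q).NeBot :=
    mem_closure_iff_nhdsWithin_neBot.1 (dense_fst_ne_zero q)
  refine tendsto_nhds_unique_of_eventuallyEq (l := 𝓝[{q : ℝ × ℝ | q.1 ≠ 0}] q)
    (hq₁.continuousAt.tendsto.mono_left nhdsWithin_le_nhds)
    (hq₂.continuousAt.tendsto.mono_left nhdsWithin_le_nhds) ?_
  filter_upwards [mem_nhdsWithin_of_mem_nhds hq, self_mem_nhdsWithin] with z hz hz0 using hz hz0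

theorem eventually_slice {p : ℝ × ℝ → Prop} {x y : ℝ} (h : ∀ᶠ q in 𝓝 (x, y), p q) :
    ∀ᶠ v in 𝓝 y, p (x, v) :=
  (Continuous.tendsto (by fun_prop : Continuous fun v : ℝ => (x, v)) y).eventually h

theorem analyticAt_slice {f : ℝ × ℝ → ℝ} {x y : ℝ} (hf : AnalyticAt ℝ f (x, y)) :
    AnalyticAt ℝ (fun v => f (x, v)) y :=
  hf.comp (f := fun v => (x, v)) (analyticAt_const.prod analyticAt_id)

theorem eventuallyEq_of_zpow_mul_eq {g₁ g₂ : ℝ × ℝ → ℝ} {p : ℝ × ℝ} (h₁ : AnalyticAt ℝ g₁ p)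
    (h₂ : AnalyticAt ℝ g₂ p) {D : ℤ}
    (h : ∀ᶠ q in 𝓝 p, q.1 ≠ 0 → q.1 ^ D * g₁ q = q.1 ^ D * g₂ q) : g₁ =ᶠ[𝓝 p] g₂ := by
  refine eventuallyEq_of_off_divisor h₁ h₂ ?_
  filter_upwards [h] with q hq hq0
  exact mul_left_cancel₀ (zpow_ne_zero D hq0) (hq hq0)

theorem eventually_eq_zero_of_zpow_mul_eq {g₁ g₂ : ℝ × ℝ → ℝ} {t : ℝ}
    (h₁ : AnalyticAt ℝ g₁ (0, t)) (h₂ : AnalyticAt ℝ g₂ (0, t)) {D₁ D₂ : ℤ} (hD : D₁ < D₂)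
    (h : ∀ᶠ q in 𝓝 ((0 : ℝ), t), q.1 ≠ 0 → q.1 ^ D₁ * g₁ q = q.1 ^ D₂ * g₂ q) :
    ∀ᶠ v in 𝓝 t, g₁ (0, v) = 0 := by
  obtain ⟨n, hn⟩ := Int.le.dest hD.le
  have hn0 : n ≠ 0 := by rintro rfl; omega
  have h3 : g₁ =ᶠ[𝓝 ((0 : ℝ), t)] fun q => q.1 ^ n * g₂ q := by
    refine eventuallyEq_of_off_divisor h₁ (by fun_prop) ?_
    filter_upwards [h] with q hq hq0
    refine mul_left_cancel₀ (zpow_ne_zero D₁ hq0) ?_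
    rw [hq hq0, ← hn, zpow_add₀ hq0, zpow_natCast, mul_assoc]
  filter_upwards [eventually_slice h3] with v hv
  simpa [hn0] using hv

/-! ### Weighted initial forms -/

theorem unit_mul_self (σ : ℤˣ) : ((σ : ℤ) : ℝ) * ((σ : ℤ) : ℝ) = 1 := by
  rcases Int.units_eq_one_or σ with rfl | rfl <;> simp

theorem unit_ne_zero (σ : ℤˣ) : ((σ : ℤ) : ℝ) ≠ 0 := by
  rcases Int.units_eq_one_or σ with rfl | rfl <;> simp

/-- The part of weight `D` of the Taylor expansion, restricted to `x = σ`. -/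
def initPoly (f : ℝ × ℝ → ℝ) (ω₁ ω₂ : ℕ) (D : ℤ) (σ : ℤˣ) : Polynomial ℝ :=
  ∑ k ∈ Finset.range (D.toNat + 1) ×ˢ Finset.range (D.toNat + 1),
    if (ω₁ * k.1 + ω₂ * k.2 : ℤ) = D then
      Polynomial.C (taylorCoeff f k.1 k.2 * ((σ : ℤ) : ℝ) ^ k.1) * Polynomial.X ^ k.2 else 0

variable {f : ℝ × ℝ → ℝ} {ω₁ ω₂ : ℕ} {D : ℤ} {σ : ℤˣ}

theorem le_toNat_of_weight (h₁ : 0 < ω₁) (h₂ : 0 < ω₂) {k l : ℕ}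
    (h : (ω₁ * k + ω₂ * l : ℤ) = D) : k < D.toNat + 1 ∧ l < D.toNat + 1 := by
  have h3 : k ≤ ω₁ * k := Nat.le_mul_of_pos_left k h₁
  have h4 : l ≤ ω₂ * l := Nat.le_mul_of_pos_left l h₂
  have h5 : ((ω₁ * k + ω₂ * l : ℕ) : ℤ) = D := by push_cast; exact h
  generalize ω₁ * k = A at *
  generalize ω₂ * l = B at *
  omega

theorem initPoly_coeff (h₁ : 0 < ω₁) (h₂ : 0 < ω₂) {k l : ℕ}
    (h : (ω₁ * k + ω₂ * l : ℤ) = D) :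
    (initPoly f ω₁ ω₂ D σ).coeff l = taylorCoeff f k l * ((σ : ℤ) : ℝ) ^ k := by
  rw [initPoly, Polynomial.finsetSum_coeff, Finset.sum_eq_single (k, l)]
  · rw [if_pos h, Polynomial.coeff_C_mul_X_pow, if_pos rfl]
  · rintro ⟨k', l'⟩ - hne
    dsimp only
    split_ifs with hD
    · rw [Polynomial.coeff_C_mul_X_pow, if_neg]
      rintro rfl
      apply hne
      have : (ω₁ : ℤ) * k' = ω₁ * k := by linarith
      have h5 : (ω₁ : ℤ) ≠ 0 := by positivity
      have := mul_left_cancel₀ h5 this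
      ext <;> simp_all
    · simp
  · intro hn
    exact absurd (Finset.mem_product.2 ⟨Finset.mem_range.2 (le_toNat_of_weight h₁ h₂ h).1,
      Finset.mem_range.2 (le_toNat_of_weight h₁ h₂ h).2⟩) hn

theorem exists_of_initPoly_coeff_ne_zero {l : ℕ} (h : (initPoly f ω₁ ω₂ D σ).coeff l ≠ 0) :
    ∃ k : ℕ, (ω₁ * k + ω₂ * l : ℤ) = D ∧ taylorCoeff f k l ≠ 0 := by
  rw [initPoly, Polynomial.finsetSum_coeff] at h
  obtain ⟨⟨k, l'⟩, -, hk⟩ := Finset.exists_ne_zero_of_sum_ne_zero h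
  dsimp only at hk
  split_ifs at hk with hD
  · rw [Polynomial.coeff_C_mul_X_pow] at hk
    split_ifs at hk with hl
    · subst hl
      exact ⟨k, hD, left_ne_zero_of_mul hk⟩
    · exact absurd rfl hk
  · simp at hk

theorem initPoly_eval (t : ℝ) : (initPoly f ω₁ ω₂ D σ).eval t =
    ∑ k ∈ Finset.range (D.toNat + 1) ×ˢ Finset.range (D.toNat + 1),
    if (ω₁ * k.1 + ω₂ * k.2 : ℤ) = D then
      taylorCoeff f k.1 k.2 * ((σ : ℤ) : ℝ) ^ k.1 * t ^ k.2 else 0 := by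
  rw [initPoly, Polynomial.eval_finsetSum]
  refine Finset.sum_congr rfl fun k _ => ?_
  split_ifs <;> simp

/-- If all Taylor coefficients of weight less than `D` vanish, then the pull back of `f` by the
weighted blow-up is divisible by `u ^ D`, and the quotient restricts to the initial form on the
exceptional divisor. -/
theorem exists_weighted_quotient (hf : AnalyticAt ℝ f 0) (h₁ : 0 < ω₁) (h₂ : 0 < ω₂) (σ : ℤˣ)
    (h : ∀ k l, taylorCoeff f k l ≠ 0 → D ≤ ω₁ * k + ω₂ * l) :
    ∃ g : ℝ × ℝ → ℝ, (∀ t, AnalyticAt ℝ g (0, t)) ∧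
      (∀ t, ∀ᶠ q in 𝓝 ((0 : ℝ), t), q.1 ≠ 0 →
        f (((σ : ℤ) : ℝ) * q.1 ^ ω₁, q.1 ^ ω₂ * q.2) = q.1 ^ D * g q) ∧
      ∀ t, g (0, t) = (initPoly f ω₁ ω₂ D σ).eval t := by
  obtain ⟨r, hr⟩ := hf.hasDoubleSeries
  -- Both weights are at least one, so x ^ N and y ^ N have weight greater than D; after division by
  -- u ^ D the tails vanish on the divisor.
  set N := D.toNat + 1 with hN
  obtain ⟨F, G, hF, hG, hFG⟩ := hr.exists_decomposition N N
  set s : ℝ := ((σ : ℤ) : ℝ)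
  let π : ℝ × ℝ → ℝ × ℝ := fun q => (s * q.1 ^ ω₁, q.1 ^ ω₂ * q.2)
  have hπ : ∀ t, AnalyticAt ℝ π (0, t) := fun t =>
    AnalyticAt.prod (f := fun q : ℝ × ℝ => s * q.1 ^ ω₁) (g := fun q : ℝ × ℝ => q.1 ^ ω₂ * q.2)
      (by fun_prop) (by fun_prop)
  have hπ0 : ∀ t, π (0, t) = 0 := fun t => by simp [π, h₁.ne', h₂.ne']
  have hx : (D : ℤ) < ω₁ * N := by
    have : N ≤ ω₁ * N := Nat.le_mul_of_pos_left N h₁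
    have : (N : ℤ) ≤ ω₁ * N := by exact_mod_cast this
    omega
  have hy : (D : ℤ) < ω₂ * N := by
    have : N ≤ ω₂ * N := Nat.le_mul_of_pos_left N h₂
    have : (N : ℤ) ≤ ω₂ * N := by exact_mod_cast this
    omega
  refine ⟨fun q => (∑ k ∈ Finset.range N ×ˢ Finset.range N, taylorCoeff f k.1 k.2 * s ^ k.1 *
      q.1 ^ ((ω₁ * k.1 + ω₂ * k.2 : ℤ) - D).toNat * q.2 ^ k.2) +
      s ^ N * q.1 ^ ((ω₁ * N : ℤ) - D).toNat * F (π q) +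
      q.1 ^ ((ω₂ * N : ℤ) - D).toNat * q.2 ^ N * G (π q), fun t => ?_, fun t => ?_, fun t => ?_⟩
  · have hF' : AnalyticAt ℝ (fun q => F (π q)) (0, t) := AnalyticAt.comp_of_eq hF (hπ t) (hπ0 t)
    have hG' : AnalyticAt ℝ (fun q => G (π q)) (0, t) := AnalyticAt.comp_of_eq hG (hπ t) (hπ0 t)
    refine AnalyticAt.fun_add (AnalyticAt.fun_add ?_ ?_) ?_
    · exact Finset.analyticAt_fun_sum _ fun k _ => by fun_prop
    · exact AnalyticAt.fun_mul (by fun_prop) hF'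
    · exact AnalyticAt.fun_mul (by fun_prop) hG'
  · have hlim : Tendsto π (𝓝 (0, t)) (𝓝 0) := by
      have := (hπ t).continuousAt.tendsto
      rwa [hπ0] at this
    filter_upwards [hlim.eventually hFG] with q hq hq0
    have hpow : ∀ E : ℤ, D ≤ E → q.1 ^ D * q.1 ^ (E - D).toNat = q.1 ^ E := fun E hE => by
      rw [← zpow_natCast, Int.toNat_of_nonneg (by omega), ← zpow_add₀ hq0]
      congr 1; ring
    have hpow1 : ∀ n m : ℕ, q.1 ^ ((n : ℤ) * m) = (q.1 ^ n) ^ m := fun n m => by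
      rw [zpow_mul, zpow_natCast, zpow_natCast]
    change f (π q) = _
    rw [hq, mul_add, mul_add, Finset.mul_sum]
    congr 1
    · congr 1
      · refine Finset.sum_congr rfl fun k _ => ?_
        by_cases hk : taylorCoeff f k.1 k.2 = 0
        · simp [hk]
        · have e := hpow _ (h k.1 k.2 hk)
          rw [zpow_add₀ hq0, hpow1, hpow1] at e
          calc _ = taylorCoeff f k.1 k.2 * s ^ k.1 * ((q.1 ^ ω₁) ^ k.1 * (q.1 ^ ω₂) ^ k.2) *
                q.2 ^ k.2 := by simp only [π]; ring
            _ = _ := by rw [← e]; ring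
      · have e := hpow _ hx.le
        rw [hpow1] at e
        calc _ = s ^ N * (q.1 ^ ω₁) ^ N * F (π q) := by simp only [π]; ring
          _ = _ := by rw [← e]; ring
    · have e := hpow _ hy.le
      rw [hpow1] at e
      calc _ = (q.1 ^ ω₂) ^ N * q.2 ^ N * G (π q) := by simp only [π]; ring
        _ = _ := by rw [← e]; ring
  · have e1 : ((ω₁ * N : ℤ) - D).toNat ≠ 0 := by omega
    have e2 : ((ω₂ * N : ℤ) - D).toNat ≠ 0 := by omega
    rw [initPoly_eval]
    simp only [zero_pow e1, zero_pow e2, mul_zero, zero_mul, add_zero]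
    refine Finset.sum_congr rfl fun k _ => ?_
    split_ifs with hk
    · simp [hk, s]
    · by_cases hc : taylorCoeff f k.1 k.2 = 0
      · simp [hc]
      · have := h k.1 k.2 hc
        have e : ((ω₁ * k.1 + ω₂ * k.2 : ℤ) - D).toNat ≠ 0 := by omega
        simp [zero_pow e]

/-- A germ that does not vanish identically has a weighted order. -/
theorem exists_weighted_order (hf : AnalyticAt ℝ f 0) (hne : ¬ ∀ᶠ q in 𝓝 (0 : ℝ × ℝ), f q = 0)
    (ω₁ ω₂ : ℕ) : ∃ D : ℕ, (∀ k l, taylorCoeff f k l ≠ 0 → D ≤ ω₁ * k + ω₂ * l) ∧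
      ∃ k l, ω₁ * k + ω₂ * l = D ∧ taylorCoeff f k l ≠ 0 := by
  classical
  have h : ∃ D k l, ω₁ * k + ω₂ * l = D ∧ taylorCoeff f k l ≠ 0 := by
    by_contra hcon
    push Not at hcon
    exact hne (eventually_eq_zero_of_taylorCoeff hf fun k l => hcon _ k l rfl)
  exact ⟨Nat.find h, fun k l hkl => Nat.find_min' h ⟨k, l, rfl, hkl⟩, Nat.find_spec h⟩

theorem initPoly_ne_zero (h₁ : 0 < ω₁) (h₂ : 0 < ω₂) {k l : ℕ}
    (h : (ω₁ * k + ω₂ * l : ℤ) = D) (hc : taylorCoeff f k l ≠ 0) :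
    initPoly f ω₁ ω₂ D σ ≠ 0 := by
  intro h0
  have := initPoly_coeff (f := f) (σ := σ) h₁ h₂ h
  rw [h0, Polynomial.coeff_zero] at this
  exact mul_ne_zero hc (pow_ne_zero _ (unit_ne_zero σ)) this.symm

theorem polynomial_eq_zero_of_eventually {p : Polynomial ℝ} {t : ℝ}
    (h : ∀ᶠ v in 𝓝 t, p.eval v = 0) : p = 0 := by
  refine Polynomial.eq_zero_of_infinite_isRoot p ?_
  exact Set.Infinite.mono (fun v hv => hv) (infinite_of_mem_nhds t h)

theorem polynomial_eq_of_eventually {p q : Polynomial ℝ} {t : ℝ}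
    (h : ∀ᶠ v in 𝓝 t, p.eval v = q.eval v) : p = q := by
  rw [← sub_eq_zero]
  refine polynomial_eq_zero_of_eventually (t := t) ?_
  filter_upwards [h] with v hv
  simp [hv]

/-- Converse of `exists_weighted_quotient`. -/
theorem weighted_order_of_quotient (hf : AnalyticAt ℝ f 0) (h₁ : 0 < ω₁) (h₂ : 0 < ω₂) (σ : ℤˣ)
    {g : ℝ × ℝ → ℝ} {t : ℝ} (hg : AnalyticAt ℝ g (0, t))
    (hfg : ∀ᶠ q in 𝓝 ((0 : ℝ), t), q.1 ≠ 0 →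
        f (((σ : ℤ) : ℝ) * q.1 ^ ω₁, q.1 ^ ω₂ * q.2) = q.1 ^ D * g q) :
    (∀ k l, taylorCoeff f k l ≠ 0 → D ≤ ω₁ * k + ω₂ * l) ∧
      ∀ᶠ v in 𝓝 t, g (0, v) = (initPoly f ω₁ ω₂ D σ).eval v := by
  have hD : ∀ k l, taylorCoeff f k l ≠ 0 → D ≤ ω₁ * k + ω₂ * l := by
    intro k₀ l₀ hkl
    have hne : ¬ ∀ᶠ q in 𝓝 (0 : ℝ × ℝ), f q = 0 := fun h0 => hkl <| by
      rw [taylorCoeff_congr (g := fun _ => 0) h0]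
      simp [taylorCoeff]
    -- E is the true weighted order. If it were less than D, comparing the two factorizations would
    -- make the initial form of weight E vanish on an interval of the divisor, hence identically.
    obtain ⟨E, hE, k, l, hklE, hc⟩ := exists_weighted_order hf hne ω₁ ω₂
    have hE' : ∀ k l, taylorCoeff f k l ≠ 0 → (E : ℤ) ≤ ω₁ * k + ω₂ * l :=
      fun k l hc => by exact_mod_cast hE k l hc
    obtain ⟨g', hg', hfg', hg0'⟩ := exists_weighted_quotient hf h₁ h₂ σ hE'
    by_contra hlt
    push Not at hlt
    have hED : (E : ℤ) < D := (hE' k₀ l₀ hkl).trans_lt hlt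
    have hz := eventually_eq_zero_of_zpow_mul_eq (hg' t) hg hED (by
      filter_upwards [hfg, hfg' t] with q hq hq' hq0
      rw [← hq hq0, hq' hq0])
    refine initPoly_ne_zero (σ := σ) h₁ h₂ (D := E) (by exact_mod_cast hklE) hc
      (polynomial_eq_zero_of_eventually (t := t) ?_)
    filter_upwards [hz] with v hv
    rw [← hg0', hv]
  refine ⟨hD, ?_⟩
  obtain ⟨g', hg', hfg', hg0'⟩ := exists_weighted_quotient hf h₁ h₂ σ hD
  have he := eventuallyEq_of_zpow_mul_eq hg (hg' t) (D := D) (by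
      filter_upwards [hfg, hfg' t] with q hq hq' hq0
      rw [← hq hq0, hq' hq0])
  filter_upwards [eventually_slice he] with v hv
  rw [hv, hg0']

end ConstrainedGerm

namespace ConstrainedGerm

/-! ### The main vertex and the main segment in terms of the support -/

/-- The point of the support that is the main vertex of the polygon. -/
def MainPoint (S : ConstrainedGerm) (p : ℤ × ℤ) : Prop :=
  p ∈ S.support ∧ ∀ p' ∈ S.support, p.1 ≤ p'.1 ∧ (p'.1 = p.1 → p.2 ≤ p'.2)

variable {S : ConstrainedGerm} {p : ℤ × ℤ} {ω₁ ω₂ : ℕ}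

theorem MainPoint.unique {p' : ℤ × ℤ} (h : S.MainPoint p) (h' : S.MainPoint p') : p = p' := by
  have h1 := h.2 _ h'.1
  have h2 := h'.2 _ h.1
  have e : p.1 = p'.1 := le_antisymm h1.1 h2.1
  exact Prod.ext e (le_antisymm (h1.2 e.symm) (h2.2 e))

theorem mem_newtonPolygon (hp : p ∈ S.support) : ((p.1 : ℝ), (p.2 : ℝ)) ∈ S.newtonPolygon :=
  subset_convexHull ℝ _ ⟨p, hp, le_rfl, le_rfl⟩

theorem newtonPolygon_subset {C : Set (ℝ × ℝ)} (hC : Convex ℝ C)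
    (h : ∀ p ∈ S.support, ∀ w : ℝ × ℝ, (p.1 : ℝ) ≤ w.1 → (p.2 : ℝ) ≤ w.2 → w ∈ C) :
    S.newtonPolygon ⊆ C :=
  convexHull_min (fun w ⟨p, hp, h1, h2⟩ => h p hp w h1 h2) hC

theorem convex_lex_lt (v : ℝ × ℝ) : Convex ℝ {w : ℝ × ℝ | v.1 < w.1 ∨ (w.1 = v.1 ∧ v.2 < w.2)} := by
  rw [convex_iff_forall_pos]
  rintro x hx y hy a b ha hb hab
  have hb' : b = 1 - a := by linarith
  simp only [Set.mem_ofPred_eq, Prod.fst_add, Prod.smul_fst, Prod.snd_add, Prod.smul_snd,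
    smul_eq_mul] at *
  subst hb'
  rcases hx with hx | ⟨hx, hx'⟩ <;> rcases hy with hy | ⟨hy, hy'⟩
  · left; nlinarith
  · left; nlinarith
  · left; nlinarith
  · right; constructor
    · rw [hx, hy]; ring
    · nlinarith

theorem convex_lex_le (v : ℝ × ℝ) : Convex ℝ {w : ℝ × ℝ | v.1 < w.1 ∨ (w.1 = v.1 ∧ v.2 ≤ w.2)} := by
  rw [convex_iff_forall_pos]
  rintro x hx y hy a b ha hb hab
  have hb' : b = 1 - a := by linarith
  simp only [Set.mem_ofPred_eq, Prod.fst_add, Prod.smul_fst, Prod.snd_add, Prod.smul_snd,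
    smul_eq_mul] at *
  subst hb'
  rcases hx with hx | ⟨hx, hx'⟩ <;> rcases hy with hy | ⟨hy, hy'⟩
  · left; nlinarith
  · left; nlinarith
  · left; nlinarith
  · right; constructor
    · rw [hx, hy]; ring
    · nlinarith

theorem convex_line (v : ℝ × ℝ) (c d : ℝ) :
    Convex ℝ {w : ℝ × ℝ | w = v ∨ c * v.1 + d * v.2 < c * w.1 + d * w.2} := by
  rw [convex_iff_forall_pos]
  rintro x hx y hy a b ha hb hab
  have hb' : b = 1 - a := by linarith
  simp only [Set.mem_ofPred_eq, Prod.fst_add, Prod.smul_fst, Prod.snd_add, Prod.smul_snd,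
    smul_eq_mul] at *
  rcases hx with rfl | hx <;> rcases hy with rfl | hy
  · left; rw [← add_smul, hab, one_smul]
  · right; subst hb'; nlinarith
  · right; subst hb'; nlinarith
  · right; subst hb'; nlinarith

theorem convex_halfplane (c d m : ℝ) : Convex ℝ {w : ℝ × ℝ | m ≤ c * w.1 + d * w.2} := by
  rintro x hx y hy a b ha hb hab
  have hb' : b = 1 - a := by linarith
  simp only [Set.mem_ofPred_eq, Prod.fst_add, Prod.smul_fst, Prod.snd_add, Prod.smul_snd,
    smul_eq_mul] at *
  subst hb'
  nlinarith

theorem isMainVertex_of_mainPoint (h : S.MainPoint p) : S.IsMainVertex ((p.1 : ℝ), (p.2 : ℝ)) := by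
  refine ⟨mem_newtonPolygon h.1, ?_⟩
  have hs : S.newtonPolygon ⊆
      {w : ℝ × ℝ | (p.1 : ℝ) < w.1 ∨ (w.1 = (p.1 : ℝ) ∧ (p.2 : ℝ) ≤ w.2)} := by
    refine newtonPolygon_subset (convex_lex_le ((p.1 : ℝ), (p.2 : ℝ))) fun p' hp' w h1 h2 => ?_
    have h3 := h.2 p' hp'
    have h4 : (p.1 : ℝ) ≤ p'.1 := by exact_mod_cast h3.1
    rcases (h4.trans h1).lt_or_eq with hlt | heq
    · exact Or.inl hlt
    · refine Or.inr ⟨heq.symm, ?_⟩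
      have h5 : (p'.1 : ℝ) = p.1 := le_antisymm (by linarith) h4
      have h6 : (p.2 : ℝ) ≤ p'.2 := by exact_mod_cast h3.2 (by exact_mod_cast h5)
      exact h6.trans h2
  intro w hw
  rcases hs hw with h1 | ⟨h1, h2⟩
  · exact ⟨h1.le, fun e => absurd e h1.ne'⟩
  · exact ⟨h1.ge, fun _ => h2⟩

/-- Points lexicographically after v form a convex set. If v were not in the support, this set would
contain the support and its upper-right quadrants, hence the whole polygon, including v. -/
theorem exists_mainPoint_of_isMainVertex {v : ℝ × ℝ} (h : S.IsMainVertex v) :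
    ∃ p, S.MainPoint p ∧ v = ((p.1 : ℝ), (p.2 : ℝ)) := by
  have hex : ∃ p ∈ S.support, v = ((p.1 : ℝ), (p.2 : ℝ)) := by
    by_contra hcon
    push Not at hcon
    have hs := newtonPolygon_subset (convex_lex_lt v) (S := S) fun p hp w h1 h2 => by
      have h3 := h.2 _ (mem_newtonPolygon hp)
      dsimp only at h3
      rcases (h3.1.trans h1).lt_or_eq with hlt | heq
      · exact Or.inl hlt
      · have h5 : (p.1 : ℝ) = v.1 := le_antisymm (by linarith) h3.1
        refine Or.inr ⟨heq.symm, lt_of_lt_of_le (lt_of_le_of_ne (h3.2 h5) ?_) h2⟩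
        intro e
        exact hcon p hp (Prod.ext h5.symm e)
    rcases hs h.1 with h1 | ⟨_, h1⟩
    · exact lt_irrefl _ h1
    · exact lt_irrefl _ h1
  obtain ⟨p, hp, rfl⟩ := hex
  refine ⟨p, ⟨hp, fun p' hp' => ?_⟩, rfl⟩
  have h3 := h.2 _ (mem_newtonPolygon hp')
  dsimp only at h3
  exact ⟨by exact_mod_cast h3.1, fun e => by exact_mod_cast h3.2 (by exact_mod_cast e)⟩

theorem MainPoint.eq_of_isMainVertex {v : ℝ × ℝ} (hp : S.MainPoint p) (h : S.IsMainVertex v) :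
    v = ((p.1 : ℝ), (p.2 : ℝ)) := by
  obtain ⟨p', hp', rfl⟩ := exists_mainPoint_of_isMainVertex h
  rw [hp.unique hp']

theorem controllable_iff : S.Controllable ↔
    ∃ p, S.MainPoint p ∧ (p.1 = 0 ∨ p.1 = -1) ∧ 0 ≤ p.2 := by
  constructor
  · rintro ⟨h, hv | hv⟩
    · obtain ⟨p, hp, e⟩ := exists_mainPoint_of_isMainVertex hv
      rw [Prod.mk.injEq] at e
      have e1 : p.1 = 0 := by exact_mod_cast e.1.symm
      have e2 : p.2 = h := by exact_mod_cast e.2.symm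
      exact ⟨p, hp, Or.inl e1, by omega⟩
    · obtain ⟨p, hp, e⟩ := exists_mainPoint_of_isMainVertex hv
      rw [Prod.mk.injEq] at e
      have e1 : p.1 = -1 := by exact_mod_cast e.1.symm
      have e2 : p.2 = h := by exact_mod_cast e.2.symm
      exact ⟨p, hp, Or.inr e1, by omega⟩
  · rintro ⟨⟨p1, p2⟩, hp, h1, h2⟩
    dsimp only at h1 h2
    have := isMainVertex_of_mainPoint hp
    lift p2 to ℕ using h2
    refine ⟨p2, ?_⟩
    rcases h1 with rfl | rfl
    · left; simpa using this
    · right; simpa using this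

theorem MainPoint.horizontal_iff (hp : S.MainPoint p) :
    S.MainSegmentHorizontal ↔ ∀ p' ∈ S.support, p.2 ≤ p'.2 := by
  constructor
  · rintro ⟨v, hv, h⟩ p' hp'
    have := h _ (mem_newtonPolygon hp')
    rw [hp.eq_of_isMainVertex hv] at this
    dsimp only at this
    exact_mod_cast this
  · intro h
    refine ⟨_, isMainVertex_of_mainPoint hp, ?_⟩
    have := newtonPolygon_subset (S := S) (convex_halfplane 0 1 (p.2 : ℝ)) fun p' hp' w h1 h2 => by
      have : (p.2 : ℝ) ≤ p'.2 := by exact_mod_cast h p' hp'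
      simp only [Set.mem_ofPred_eq]
      linarith
    intro w hw
    have := this hw
    simpa using this

/-- If p were the only support point on the line, the convex set made of p and the open half plane
beyond the line would contain the polygon, which would then meet the line only at p. -/
theorem MainPoint.isMainWeight_iff (hp : S.MainPoint p) :
    S.IsMainWeight ω₁ ω₂ ↔ 0 < ω₁ ∧ 0 < ω₂ ∧ Nat.Coprime ω₁ ω₂ ∧
      (∀ p' ∈ S.support, (ω₁ * p.1 + ω₂ * p.2 : ℤ) ≤ ω₁ * p'.1 + ω₂ * p'.2) ∧
      ∃ p' ∈ S.support, p' ≠ p ∧ (ω₁ * p'.1 + ω₂ * p'.2 : ℤ) = ω₁ * p.1 + ω₂ * p.2 := by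
  constructor
  · rintro ⟨h1, h2, h3, v, hv, h4, w, hw, hwv, hw2⟩
    obtain rfl := hp.eq_of_isMainVertex hv
    have h5 : ∀ p' ∈ S.support, (ω₁ * p.1 + ω₂ * p.2 : ℤ) ≤ ω₁ * p'.1 + ω₂ * p'.2 := by
      intro p' hp'
      have := h4 _ (mem_newtonPolygon hp')
      dsimp only at this
      exact_mod_cast this
    refine ⟨h1, h2, h3, h5, ?_⟩
    by_contra hcon
    push Not at hcon
    have hs := newtonPolygon_subset (S := S)
      (convex_line ((p.1 : ℝ), (p.2 : ℝ)) (ω₁ : ℝ) (ω₂ : ℝ)) fun p' hp' w h1' h2' => by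
        have hω₁ : (0 : ℝ) < ω₁ := by exact_mod_cast h1
        have hω₂ : (0 : ℝ) < ω₂ := by exact_mod_cast h2
        by_cases e : p' = p
        · subst e
          by_cases e' : w = ((p'.1 : ℝ), (p'.2 : ℝ))
          · exact Or.inl e'
          · right
            dsimp only
            rcases h1'.lt_or_eq with hlt | heq
            · nlinarith
            · rcases h2'.lt_or_eq with hlt | heq'
              · nlinarith
              · exact absurd (Prod.ext heq.symm heq'.symm) e'
        · right
          have h6 : (ω₁ * p.1 + ω₂ * p.2 : ℤ) < ω₁ * p'.1 + ω₂ * p'.2 :=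
            lt_of_le_of_ne (h5 p' hp') (hcon p' hp' e).symm
          have h7 : (ω₁ * p.1 + ω₂ * p.2 : ℝ) < ω₁ * p'.1 + ω₂ * p'.2 := by exact_mod_cast h6
          dsimp only
          nlinarith
    rcases hs hw with e | hlt
    · exact hwv e
    · exact absurd hw2 hlt.ne'
  · rintro ⟨h1, h2, h3, h4, p', hp', hne, heq⟩
    refine ⟨h1, h2, h3, _, isMainVertex_of_mainPoint hp, ?_, _, mem_newtonPolygon hp', ?_, ?_⟩
    · have := newtonPolygon_subset (S := S)
        (convex_halfplane ω₁ ω₂ (ω₁ * p.1 + ω₂ * p.2)) fun p' hp' w h1' h2' => by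
          have h7 : (ω₁ * p.1 + ω₂ * p.2 : ℝ) ≤ ω₁ * p'.1 + ω₂ * p'.2 := by
            exact_mod_cast h4 p' hp'
          have hω₁ : (0 : ℝ) < ω₁ := by exact_mod_cast h1
          have hω₂ : (0 : ℝ) < ω₂ := by exact_mod_cast h2
          simp only [Set.mem_ofPred_eq]
          nlinarith
      exact fun w hw => this hw
    · intro e
      rw [Prod.mk.injEq] at e
      exact hne (Prod.ext (by exact_mod_cast e.1) (by exact_mod_cast e.2))
    · dsimp only
      exact_mod_cast heq

theorem neg_one_le_of_mem_support (hp : p ∈ S.support) : -1 ≤ p.1 ∧ -1 ≤ p.2 := by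
  obtain ⟨k, l, ⟨rfl, -⟩ | ⟨rfl, -⟩⟩ := hp <;> dsimp only <;> omega

theorem MainPoint.exists_isMainWeight (hp : S.MainPoint p) (hh : ¬ S.MainSegmentHorizontal) :
    ∃ ω₁ ω₂, S.IsMainWeight ω₁ ω₂ := by
  rw [hp.horizontal_iff] at hh
  push Not at hh
  obtain ⟨p₁, hp₁, hlt₁⟩ := hh
  -- candidates for the second vertex
  let A : Set (ℤ × ℤ) := {p' ∈ S.support | p'.2 < p.2 ∧
    (p'.1 - p.1) * (p.2 - p₁.2) ≤ (p₁.1 - p.1) * (p.2 - p'.2)}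
  have hgt : ∀ p' ∈ S.support, p'.2 < p.2 → p.1 < p'.1 := fun p' hp' hlt =>
    lt_of_le_of_ne (hp.2 p' hp').1 fun e => by have := (hp.2 p' hp').2 e.symm; omega
  -- Candidates lie no farther right per unit of descent than p₁, and the descent is at most p.2 +
  -- 1; both coordinates are therefore bounded.
  have hAfin : A.Finite := by
    refine Set.Finite.subset (Set.finite_Icc ((-1, -1) : ℤ × ℤ)
      (p.1 + (p₁.1 - p.1) * (p.2 + 1), p.2)) ?_
    rintro p' ⟨hp', hlt, hle⟩
    have h1 := neg_one_le_of_mem_support hp'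
    have h2 := hgt p₁ hp₁ hlt₁
    have h3 := hgt p' hp' hlt
    refine ⟨h1, ?_, hlt.le⟩
    dsimp only
    nlinarith
  obtain ⟨p₂, ⟨hp₂, hlt₂, hle₂⟩, hmin⟩ := Set.exists_min_image A
    (fun p' => ((p'.1 - p.1 : ℤ) : ℚ) / ((p.2 - p'.2 : ℤ) : ℚ)) hAfin ⟨p₁, hp₁, hlt₁, le_rfl⟩
  have hmin' : ∀ p' ∈ S.support, p'.2 < p.2 →
      (p₂.1 - p.1) * (p.2 - p'.2) ≤ (p'.1 - p.1) * (p.2 - p₂.2) := by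
    intro p' hp' hlt
    by_cases hA : p' ∈ A
    · have h1 := hmin p' hA
      rw [div_le_div_iff₀ (by exact_mod_cast (by omega : 0 < p.2 - p₂.2))
        (by exact_mod_cast (by omega : 0 < p.2 - p'.2))] at h1
      exact_mod_cast h1
    · have hlt' : (p₁.1 - p.1) * (p.2 - p'.2) < (p'.1 - p.1) * (p.2 - p₁.2) := by
        by_contra hcon
        exact hA ⟨hp', hlt, not_lt.1 hcon⟩
      have e1 : 0 < p.2 - p₁.2 := by omega
      have e2 : 0 < p.2 - p₂.2 := by omega
      have e3 : 0 < p.2 - p'.2 := by omega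
      have h1 : ((p₂.1 - p.1) * (p.2 - p'.2)) * (p.2 - p₁.2) ≤
          ((p'.1 - p.1) * (p.2 - p₂.2)) * (p.2 - p₁.2) := by
        calc _ = ((p₂.1 - p.1) * (p.2 - p₁.2)) * (p.2 - p'.2) := by ring
          _ ≤ ((p₁.1 - p.1) * (p.2 - p₂.2)) * (p.2 - p'.2) := by gcongr
          _ = ((p₁.1 - p.1) * (p.2 - p'.2)) * (p.2 - p₂.2) := by ring
          _ ≤ ((p'.1 - p.1) * (p.2 - p₁.2)) * (p.2 - p₂.2) := by gcongr
          _ = _ := by ring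
      exact le_of_mul_le_mul_right h1 e1
  have hpos1 : 0 < p.2 - p₂.2 := by omega
  have hpos2 : 0 < p₂.1 - p.1 := by have := hgt p₂ hp₂ hlt₂; omega
  obtain ⟨a, ha⟩ := Int.eq_ofNat_of_zero_le hpos1.le
  obtain ⟨b, hb⟩ := Int.eq_ofNat_of_zero_le hpos2.le
  have ha0 : 0 < a := by omega
  have hb0 : 0 < b := by omega
  -- The normal to the segment from p to p₂ is (descent, advance); dividing by the gcd makes it
  -- primitive.
  obtain ⟨g, a', b', hg, hco, rfl, rfl⟩ := Nat.exists_coprime' (Nat.gcd_pos_of_pos_left b ha0)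
  have ha0' : 0 < a' := Nat.pos_of_mul_pos_right ha0
  have hb0' : 0 < b' := Nat.pos_of_mul_pos_right hb0
  have hgZ : (0 : ℤ) < g := by exact_mod_cast hg
  refine ⟨a', b', hp.isMainWeight_iff.2 ⟨ha0', hb0', hco, fun p' hp' => ?_, p₂, hp₂, ?_, ?_⟩⟩
  · have ha0Z : (0 : ℤ) < a' := by exact_mod_cast ha0'
    have hb0Z : (0 : ℤ) < b' := by exact_mod_cast hb0'
    by_cases hlt : p'.2 < p.2
    · have h1 := hmin' p' hp' hlt
      rw [ha, hb] at h1
      push_cast at h1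
      have h2 : (b' * (p.2 - p'.2)) * (g : ℤ) ≤ (a' * (p'.1 - p.1)) * g := by linarith
      have h3 := le_of_mul_le_mul_right h2 hgZ
      linarith
    · have h1 := (hp.2 p' hp').1
      push Not at hlt
      nlinarith
  · rintro rfl
    omega
  · push_cast at ha hb
    have h2 : (a' * (p₂.1 - p.1)) * (g : ℤ) = (b' * (p.2 - p₂.2)) * g := by
      rw [ha, hb]; ring
    have h3 := mul_right_cancel₀ hgZ.ne' h2
    linarith

end ConstrainedGerm

namespace ConstrainedGerm

/-! ### Strict transforms -/

theorem hasFDerivAt_xBlowUp (ω₁ ω₂ : ℕ) (σ : ℤˣ) (ξ : ℝ) (q : ℝ × ℝ) :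
    HasFDerivAt (xBlowUp ω₁ ω₂ σ ξ)
      (((((σ : ℤ) : ℝ) * (ω₁ * q.1 ^ (ω₁ - 1))) • ContinuousLinearMap.fst ℝ ℝ ℝ).prod
        ((ω₂ * q.1 ^ (ω₂ - 1) * (ξ + q.2)) • ContinuousLinearMap.fst ℝ ℝ ℝ +
          (q.1 ^ ω₂) • ContinuousLinearMap.snd ℝ ℝ ℝ)) q := by
  have hx : HasFDerivAt (fun q : ℝ × ℝ => q.1) (ContinuousLinearMap.fst ℝ ℝ ℝ) q := hasFDerivAt_fst
  have hy : HasFDerivAt (fun q : ℝ × ℝ => ξ + q.2) (ContinuousLinearMap.snd ℝ ℝ ℝ) q :=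
    hasFDerivAt_snd.const_add ξ
  have h1 := (hx.pow ω₁).const_mul ((σ : ℤ) : ℝ)
  have h2 := (hx.pow ω₂).mul hy
  refine (h1.prodMk h2).congr_fderiv ?_
  ext <;> (simp; try ring)

theorem fderiv_xBlowUp (ω₁ ω₂ : ℕ) (σ : ℤˣ) (ξ : ℝ) (q w : ℝ × ℝ) :
    fderiv ℝ (xBlowUp ω₁ ω₂ σ ξ) q w = (((σ : ℤ) : ℝ) * (ω₁ * q.1 ^ (ω₁ - 1)) * w.1,
      ω₂ * q.1 ^ (ω₂ - 1) * (ξ + q.2) * w.1 + q.1 ^ ω₂ * w.2) := by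
  rw [(hasFDerivAt_xBlowUp ω₁ ω₂ σ ξ q).fderiv]
  simp

theorem tendsto_add_snd (ξ : ℝ) :
    Tendsto (fun q : ℝ × ℝ => (q.1, ξ + q.2)) (𝓝 0) (𝓝 (0, ξ)) := by
  have h : Continuous fun q : ℝ × ℝ => (q.1, ξ + q.2) := by fun_prop
  simpa using h.tendsto 0

theorem analyticAt_add_snd {g : ℝ × ℝ → ℝ} {ξ : ℝ} (hg : AnalyticAt ℝ g (0, ξ)) :
    AnalyticAt ℝ (fun q : ℝ × ℝ => g (q.1, ξ + q.2)) 0 :=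
  hg.comp_of_eq (f := fun q : ℝ × ℝ => (q.1, ξ + q.2))
    (AnalyticAt.prod (by fun_prop) (AnalyticAt.fun_add analyticAt_const analyticAt_snd)) (by simp)

/-- Orders of vanishing add, so an infinite order of the product comes from a factor. The same fact
later shows that one-variable germs form a domain. -/
theorem eventually_zero_or_of_mul {a b : ℝ → ℝ} {t : ℝ} (ha : AnalyticAt ℝ a t)
    (hb : AnalyticAt ℝ b t) (h : ∀ᶠ v in 𝓝 t, a v * b v = 0) :
    (∀ᶠ v in 𝓝 t, a v = 0) ∨ (∀ᶠ v in 𝓝 t, b v = 0) := by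
  have h1 : analyticOrderAt (a * b) t = ⊤ := analyticOrderAt_eq_top.2 h
  rw [analyticOrderAt_mul ha hb] at h1
  rcases WithTop.add_eq_top.1 h1 with h2 | h2
  · exact Or.inl (analyticOrderAt_eq_top.1 h2)
  · exact Or.inr (analyticOrderAt_eq_top.1 h2)

/-- Primitivity of the transformed field is stated with ∂P/∂u on u = 0; this identifies it with the
u∂/∂u coefficient. -/
theorem deriv_x_mul {f : ℝ × ℝ → ℝ} {p : ℝ × ℝ → ℝ} (hp : AnalyticAt ℝ p 0)
    (h : ∀ᶠ q in 𝓝 (0 : ℝ × ℝ), f q = q.1 * p q) :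
    ∀ᶠ v in 𝓝 (0 : ℝ), deriv (fun u => f (u, v)) 0 = p (0, v) := by
  filter_upwards [eventually_slice (x := 0) (y := 0) hp.eventually_analyticAt,
    eventually_slice (x := 0) (y := 0) h.eventually_nhds] with v hv he
  have h1 : (fun u => f (u, v)) =ᶠ[𝓝 0] fun u => u * p (u, v) :=
    (Continuous.tendsto (by fun_prop : Continuous fun u : ℝ => (u, v)) 0).eventually he
  rw [h1.deriv_eq]
  have h2 : DifferentiableAt ℝ (fun u => p (u, v)) 0 :=
    DifferentiableAt.comp (f := fun u => (u, v)) (g := p) 0 hv.differentiableAt (by fun_prop)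
  simpa using ((hasDerivAt_id' (0 : ℝ)).fun_mul h2.hasDerivAt).deriv

/-- The support lies on or above the line `ω₁ r + ω₂ s = m`. -/
def Above (S : ConstrainedGerm) (ω₁ ω₂ : ℕ) (m : ℤ) : Prop :=
  ∀ p ∈ S.support, m ≤ ω₁ * p.1 + ω₂ * p.2

/-- The `x` component of the initial part of `δ X` of weight `m`, on the line `x = σ`. -/
def polyA (S : ConstrainedGerm) (ω₁ ω₂ : ℕ) (m : ℤ) (σ : ℤˣ) : Polynomial ℝ :=
  initPoly (fun q => S.δ q * S.P q) ω₁ ω₂ (m + ω₁) σ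

/-- The `y` component of the initial part of `δ X` of weight `m`, on the line `x = σ`. -/
def polyQ (S : ConstrainedGerm) (ω₁ ω₂ : ℕ) (m : ℤ) (σ : ℤˣ) : Polynomial ℝ :=
  initPoly (fun q => S.δ q * S.Q q) ω₁ ω₂ (m + ω₂) σ

/-- The component along the exceptional divisor of the blown up initial part of weight `m`. -/
def polyB (S : ConstrainedGerm) (ω₁ ω₂ : ℕ) (m : ℤ) (σ : ℤˣ) : Polynomial ℝ :=
  S.polyQ ω₁ ω₂ m σ -
    Polynomial.C (((σ : ℤ) : ℝ) * (ω₂ / ω₁)) * (Polynomial.X * S.polyA ω₁ ω₂ m σ)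

variable {S T : ConstrainedGerm} {ω₁ ω₂ : ℕ} {m : ℤ} {σ : ℤˣ} {ξ : ℝ} {p : ℤ × ℤ}

theorem mem_support_P {k l : ℕ} (h : taylorCoeff (fun q => S.δ q * S.P q) k l ≠ 0) :
    ((k : ℤ) - 1, (l : ℤ)) ∈ S.support := ⟨k, l, Or.inl ⟨rfl, h⟩⟩

theorem mem_support_Q {k l : ℕ} (h : taylorCoeff (fun q => S.δ q * S.Q q) k l ≠ 0) :
    ((k : ℤ), (l : ℤ) - 1) ∈ S.support := ⟨k, l, Or.inr ⟨rfl, h⟩⟩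

theorem Above.weight_P (h : S.Above ω₁ ω₂ m) (k l : ℕ)
    (hk : taylorCoeff (fun q => S.δ q * S.P q) k l ≠ 0) : m + ω₁ ≤ ω₁ * k + ω₂ * l := by
  have := h _ (mem_support_P hk)
  dsimp only at this
  linarith

theorem Above.weight_Q (h : S.Above ω₁ ω₂ m) (k l : ℕ)
    (hk : taylorCoeff (fun q => S.δ q * S.Q q) k l ≠ 0) : m + ω₂ ≤ ω₁ * k + ω₂ * l := by
  have := h _ (mem_support_Q hk)
  dsimp only at this
  linarith

theorem above_of_weights
    (hP : ∀ k l, taylorCoeff (fun q => S.δ q * S.P q) k l ≠ 0 → m + ω₁ ≤ ω₁ * k + ω₂ * l)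
    (hQ : ∀ k l, taylorCoeff (fun q => S.δ q * S.Q q) k l ≠ 0 → m + ω₂ ≤ ω₁ * k + ω₂ * l) :
    S.Above ω₁ ω₂ m := by
  rintro p ⟨k, l, ⟨rfl, h⟩ | ⟨rfl, h⟩⟩
  · have := hP k l h; dsimp only; linarith
  · have := hQ k l h; dsimp only; linarith

theorem polyA_coeff_ne_zero {l : ℕ} (h : (S.polyA ω₁ ω₂ m σ).coeff l ≠ 0) :
    ∃ p ∈ S.support, p.2 = l ∧ ω₁ * p.1 + ω₂ * p.2 = m := by
  obtain ⟨k, hk, hc⟩ := exists_of_initPoly_coeff_ne_zero h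
  exact ⟨_, mem_support_P hc, rfl, by dsimp only; linarith⟩

theorem polyQ_coeff_ne_zero {l : ℕ} (h : (S.polyQ ω₁ ω₂ m σ).coeff l ≠ 0) :
    ∃ p ∈ S.support, p.2 + 1 = l ∧ ω₁ * p.1 + ω₂ * p.2 = m := by
  obtain ⟨k, hk, hc⟩ := exists_of_initPoly_coeff_ne_zero h
  exact ⟨_, mem_support_Q hc, by simp, by dsimp only; linarith⟩

theorem coeff_ne_zero_of_mem_support (h₁ : 0 < ω₁) (h₂ : 0 < ω₂) (hp : p ∈ S.support)
    (hm : ω₁ * p.1 + ω₂ * p.2 = m) (σ : ℤˣ) :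
    (∃ l : ℕ, p.2 = l ∧ (S.polyA ω₁ ω₂ m σ).coeff l ≠ 0) ∨
      (∃ l : ℕ, p.2 + 1 = l ∧ (S.polyQ ω₁ ω₂ m σ).coeff l ≠ 0) := by
  obtain ⟨k, l, ⟨rfl, h⟩ | ⟨rfl, h⟩⟩ := hp
  · refine Or.inl ⟨l, rfl, ?_⟩
    rw [polyA, initPoly_coeff h₁ h₂ (k := k) (by dsimp only at hm; linarith)]
    exact mul_ne_zero h (pow_ne_zero _ (unit_ne_zero σ))
  · refine Or.inr ⟨l, by simp, ?_⟩
    rw [polyQ, initPoly_coeff h₁ h₂ (k := k) (by dsimp only at hm; linarith)]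
    exact mul_ne_zero h (pow_ne_zero _ (unit_ne_zero σ))

theorem analytic_δP (S : ConstrainedGerm) : AnalyticAt ℝ (fun q => S.δ q * S.P q) 0 :=
  S.analytic_δ.fun_mul S.analytic_P

theorem analytic_δQ (S : ConstrainedGerm) : AnalyticAt ℝ (fun q => S.δ q * S.Q q) 0 :=
  S.analytic_δ.fun_mul S.analytic_Q

/-- The field of the strict transform in the logarithmic basis. -/
theorem IsXTransform.exists_log (hT : S.IsXTransform ω₁ ω₂ σ ξ T) (h₁ : 0 < ω₁) (h₂ : 0 < ω₂) :
    ∃ p : ℝ × ℝ → ℝ, AnalyticAt ℝ p 0 ∧ (∀ᶠ q in 𝓝 (0 : ℝ × ℝ), T.P q = q.1 * p q) ∧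
      ∃ d : ℤ, ∀ᶠ q in 𝓝 (0 : ℝ × ℝ), q.1 ≠ 0 →
        S.P (xBlowUp ω₁ ω₂ σ ξ q) = q.1 ^ (d + ω₁) * (((σ : ℤ) : ℝ) * ω₁ * p q) ∧
        S.Q (xBlowUp ω₁ ω₂ σ ξ q) = q.1 ^ (d + ω₂) * (T.Q q + ω₂ * (ξ + q.2) * p q) := by
  obtain ⟨p, hp, hpe⟩ := exists_eq_x_mul T.analytic_P (T.invariant_x hT.divX)
  obtain ⟨d, hd⟩ := hT.field
  refine ⟨p, hp, hpe, d, ?_⟩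
  filter_upwards [hpe, hd] with q hq hdq hq0
  have h := hdq hq0
  rw [fderiv_xBlowUp] at h
  simp only [X, hq, Prod.smul_mk, Prod.mk.injEq, smul_eq_mul] at h
  have e1 : q.1 ^ (ω₁ - 1) * q.1 = q.1 ^ ω₁ := by rw [← pow_succ, Nat.sub_add_cancel h₁]
  have e2 : q.1 ^ (ω₂ - 1) * q.1 = q.1 ^ ω₂ := by rw [← pow_succ, Nat.sub_add_cancel h₂]
  rw [h.1, h.2, zpow_add₀ hq0, zpow_add₀ hq0, zpow_natCast, zpow_natCast, ← e1, ← e2]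
  constructor <;> ring

/-- The strict transform on the exceptional divisor is given by the initial part of `δ X`. -/
theorem IsXTransform.exists_log_initial (hT : S.IsXTransform ω₁ ω₂ σ ξ T) (h₁ : 0 < ω₁)
    (h₂ : 0 < ω₂) (hm : S.Above ω₁ ω₂ m) (hp : p ∈ S.support) (hpm : ω₁ * p.1 + ω₂ * p.2 = m) :
    ∃ p : ℝ × ℝ → ℝ, AnalyticAt ℝ p 0 ∧ (∀ᶠ q in 𝓝 (0 : ℝ × ℝ), T.P q = q.1 * p q) ∧
      (∀ᶠ v in 𝓝 (0 : ℝ), ((σ : ℤ) : ℝ) * ω₁ * (T.δ (0, v) * p (0, v)) =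
        (S.polyA ω₁ ω₂ m σ).eval (ξ + v)) ∧
      (∀ᶠ v in 𝓝 (0 : ℝ), T.δ (0, v) * T.Q (0, v) = (S.polyB ω₁ ω₂ m σ).eval (ξ + v)) := by
  obtain ⟨P, hP, hPe, d, hd⟩ := hT.exists_log h₁ h₂
  obtain ⟨d', hd'⟩ := hT.impasse
  refine ⟨P, hP, hPe, ?_⟩
  obtain ⟨gF, hgF, hFe, hF0⟩ := exists_weighted_quotient S.analytic_δP h₁ h₂ σ hm.weight_P
  obtain ⟨gG, hgG, hGe, hG0⟩ := exists_weighted_quotient S.analytic_δQ h₁ h₂ σ hm.weight_Q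
  have hFe' := (tendsto_add_snd ξ).eventually (hFe ξ)
  have hGe' := (tendsto_add_snd ξ).eventually (hGe ξ)
  have aF := analyticAt_add_snd (hgF ξ)
  have aG := analyticAt_add_snd (hgG ξ)
  let Φ : ℝ × ℝ → ℝ := fun q => ((σ : ℤ) : ℝ) * ω₁ * (T.δ q * P q)
  let Ψ : ℝ × ℝ → ℝ := fun q => T.δ q * (T.Q q + ω₂ * (ξ + q.2) * P q)
  have aΦ : AnalyticAt ℝ Φ 0 := analyticAt_const.fun_mul (T.analytic_δ.fun_mul hP)
  have aΨ : AnalyticAt ℝ Ψ 0 := T.analytic_δ.fun_mul (T.analytic_Q.fun_add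
    (AnalyticAt.fun_mul (by fun_prop) hP))
  have eF : ∀ᶠ q in 𝓝 (0 : ℝ × ℝ), q.1 ≠ 0 →
      q.1 ^ (d + d' + ω₁) * Φ q = q.1 ^ (m + ω₁) * gF (q.1, ξ + q.2) := by
    filter_upwards [hd, hd', hFe'] with q h1 h2 h3 hq0
    have h3 := h3 hq0
    change S.δ (xBlowUp ω₁ ω₂ σ ξ q) * S.P (xBlowUp ω₁ ω₂ σ ξ q) = _ at h3
    rw [← h3, h2, (h1 hq0).1, add_right_comm, zpow_add₀ hq0 _ (d' : ℤ), zpow_natCast]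
    ring
  have eG : ∀ᶠ q in 𝓝 (0 : ℝ × ℝ), q.1 ≠ 0 →
      q.1 ^ (d + d' + ω₂) * Ψ q = q.1 ^ (m + ω₂) * gG (q.1, ξ + q.2) := by
    filter_upwards [hd, hd', hGe'] with q h1 h2 h3 hq0
    have h3 := h3 hq0
    change S.δ (xBlowUp ω₁ ω₂ σ ξ q) * S.Q (xBlowUp ω₁ ω₂ σ ξ q) = _ at h3
    rw [← h3, h2, (h1 hq0).2, add_right_comm, zpow_add₀ hq0 _ (d' : ℤ), zpow_natCast]
    ring
  have hω₁ : (ω₁ : ℝ) ≠ 0 := by exact_mod_cast h₁.ne'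
  have hsl : ∀ {g : ℝ × ℝ → ℝ}, AnalyticAt ℝ g 0 → AnalyticAt ℝ (fun v => g (0, v)) 0 :=
    fun {g} hg => analyticAt_slice (x := 0) (y := 0) hg
  -- A smaller exponent would make the transformed field vanish on the divisor, against primitivity;
  -- a larger one would make the initial part of weight m vanish, although p lies on the line.
  have hdm : d + d' = m := by
    rcases lt_trichotomy (d + d') m with hlt | heq | hgt
    · exfalso
      have z1 := eventually_eq_zero_of_zpow_mul_eq (t := 0) aΦ aF (by omega) eF
      have z2 := eventually_eq_zero_of_zpow_mul_eq (t := 0) aΨ aG (by omega) eG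
      have hδ : ¬ ∀ᶠ v in 𝓝 (0 : ℝ), T.δ (0, v) = 0 := fun h => hT.impasse_primitive (by
        filter_upwards [h] with v hv; simpa using hv)
      have zP : ∀ᶠ v in 𝓝 (0 : ℝ), P (0, v) = 0 := by
        refine (eventually_zero_or_of_mul (hsl T.analytic_δ) (hsl hP) ?_).resolve_left hδ
        filter_upwards [z1] with v hv
        have : ((σ : ℤ) : ℝ) * ω₁ ≠ 0 := mul_ne_zero (unit_ne_zero σ) hω₁
        exact (mul_eq_zero.1 hv).resolve_left this
      have zQ : ∀ᶠ v in 𝓝 (0 : ℝ), T.Q (0, v) = 0 := by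
        refine (eventually_zero_or_of_mul (hsl T.analytic_δ) (hsl T.analytic_Q) ?_).resolve_left hδ
        filter_upwards [z2, zP] with v hv hv'
        simpa [Ψ, hv'] using hv
      refine hT.field_primitive ?_
      filter_upwards [zP, zQ, deriv_x_mul hP hPe] with v h1 h2 h3
      simp [h1, h2, h3]
    · exact heq
    · exfalso
      have z1 := eventually_eq_zero_of_zpow_mul_eq (t := 0) aF aΦ (D₁ := m + ω₁)
        (D₂ := d + d' + ω₁) (by omega) (by
          filter_upwards [eF] with q h hq using (h hq).symm)
      have z2 := eventually_eq_zero_of_zpow_mul_eq (t := 0) aG aΨ (D₁ := m + ω₂)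
        (D₂ := d + d' + ω₂) (by omega) (by
          filter_upwards [eG] with q h hq using (h hq).symm)
      have hlim : Tendsto (fun t : ℝ => -ξ + t) (𝓝 ξ) (𝓝 0) := by
        have : Continuous fun t : ℝ => -ξ + t := by fun_prop
        simpa using this.tendsto ξ
      have pA : S.polyA ω₁ ω₂ m σ = 0 := by
        refine polynomial_eq_zero_of_eventually (t := ξ) ?_
        filter_upwards [hlim.eventually z1] with v hv
        rw [polyA, ← hF0]; simpa using hv
      have pQ : S.polyQ ω₁ ω₂ m σ = 0 := by
        refine polynomial_eq_zero_of_eventually (t := ξ) ?_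
        filter_upwards [hlim.eventually z2] with v hv
        rw [polyQ, ← hG0]; simpa using hv
      rcases coeff_ne_zero_of_mem_support h₁ h₂ hp hpm σ with ⟨l, -, hl⟩ | ⟨l, -, hl⟩
      · rw [pA] at hl; simp at hl
      · rw [pQ] at hl; simp at hl
  rw [hdm] at eF eG
  have e1 := eventually_slice (x := 0) (y := 0) (eventuallyEq_of_zpow_mul_eq aΦ aF eF)
  have e2 := eventually_slice (x := 0) (y := 0) (eventuallyEq_of_zpow_mul_eq aΨ aG eG)
  refine ⟨?_, ?_⟩
  · filter_upwards [e1] with v hv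
    rw [polyA, ← hF0]; exact hv
  · filter_upwards [e1, e2] with v hv hv'
    have hA : (S.polyA ω₁ ω₂ m σ).eval (ξ + v) = Φ (0, v) := by rw [polyA, ← hF0]; exact hv.symm
    have hQ : (S.polyQ ω₁ ω₂ m σ).eval (ξ + v) = Ψ (0, v) := by rw [polyQ, ← hG0]; exact hv'.symm
    simp only [polyB, Polynomial.eval_sub, Polynomial.eval_mul, Polynomial.eval_C, Polynomial.eval_X,
      hA, hQ, Φ, Ψ]
    have := unit_mul_self σ
    field_simp
    linear_combination (ω₂ * T.δ (0, v) * (ξ + v) * P (0, v)) * this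

/-- The germ `δ` does not vanish identically, and neither does the field `X`. -/
def NonTrivial (S : ConstrainedGerm) : Prop :=
  (¬ ∀ᶠ q in 𝓝 (0 : ℝ × ℝ), S.δ q = 0) ∧ ¬ ∀ᶠ q in 𝓝 (0 : ℝ × ℝ), S.P q = 0 ∧ S.Q q = 0

/-- Divide δ and the two components of X by their weighted orders, measured in the logarithmic
basis, then solve the triangular system given by the derivative of the blow-up for the coefficients
of u∂/∂u and ∂/∂v. -/
theorem exists_isXTransform (hS : S.NonTrivial) (h₁ : 0 < ω₁) (h₂ : 0 < ω₂) (σ : ℤˣ) (ξ : ℝ) :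
    ∃ T, S.IsXTransform ω₁ ω₂ σ ξ T := by
  classical
  obtain ⟨D, hD, k₀, l₀, hkl₀, hc₀⟩ := exists_weighted_order S.analytic_δ hS.1 ω₁ ω₂
  obtain ⟨gD, hgD, hDe, hD0⟩ := exists_weighted_quotient S.analytic_δ h₁ h₂ σ (D := D)
    (fun k l h => by exact_mod_cast hD k l h)
  -- The logarithmic weight can be negative; adding ω₁ + ω₂ keeps the minimization inside ℕ.
  have hex : ∃ n k l : ℕ, (taylorCoeff S.P k l ≠ 0 ∧ ω₁ * k + ω₂ * l + ω₂ = n) ∨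
      (taylorCoeff S.Q k l ≠ 0 ∧ ω₁ * k + ω₂ * l + ω₁ = n) := by
    by_contra hcon
    push Not at hcon
    have zP : ∀ᶠ q in 𝓝 (0 : ℝ × ℝ), S.P q = 0 :=
      eventually_eq_zero_of_taylorCoeff S.analytic_P fun k l => by
        by_contra h; exact (hcon _ k l).1 h rfl
    have zQ : ∀ᶠ q in 𝓝 (0 : ℝ × ℝ), S.Q q = 0 :=
      eventually_eq_zero_of_taylorCoeff S.analytic_Q fun k l => by
        by_contra h; exact (hcon _ k l).2 h rfl
    exact hS.2 (zP.and zQ)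
  obtain ⟨n, hn, hmin⟩ : ∃ n : ℕ, (∃ k l : ℕ, (taylorCoeff S.P k l ≠ 0 ∧ ω₁ * k + ω₂ * l + ω₂ = n) ∨
      (taylorCoeff S.Q k l ≠ 0 ∧ ω₁ * k + ω₂ * l + ω₁ = n)) ∧ ∀ k l,
      (taylorCoeff S.P k l ≠ 0 → n ≤ ω₁ * k + ω₂ * l + ω₂) ∧
      (taylorCoeff S.Q k l ≠ 0 → n ≤ ω₁ * k + ω₂ * l + ω₁) :=
    ⟨Nat.find hex, Nat.find_spec hex, fun k l =>
      ⟨fun h => Nat.find_min' hex ⟨k, l, Or.inl ⟨h, rfl⟩⟩,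
        fun h => Nat.find_min' hex ⟨k, l, Or.inr ⟨h, rfl⟩⟩⟩⟩
  set e : ℤ := (n : ℤ) - ω₁ - ω₂ with he
  have wP : ∀ k l, taylorCoeff S.P k l ≠ 0 → e + ω₁ ≤ ω₁ * k + ω₂ * l := fun k l h => by
    have : (n : ℤ) ≤ ω₁ * k + ω₂ * l + ω₂ := by exact_mod_cast (hmin k l).1 h
    omega
  have wQ : ∀ k l, taylorCoeff S.Q k l ≠ 0 → e + ω₂ ≤ ω₁ * k + ω₂ * l := fun k l h => by
    have : (n : ℤ) ≤ ω₁ * k + ω₂ * l + ω₁ := by exact_mod_cast (hmin k l).2 h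
    omega
  obtain ⟨gP, hgP, hPe, hP0⟩ := exists_weighted_quotient S.analytic_P h₁ h₂ σ wP
  obtain ⟨gQ, hgQ, hQe, hQ0⟩ := exists_weighted_quotient S.analytic_Q h₁ h₂ σ wQ
  have hω₁ : (ω₁ : ℝ) ≠ 0 := by exact_mod_cast h₁.ne'
  have hσ := unit_mul_self σ
  set s : ℝ := ((σ : ℤ) : ℝ) with hs
  let p : ℝ × ℝ → ℝ := fun q => s / ω₁ * gP (q.1, ξ + q.2)
  have hp : AnalyticAt ℝ p 0 := analyticAt_const.fun_mul (analyticAt_add_snd (hgP ξ))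
  let R : ℝ × ℝ → ℝ := fun q => gQ (q.1, ξ + q.2) - ω₂ * (ξ + q.2) * p q
  have hR : AnalyticAt ℝ R 0 :=
    (analyticAt_add_snd (hgQ ξ)).fun_sub (AnalyticAt.fun_mul (by fun_prop) hp)
  have hPe' := (tendsto_add_snd ξ).eventually (hPe ξ)
  have hQe' := (tendsto_add_snd ξ).eventually (hQe ξ)
  have hDe' := (tendsto_add_snd ξ).eventually (hDe ξ)
  have hinvY : S.divY ∧ ξ = 0 → ∀ᶠ u in 𝓝 (0 : ℝ), R (u, 0) = 0 := by
    rintro ⟨hdiv, rfl⟩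
    have hsl : AnalyticAt ℝ (fun u => R (u, 0)) 0 :=
      hR.comp (f := fun u : ℝ => (u, (0 : ℝ))) (x := 0) (analyticAt_id.prod analyticAt_const)
    have h0 : ∀ᶠ u in 𝓝 (0 : ℝ), S.Q (s * u ^ ω₁, 0) = 0 := by
      have hc : Continuous fun u : ℝ => s * u ^ ω₁ := by fun_prop
      exact (by simpa [h₁.ne'] using hc.tendsto 0 :
        Tendsto (fun u : ℝ => s * u ^ ω₁) (𝓝 0) (𝓝 0)).eventually (S.invariant_y hdiv)
    have h1 : ∀ᶠ u in 𝓝 (0 : ℝ), u ≠ 0 → S.Q (s * u ^ ω₁, 0) = u ^ (e + ω₂) * R (u, 0) := by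
      have hc : Continuous fun u : ℝ => (u, (0 : ℝ)) := by fun_prop
      filter_upwards [(hc.tendsto 0).eventually hQe'] with u hu hu0
      simpa [R] using hu hu0
    refine hsl.frequently_zero_iff_eventually_zero.1 (Eventually.frequently ?_)
    rw [eventually_nhdsWithin_iff]
    filter_upwards [h0, h1] with u hu hu' hu0
    have := hu' hu0
    rw [hu] at this
    exact (mul_eq_zero.1 this.symm).resolve_left (zpow_ne_zero _ hu0)
  let T : ConstrainedGerm :=
    { δ := fun q => gD (q.1, ξ + q.2)
      P := fun q => q.1 * p q
      Q := R
      divX := True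
      divY := S.divY ∧ ξ = 0
      analytic_δ := analyticAt_add_snd (hgD ξ)
      analytic_P := AnalyticAt.fun_mul (by fun_prop) hp
      analytic_Q := hR
      invariant_x := fun _ => by simp
      invariant_y := hinvY }
  have hlim : Tendsto (fun t : ℝ => -ξ + t) (𝓝 ξ) (𝓝 0) := by
    have : Continuous fun t : ℝ => -ξ + t := by fun_prop
    simpa using this.tendsto ξ
  refine ⟨T, ⟨D, ?_⟩, ?_, ⟨e, ?_⟩, ?_, trivial, Iff.rfl⟩
  · have hc : AnalyticAt ℝ (fun q => S.δ (xBlowUp ω₁ ω₂ σ ξ q)) 0 := by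
      refine AnalyticAt.comp_of_eq S.analytic_δ (f := xBlowUp ω₁ ω₂ σ ξ) ?_ ?_
      · exact AnalyticAt.prod (f := fun q : ℝ × ℝ => s * q.1 ^ ω₁)
          (g := fun q : ℝ × ℝ => q.1 ^ ω₂ * (ξ + q.2)) (by fun_prop) (by fun_prop)
      · simp [xBlowUp, h₁.ne', h₂.ne']
    have hc2 : AnalyticAt ℝ (fun q : ℝ × ℝ => q.1 ^ D * gD (q.1, ξ + q.2)) 0 :=
      AnalyticAt.fun_mul (by fun_prop) (analyticAt_add_snd (hgD ξ))
    refine eventuallyEq_of_off_divisor hc hc2 ?_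
    filter_upwards [hDe'] with q hq hq0
    rw [← zpow_natCast]
    exact hq hq0
  · intro h
    refine initPoly_ne_zero (σ := σ) h₁ h₂ (D := D) (k := k₀) (l := l₀) (by exact_mod_cast hkl₀) hc₀
      (polynomial_eq_zero_of_eventually (t := ξ) ?_)
    filter_upwards [hlim.eventually h] with v hv
    rw [← hD0]
    simpa [T] using hv
  · filter_upwards [hPe', hQe'] with q h1 h2 hq0
    have e1 : q.1 ^ (ω₁ - 1) * q.1 = q.1 ^ ω₁ := by rw [← pow_succ, Nat.sub_add_cancel h₁]
    have e2 : q.1 ^ (ω₂ - 1) * q.1 = q.1 ^ ω₂ := by rw [← pow_succ, Nat.sub_add_cancel h₂]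
    rw [fderiv_xBlowUp]
    refine Prod.ext ?_ ?_
    · refine (h1 hq0).trans ?_
      rw [zpow_add₀ hq0, zpow_natCast, ← e1]
      simp only [X, T, p, Prod.smul_mk, smul_eq_mul, ← hs]
      field_simp
      linear_combination (-gP (q.1, ξ + q.2)) * hσ
    · refine (h2 hq0).trans ?_
      rw [zpow_add₀ hq0, zpow_natCast, ← e2]
      simp only [X, T, R, Prod.smul_mk, smul_eq_mul]
      ring
  · intro h
    have hz := deriv_x_mul (f := T.P) hp (Eventually.of_forall fun q => rfl)
    have zP : ∀ᶠ v in 𝓝 (0 : ℝ), gP (0, ξ + v) = 0 := by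
      filter_upwards [h, hz] with v hv hv'
      push Not at hv
      rw [hv'] at hv
      have : s / ω₁ ≠ 0 := div_ne_zero (unit_ne_zero σ) hω₁
      exact (mul_eq_zero.1 hv.1).resolve_left this
    have zQ : ∀ᶠ v in 𝓝 (0 : ℝ), gQ (0, ξ + v) = 0 := by
      filter_upwards [h, zP] with v hv hv'
      push Not at hv
      simpa [T, R, p, hv'] using hv.2
    obtain ⟨k, l, ⟨hc, hkl⟩ | ⟨hc, hkl⟩⟩ := hn
    · refine initPoly_ne_zero (σ := σ) h₁ h₂ (D := e + ω₁) (k := k) (l := l) ?_ hc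
        (polynomial_eq_zero_of_eventually (t := ξ) ?_)
      · rw [he, ← hkl]; push_cast; ring
      · filter_upwards [hlim.eventually zP] with v hv
        rw [← hP0]
        simpa using hv
    · refine initPoly_ne_zero (σ := σ) h₁ h₂ (D := e + ω₂) (k := k) (l := l) ?_ hc
        (polynomial_eq_zero_of_eventually (t := ξ) ?_)
      · rw [he, ← hkl]; push_cast; ring
      · filter_upwards [hlim.eventually zQ] with v hv
        rw [← hQ0]
        simpa using hv

end ConstrainedGerm

namespace ConstrainedGerm

variable {S T : ConstrainedGerm} {ω₁ ω₂ : ℕ} {m : ℤ} {σ : ℤˣ} {ξ : ℝ} {p : ℤ × ℤ}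

/-! ### Sufficient conditions for elementary points -/

theorem fderiv_apply_snd {f : ℝ × ℝ → ℝ} {x y : ℝ} (hf : DifferentiableAt ℝ f (x, y)) :
    fderiv ℝ f (x, y) (0, 1) = deriv (fun v => f (x, v)) y := by
  have h1 : HasDerivAt (fun v : ℝ => (x, v)) ((0 : ℝ), (1 : ℝ)) y :=
    (hasDerivAt_const y x).prodMk (hasDerivAt_id' y)
  exact (hf.hasFDerivAt.comp_hasDerivAt y h1).deriv.symm

theorem fderiv_apply_fst {f : ℝ × ℝ → ℝ} {x y : ℝ} (hf : DifferentiableAt ℝ f (x, y)) :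
    fderiv ℝ f (x, y) (1, 0) = deriv (fun u => f (u, y)) x := by
  have h1 : HasDerivAt (fun u : ℝ => (u, y)) ((1 : ℝ), (0 : ℝ)) x :=
    (hasDerivAt_id' x).prodMk (hasDerivAt_const x y)
  exact (hf.hasFDerivAt.comp_hasDerivAt x h1).deriv.symm

theorem fderiv_X_apply (S : ConstrainedGerm) (w : ℝ × ℝ) :
    fderiv ℝ S.X 0 w = (fderiv ℝ S.P 0 w, fderiv ℝ S.Q 0 w) := by
  have h := (S.analytic_P.differentiableAt.hasFDerivAt).prodMk
    (S.analytic_Q.differentiableAt.hasFDerivAt)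
  change fderiv ℝ (fun q => (S.P q, S.Q q)) 0 w = _
  rw [h.fderiv]
  rfl

theorem isSemiHyperbolic_of_eigenvector (h0 : S.X 0 = 0) {c : ℝ} (hc : c ≠ 0) {w : ℝ × ℝ}
    (hw : w ≠ 0) (h : fderiv ℝ S.X 0 w = c • w) : S.IsSemiHyperbolic := by
  refine ⟨h0, c, by simpa using hc, ?_⟩
  have h1 : Module.End.HasEigenvalue (fderiv ℝ S.X 0 : (ℝ × ℝ) →ₗ[ℝ] (ℝ × ℝ)) c :=
    Module.End.hasEigenvalue_of_hasEigenvector ⟨Module.End.mem_eigenspace_iff.2 h, hw⟩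
  have h2 : (fderiv ℝ S.X 0 : (ℝ × ℝ) →ₗ[ℝ] (ℝ × ℝ)).charpoly.IsRoot c :=
    (Module.End.hasEigenvalue_iff_isRoot_charpoly _ _).1 h1
  have h3 := Polynomial.aeval_algebraMap_apply ℂ c
    (fderiv ℝ S.X 0 : (ℝ × ℝ) →ₗ[ℝ] (ℝ × ℝ)).charpoly
  rw [Polynomial.coe_aeval_eq_eval, h2.eq_zero, map_zero] at h3
  exact h3

theorem isSemiHyperbolic_of_triangular (h0 : S.X 0 = 0) (hP : fderiv ℝ S.P 0 (0, 1) = 0)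
    (h : fderiv ℝ S.P 0 (1, 0) ≠ 0 ∨ fderiv ℝ S.Q 0 (0, 1) ≠ 0) : S.IsSemiHyperbolic := by
  by_cases hQ : fderiv ℝ S.Q 0 (0, 1) = 0
  · have ha := h.resolve_right (not_not.2 hQ)
    set a := fderiv ℝ S.P 0 (1, 0) with ha'
    set b := fderiv ℝ S.Q 0 (1, 0) with hb'
    -- With ∂P/∂y = ∂Q/∂y = 0 the linearization kills (0, 1) and sends (1, 0) to (a, b), hence (a,
    -- b) to a(a, b).
    refine isSemiHyperbolic_of_eigenvector h0 ha (w := (a, b)) (fun e => ha (Prod.ext_iff.1 e).1) ?_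
    have e : ((a, b) : ℝ × ℝ) = a • ((1, 0) : ℝ × ℝ) + b • ((0, 1) : ℝ × ℝ) := by simp
    rw [fderiv_X_apply]
    rw [e, map_add, map_add, map_smul, map_smul, map_smul, map_smul, hP, hQ, ← ha', ← hb']
    simp
  · refine isSemiHyperbolic_of_eigenvector h0 hQ (w := (0, 1)) (by simp) ?_
    rw [fderiv_X_apply, hP]
    simp

theorem IsSemiHyperbolic.swap (h : S.IsSemiHyperbolic) : S.swap.IsSemiHyperbolic := by
  obtain ⟨h0, μ, hμ, hr⟩ := h
  have hX : S.swap.X = fun q => (S.X q.swap).swap := by funext q; rfl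
  refine ⟨by simp [hX, h0], μ, hμ, ?_⟩
  let e : (ℝ × ℝ) ≃L[ℝ] (ℝ × ℝ) := ContinuousLinearEquiv.prodComm ℝ ℝ ℝ
  have hd : DifferentiableAt ℝ S.X 0 :=
    S.analytic_P.differentiableAt.prodMk S.analytic_Q.differentiableAt
  have h1 : HasFDerivAt (fun q : ℝ × ℝ => (S.X q.swap).swap)
      ((e : (ℝ × ℝ) →L[ℝ] (ℝ × ℝ)).comp ((fderiv ℝ S.X 0).comp (e : (ℝ × ℝ) →L[ℝ] (ℝ × ℝ)))) 0 := by
    have hd' : HasFDerivAt S.X (fderiv ℝ S.X 0) (e 0) := by simpa using hd.hasFDerivAt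
    exact e.hasFDerivAt.comp (0 : ℝ × ℝ) (hd'.comp (0 : ℝ × ℝ) e.hasFDerivAt)
  have h2 : ((fderiv ℝ S.swap.X 0 : (ℝ × ℝ) →L[ℝ] (ℝ × ℝ)) : (ℝ × ℝ) →ₗ[ℝ] (ℝ × ℝ)) =
      e.toLinearEquiv.conj (fderiv ℝ S.X 0 : (ℝ × ℝ) →ₗ[ℝ] (ℝ × ℝ)) := by
    rw [hX, h1.fderiv]
    rfl
  rw [h2, LinearEquiv.charpoly_conj]
  exact hr

theorem fderiv_comp_swap {f : ℝ × ℝ → ℝ} {q : ℝ × ℝ} (hf : DifferentiableAt ℝ f q.swap)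
    (w : ℝ × ℝ) : fderiv ℝ (fun q : ℝ × ℝ => f q.swap) q w = fderiv ℝ f q.swap w.swap := by
  let e : (ℝ × ℝ) ≃L[ℝ] (ℝ × ℝ) := ContinuousLinearEquiv.prodComm ℝ ℝ ℝ
  have h : HasFDerivAt (fun q : ℝ × ℝ => f q.swap) ((fderiv ℝ f q.swap).comp
      (e : (ℝ × ℝ) →L[ℝ] (ℝ × ℝ))) q := by
    have hf' : HasFDerivAt f (fderiv ℝ f q.swap) (e q) := hf.hasFDerivAt
    exact hf'.comp q e.hasFDerivAt
  rw [h.fderiv]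
  rfl

theorem IsElementary.swap (h : S.IsElementary) : S.swap.IsElementary := by
  have hd : DifferentiableAt ℝ S.δ (0 : ℝ × ℝ).swap := by
    simpa using S.analytic_δ.differentiableAt
  have hf : ∀ w : ℝ × ℝ, fderiv ℝ S.swap.δ 0 w = fderiv ℝ S.δ 0 w.swap := fun w => by
    have := fderiv_comp_swap hd w
    rwa [Prod.swap_zero] at this
  have hX0 : S.swap.X 0 = (S.X 0).swap := rfl
  have hf0 : fderiv ℝ S.swap.δ 0 = 0 → fderiv ℝ S.δ 0 = 0 := fun h => by
    refine ContinuousLinearMap.ext fun w => ?_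
    have := hf w.swap
    rw [h] at this
    simpa using this.symm
  have hδ0 : S.swap.δ 0 = S.δ 0 := rfl
  rcases h with h | ⟨h, h0⟩ | ⟨h, h0, h1, h2⟩
  · left
    intro hs
    apply h
    rcases hs with hs | ⟨hs, hs'⟩ | ⟨hs, hs'⟩
    · left
      rw [hX0] at hs
      have := congrArg Prod.swap hs
      simpa using this
    · exact Or.inr (Or.inl ⟨hs, hf0 hs'⟩)
    · refine Or.inr (Or.inr ⟨hs, ?_⟩)
      rw [hf, hX0] at hs'
      simpa using hs'
  · exact Or.inr (Or.inl ⟨h.swap, h0⟩)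
  · refine Or.inr (Or.inr ⟨h.swap, h0, fun h => h1 (hf0 h), ?_⟩)
    filter_upwards [eventually_swap h2, eventually_swap S.analytic_δ.eventually_analyticAt]
      with q hq hq' hq0
    exact (fderiv_comp_swap hq'.differentiableAt (S.swap.X q)).trans (hq hq0)

/-- A system with invariant `{x = 0}` whose polygon has main vertex `(0, s)`, `s ≤ 0`, is
elementary. -/
theorem isElementary_of_low {P : ℝ × ℝ → ℝ} (hP : AnalyticAt ℝ P 0)
    (hPe : ∀ᶠ q in 𝓝 (0 : ℝ × ℝ), T.P q = q.1 * P q)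
    (h : T.δ 0 * P 0 ≠ 0 ∨ T.δ 0 * T.Q 0 ≠ 0 ∨ deriv (fun v => T.δ (0, v) * T.Q (0, v)) 0 ≠ 0) :
    T.IsElementary := by
  have hP0 : T.P 0 = 0 := by simpa using hPe.self_of_nhds
  have hdP := T.analytic_P.differentiableAt
  have hdQ := T.analytic_Q.differentiableAt
  have hdδ := T.analytic_δ.differentiableAt
  have hPy : fderiv ℝ T.P 0 (0, 1) = 0 := by
    have h1 := fderiv_apply_snd (x := 0) (y := 0) hdP
    have h2 : (fun v => T.P (0, v)) =ᶠ[𝓝 0] fun _ => 0 := by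
      filter_upwards [eventually_slice (x := 0) (y := 0) hPe] with v hv
      simpa using hv
    rw [h2.deriv_eq, deriv_const] at h1
    exact h1
  have hPx : fderiv ℝ T.P 0 (1, 0) = P 0 :=
    (fderiv_apply_fst (x := 0) (y := 0) hdP).trans (deriv_x_mul hP hPe).self_of_nhds
  -- If Q(0) = 0 then δ(0) = 0 would give δQ a double zero on the divisor and contradict all
  -- alternatives; so δ(0) ≠ 0 and the triangular linearization has a nonzero eigenvalue. If Q(0) ≠
  -- 0 the field is tangent to the divisor and nonzero, and a zero of δ there is simple, so the
  -- field crosses the impasse set transversally.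
  by_cases hQ : T.Q 0 = 0
  · have hX : T.X 0 = 0 := Prod.ext hP0 hQ
    by_cases hδ : T.δ 0 = 0
    · exfalso
      simp only [hδ, zero_mul, ne_eq, not_true_eq_false, false_or] at h
      apply h
      have h1 : HasDerivAt (fun v => T.δ (0, v)) _ 0 :=
        ((analyticAt_slice (x := 0) (y := 0) T.analytic_δ).differentiableAt).hasDerivAt
      have h2 : HasDerivAt (fun v => T.Q (0, v)) _ 0 :=
        ((analyticAt_slice (x := 0) (y := 0) T.analytic_Q).differentiableAt).hasDerivAt
      have hδ' : T.δ (0, 0) = 0 := hδ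
      have hQ' : T.Q (0, 0) = 0 := hQ
      simpa [hδ', hQ'] using (h1.fun_mul h2).deriv
    · refine Or.inr (Or.inl ⟨isSemiHyperbolic_of_triangular hX hPy ?_, hδ⟩)
      rw [hPx]
      rcases h with h | h | h
      · exact Or.inl (right_ne_zero_of_mul h)
      · exact absurd hQ (right_ne_zero_of_mul h)
      · right
        intro hQy
        apply h
        have h1 : HasDerivAt (fun v => T.δ (0, v)) _ 0 :=
          ((analyticAt_slice (x := 0) (y := 0) T.analytic_δ).differentiableAt).hasDerivAt
        have h2 : HasDerivAt (fun v => T.Q (0, v)) _ 0 :=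
          ((analyticAt_slice (x := 0) (y := 0) T.analytic_Q).differentiableAt).hasDerivAt
        have h3 := fderiv_apply_snd (x := 0) (y := 0) hdQ
        rw [show ((0 : ℝ), (0 : ℝ)) = 0 from rfl, hQy] at h3
        have hQ' : T.Q (0, 0) = 0 := hQ
        simpa [hQ', ← h3] using (h1.fun_mul h2).deriv
  · left
    have hX : T.X 0 ≠ 0 := fun h => hQ (Prod.ext_iff.1 h).2
    have hXe : T.X 0 = T.Q 0 • ((0, 1) : ℝ × ℝ) := by
      refine Prod.ext ?_ ?_
      · simpa [X] using hP0
      · simp [X]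
    have key : T.δ 0 = 0 → fderiv ℝ T.δ 0 (0, 1) ≠ 0 := by
      intro hδ
      simp only [hδ, zero_mul, ne_eq, not_true_eq_false, false_or] at h
      intro hδy
      apply h
      have h1 : HasDerivAt (fun v => T.δ (0, v)) _ 0 :=
        ((analyticAt_slice (x := 0) (y := 0) T.analytic_δ).differentiableAt).hasDerivAt
      have h2 : HasDerivAt (fun v => T.Q (0, v)) _ 0 :=
        ((analyticAt_slice (x := 0) (y := 0) T.analytic_Q).differentiableAt).hasDerivAt
      have h3 := fderiv_apply_snd (x := 0) (y := 0) hdδ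
      rw [show ((0 : ℝ), (0 : ℝ)) = 0 from rfl, hδy] at h3
      have hδ' : T.δ (0, 0) = 0 := hδ
      simpa [hδ', ← h3] using (h1.fun_mul h2).deriv
    rintro (hs | ⟨hs, hs'⟩ | ⟨hs, hs'⟩)
    · exact hX hs
    · apply key hs; rw [hs']; rfl
    · rw [hXe, map_smul, smul_eq_mul] at hs'
      exact (mul_ne_zero hQ (key hs)) hs'

/-! ### The height of the strict transform -/

theorem taylorCoeff_zero_of_eval {f : ℝ × ℝ → ℝ} {A : Polynomial ℝ} {c : ℝ}
    (h : ∀ᶠ v in 𝓝 (0 : ℝ), c * f (0, v) = A.eval (ξ + v)) (hc : c ≠ 0) (l : ℕ) :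
    taylorCoeff f 0 l ≠ 0 ↔ (A.comp (Polynomial.X + Polynomial.C ξ)).coeff l ≠ 0 := by
  have h1 : ∀ᶠ v in 𝓝 (0 : ℝ), HasSum (fun l =>
      (c⁻¹ * (A.comp (Polynomial.X + Polynomial.C ξ)).coeff l) * v ^ l) (f (0, v)) := by
    filter_upwards [h] with v hv
    have h2 : f (0, v) = c⁻¹ * (A.comp (Polynomial.X + Polynomial.C ξ)).eval v := by
      rw [Polynomial.eval_comp]
      simp only [Polynomial.eval_add, Polynomial.eval_X, Polynomial.eval_C]
      rw [add_comm v, ← hv, inv_mul_cancel_left₀ hc]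
    rw [h2, Polynomial.eval_eq_sum_range, Finset.mul_sum]
    simp only [mul_assoc]
    refine hasSum_sum_of_ne_finset_zero fun l hl => ?_
    rw [Polynomial.coeff_eq_zero_of_natDegree_lt]
    · simp
    · simpa [Nat.lt_succ_iff] using hl
  have h2 := iteratedDeriv_eq_of_hasSum h1 l
  have hl : (l.factorial : ℝ) ≠ 0 := by positivity
  simp [taylorCoeff, h2, hl, hc]

theorem X_sub_C_pow_dvd_iff_coeff {A : Polynomial ℝ} {n : ℕ} :
    (Polynomial.X - Polynomial.C ξ) ^ n ∣ A ↔
      ∀ d < n, (A.comp (Polynomial.X + Polynomial.C ξ)).coeff d = 0 := by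
  rw [Polynomial.X_sub_C_pow_dvd_iff, Polynomial.X_pow_dvd_iff]

/-- The column r = 0 of the transformed support consists of the coefficients of A and B re-expanded
at ξ, and no point lies to its left because u divides the first component. A coefficient of A of
index i sits at height i, one of B of index j at height j - 1, which explains the exponents n and n
+ 1. -/
theorem IsXTransform.exists_height (hT : S.IsXTransform ω₁ ω₂ σ ξ T) (h₁ : 0 < ω₁)
    (h₂ : 0 < ω₂) (hm : S.Above ω₁ ω₂ m) (hp : p ∈ S.support) (hpm : ω₁ * p.1 + ω₂ * p.2 = m) :
    ∃ s : ℤ, T.MainPoint (0, s) ∧ (s ≤ 0 → T.IsElementary) ∧ ∀ n : ℕ, (n : ℤ) ≤ s ↔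
      (Polynomial.X - Polynomial.C ξ) ^ n ∣ S.polyA ω₁ ω₂ m σ ∧
      (Polynomial.X - Polynomial.C ξ) ^ (n + 1) ∣ S.polyB ω₁ ω₂ m σ := by
  classical
  obtain ⟨P, hP, hPe, hA, hB⟩ := hT.exists_log_initial h₁ h₂ hm hp hpm
  set A := S.polyA ω₁ ω₂ m σ with hAdef
  set B := S.polyB ω₁ ω₂ m σ with hBdef
  set A' := A.comp (Polynomial.X + Polynomial.C ξ) with hA'
  set B' := B.comp (Polynomial.X + Polynomial.C ξ) with hB'
  have hω₁ : (ω₁ : ℝ) ≠ 0 := by exact_mod_cast h₁.ne'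
  have hc : ((σ : ℤ) : ℝ) * ω₁ ≠ 0 := mul_ne_zero (unit_ne_zero σ) hω₁
  have cA : ∀ l, taylorCoeff (fun q => T.δ q * P q) 0 l ≠ 0 ↔ A'.coeff l ≠ 0 := fun l =>
    taylorCoeff_zero_of_eval (f := fun q => T.δ q * P q) hA hc l
  have cB : ∀ l, taylorCoeff (fun q => T.δ q * T.Q q) 0 l ≠ 0 ↔ B'.coeff l ≠ 0 := fun l =>
    taylorCoeff_zero_of_eval (f := fun q => T.δ q * T.Q q) (c := 1) (by simpa using hB) one_ne_zero l
  have hF : (fun q => T.δ q * T.P q) =ᶠ[𝓝 0] fun q => q.1 * (T.δ q * P q) := by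
    filter_upwards [hPe] with q hq
    rw [hq]; ring
  have cF0 : ∀ l, taylorCoeff (fun q => T.δ q * T.P q) 0 l = 0 := fun l => by
    rw [taylorCoeff_congr hF]
    exact taylorCoeff_x_zero (by simp) l
  have cF : ∀ k l, taylorCoeff (fun q => T.δ q * T.P q) (k + 1) l =
      taylorCoeff (fun q => T.δ q * P q) k l := fun k l => by
    rw [taylorCoeff_congr hF]
    exact taylorCoeff_x_mul (T.analytic_δ.fun_mul hP) k l
  have hne : ¬ (A = 0 ∧ B = 0) := by
    rintro ⟨h1, h2⟩
    have h3 : S.polyQ ω₁ ω₂ m σ = 0 := by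
      have h4 : B = S.polyQ ω₁ ω₂ m σ - _ := rfl
      rw [h2, ← hAdef, h1] at h4
      simpa using h4.symm
    rcases coeff_ne_zero_of_mem_support h₁ h₂ hp hpm σ with ⟨l, -, hl⟩ | ⟨l, -, hl⟩
    · rw [← hAdef, h1] at hl; simp at hl
    · rw [h3] at hl; simp at hl
  -- The index j is the height plus one, which is a natural number even when the height is -1.
  have hex : ∃ j, (∃ i, j = i + 1 ∧ A'.coeff i ≠ 0) ∨ B'.coeff j ≠ 0 := by
    by_contra hcon
    push Not at hcon
    refine hne ⟨?_, ?_⟩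
    · have hz : A' = 0 := Polynomial.ext fun i => by
        simpa using (hcon (i + 1)).1 i rfl
      rw [hA'] at hz
      have := congrArg (fun R => R.comp (Polynomial.X - Polynomial.C ξ)) hz
      simpa [Polynomial.comp_assoc] using this
    · have hz : B' = 0 := Polynomial.ext fun j => by simpa using (hcon j).2
      rw [hB'] at hz
      have := congrArg (fun R => R.comp (Polynomial.X - Polynomial.C ξ)) hz
      simpa [Polynomial.comp_assoc] using this
  obtain ⟨N, hN, hmin⟩ : ∃ N, ((∃ i, N = i + 1 ∧ A'.coeff i ≠ 0) ∨ B'.coeff N ≠ 0) ∧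
      ∀ j, ((∃ i, j = i + 1 ∧ A'.coeff i ≠ 0) ∨ B'.coeff j ≠ 0) → N ≤ j :=
    ⟨Nat.find hex, Nat.find_spec hex, fun j hj => Nat.find_min' hex hj⟩
  have hiff : ∀ n : ℕ, (n : ℤ) ≤ (N : ℤ) - 1 ↔
      (Polynomial.X - Polynomial.C ξ) ^ n ∣ A ∧ (Polynomial.X - Polynomial.C ξ) ^ (n + 1) ∣ B := by
    intro n
    rw [X_sub_C_pow_dvd_iff_coeff, X_sub_C_pow_dvd_iff_coeff, ← hA', ← hB']
    constructor
    · intro hn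
      refine ⟨fun i hi => ?_, fun j hj => ?_⟩
      · by_contra hcon
        have := hmin (i + 1) (Or.inl ⟨i, rfl, hcon⟩)
        omega
      · by_contra hcon
        have := hmin j (Or.inr hcon)
        omega
    · rintro ⟨h1, h2⟩
      by_contra hcon
      rcases hN with ⟨i, rfl, hi⟩ | hN
      · exact hi (h1 i (by omega))
      · exact hN (h2 N (by omega))
  refine ⟨(N : ℤ) - 1, ⟨?_, ?_⟩, ?_, hiff⟩
  · rcases hN with ⟨i, rfl, hi⟩ | hN
    · have := mem_support_P (S := T) (k := 1) (l := i) (by rw [cF 0]; exact (cA i).2 hi)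
      simpa using this
    · simpa using mem_support_Q (S := T) (k := 0) (l := N) ((cB N).2 hN)
  · rintro p' ⟨k, l, ⟨rfl, h⟩ | ⟨rfl, h⟩⟩
    · have hk : k ≠ 0 := by rintro rfl; exact h (cF0 l)
      obtain ⟨k, rfl⟩ := Nat.exists_eq_succ_of_ne_zero hk
      refine ⟨by simp, fun e => ?_⟩
      have : k = 0 := by simpa using e
      subst this
      rw [Nat.succ_eq_add_one, cF 0] at h
      have := hmin (l + 1) (Or.inl ⟨l, rfl, (cA l).1 h⟩)
      dsimp only
      omega
    · refine ⟨by simp, fun e => ?_⟩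
      have : k = 0 := by simpa using e
      subst this
      have := hmin l (Or.inr ((cB l).1 h))
      dsimp only
      omega
  · intro hs
    refine isElementary_of_low hP hPe ?_
    by_contra hcon
    push Not at hcon
    obtain ⟨h1, h2, h3⟩ := hcon
    have hA0 : A'.coeff 0 = 0 := by
      by_contra h
      have := (cA 0).2 h
      apply this
      have : T.δ (0, 0) * P (0, 0) = 0 := h1
      simpa [taylorCoeff] using this
    have hB0 : B'.coeff 0 = 0 := by
      by_contra h
      have := (cB 0).2 h
      apply this
      have : T.δ (0, 0) * T.Q (0, 0) = 0 := h2
      simpa [taylorCoeff] using this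
    have hB1 : B'.coeff 1 = 0 := by
      by_contra h
      apply (cB 1).2 h
      simp [taylorCoeff, iteratedDeriv_one, h3]
    rcases hN with ⟨i, rfl, hi⟩ | hN
    · have : i = 0 := by omega
      subst this
      exact hi hA0
    · have : N = 0 ∨ N = 1 := by omega
      rcases this with rfl | rfl
      · exact hN hB0
      · exact hN hB1

end ConstrainedGerm

namespace ConstrainedGerm

variable {S T : ConstrainedGerm} {ω₁ ω₂ : ℕ} {m : ℤ} {σ : ℤˣ} {ξ : ℝ} {p : ℤ × ℤ} {h : ℕ}

/-! ### Bounds for the height of the strict transform -/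

theorem polyQ_eq : S.polyQ ω₁ ω₂ m σ = S.polyB ω₁ ω₂ m σ +
    Polynomial.C (((σ : ℤ) : ℝ) * (ω₂ / ω₁)) * (Polynomial.X * S.polyA ω₁ ω₂ m σ) := by
  rw [polyB]; ring

theorem not_polyA_polyB_eq_zero (h₁ : 0 < ω₁) (h₂ : 0 < ω₂) (hp : p ∈ S.support)
    (hpm : ω₁ * p.1 + ω₂ * p.2 = m) :
    ¬ (S.polyA ω₁ ω₂ m σ = 0 ∧ S.polyB ω₁ ω₂ m σ = 0) := by
  rintro ⟨h1, h2⟩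
  rcases coeff_ne_zero_of_mem_support h₁ h₂ hp hpm σ with ⟨l, -, hl⟩ | ⟨l, -, hl⟩
  · rw [h1] at hl; simp at hl
  · rw [polyQ_eq, h1, h2] at hl; simp at hl

/-- The main vertex is leftmost and the line descends to the right. This bounds the degrees of A and
B by the height and the height plus one. -/
theorem MainPoint.le_of_line (hp : S.MainPoint p) (h₂ : 0 < ω₂)
    (hpm : ω₁ * p.1 + ω₂ * p.2 = m) {p' : ℤ × ℤ} (hp' : p' ∈ S.support)
    (hpm' : ω₁ * p'.1 + ω₂ * p'.2 = m) : p'.2 ≤ p.2 := by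
  have h1 := (hp.2 p' hp').1
  have h2 : (ω₂ : ℤ) * p'.2 ≤ ω₂ * p.2 := by nlinarith
  exact le_of_mul_le_mul_left h2 (by exact_mod_cast h₂)

theorem MainPoint.natDegree_polyA_le (hp : S.MainPoint p) (h₂ : 0 < ω₂)
    (hpm : ω₁ * p.1 + ω₂ * p.2 = m) (hh : p.2 = h) : (S.polyA ω₁ ω₂ m σ).natDegree ≤ h := by
  rw [Polynomial.natDegree_le_iff_coeff_eq_zero]
  intro l hl
  by_contra hne
  obtain ⟨p', hp', e, hpm'⟩ := polyA_coeff_ne_zero hne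
  have := hp.le_of_line h₂ hpm hp' hpm'
  omega

theorem MainPoint.natDegree_polyQ_le (hp : S.MainPoint p) (h₂ : 0 < ω₂)
    (hpm : ω₁ * p.1 + ω₂ * p.2 = m) (hh : p.2 = h) : (S.polyQ ω₁ ω₂ m σ).natDegree ≤ h + 1 := by
  rw [Polynomial.natDegree_le_iff_coeff_eq_zero]
  intro l hl
  by_contra hne
  obtain ⟨p', hp', e, hpm'⟩ := polyQ_coeff_ne_zero hne
  have := hp.le_of_line h₂ hpm hp' hpm'
  omega

theorem MainPoint.natDegree_polyB_le (hp : S.MainPoint p) (h₂ : 0 < ω₂)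
    (hpm : ω₁ * p.1 + ω₂ * p.2 = m) (hh : p.2 = h) : (S.polyB ω₁ ω₂ m σ).natDegree ≤ h + 1 := by
  refine (Polynomial.natDegree_sub_le _ _).trans (max_le (hp.natDegree_polyQ_le h₂ hpm hh) ?_)
  refine (Polynomial.natDegree_C_mul_le _ _).trans ?_
  refine Polynomial.natDegree_mul_le.trans ?_
  have := hp.natDegree_polyA_le (σ := σ) h₂ hpm hh
  rw [Polynomial.natDegree_X]
  omega

/-- The polynomials of the initial part when the height does not drop at `ξ`. -/
def Stalls (S : ConstrainedGerm) (ω₁ ω₂ : ℕ) (m : ℤ) (σ : ℤˣ) (ξ : ℝ) (h : ℕ) : Prop :=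
  ∃ a b : ℝ, ¬ (a = 0 ∧ b = 0) ∧
    S.polyA ω₁ ω₂ m σ = Polynomial.C a * (Polynomial.X - Polynomial.C ξ) ^ h ∧
    S.polyB ω₁ ω₂ m σ = Polynomial.C b * (Polynomial.X - Polynomial.C ξ) ^ (h + 1)

/-- The divisors already have the maximal degrees allowed for A and B, so the quotients are
constants, not both zero since p lies on the line. -/
theorem MainPoint.stalls_of_dvd (hp : S.MainPoint p) (h₁ : 0 < ω₁) (h₂ : 0 < ω₂)
    (hpm : ω₁ * p.1 + ω₂ * p.2 = m) (hh : p.2 = h)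
    (hA : (Polynomial.X - Polynomial.C ξ) ^ h ∣ S.polyA ω₁ ω₂ m σ)
    (hB : (Polynomial.X - Polynomial.C ξ) ^ (h + 1) ∣ S.polyB ω₁ ω₂ m σ) :
    S.Stalls ω₁ ω₂ m σ ξ h := by
  have hm := fun n => (Polynomial.monic_X_sub_C ξ).pow n
  have hd : ∀ n, ((Polynomial.X - Polynomial.C ξ) ^ n).natDegree = n := fun n => by
    rw [Polynomial.natDegree_pow, Polynomial.natDegree_X_sub_C, mul_one]
  have eA := Polynomial.eq_leadingCoeff_mul_of_monic_of_dvd_of_natDegree_le (hm h) hA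
    (by rw [hd]; exact hp.natDegree_polyA_le h₂ hpm hh)
  have eB := Polynomial.eq_leadingCoeff_mul_of_monic_of_dvd_of_natDegree_le (hm (h + 1)) hB
    (by rw [hd]; exact hp.natDegree_polyB_le h₂ hpm hh)
  refine ⟨(S.polyA ω₁ ω₂ m σ).leadingCoeff, (S.polyB ω₁ ω₂ m σ).leadingCoeff, ?_, eA, eB⟩
  rintro ⟨h1, h2⟩
  exact not_polyA_polyB_eq_zero h₁ h₂ hp.1 hpm (σ := σ)
    ⟨Polynomial.leadingCoeff_eq_zero.1 h1, Polynomial.leadingCoeff_eq_zero.1 h2⟩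

theorem MainPoint.not_dvd_succ (hp : S.MainPoint p) (h₁ : 0 < ω₁) (h₂ : 0 < ω₂)
    (hpm : ω₁ * p.1 + ω₂ * p.2 = m) (hh : p.2 = h) :
    ¬ ((Polynomial.X - Polynomial.C ξ) ^ (h + 1) ∣ S.polyA ω₁ ω₂ m σ ∧
      (Polynomial.X - Polynomial.C ξ) ^ (h + 1 + 1) ∣ S.polyB ω₁ ω₂ m σ) := by
  rintro ⟨hA, hB⟩
  have hd : ∀ n, ((Polynomial.X - Polynomial.C ξ) ^ n).natDegree = n := fun n => by
    rw [Polynomial.natDegree_pow, Polynomial.natDegree_X_sub_C, mul_one]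
  refine not_polyA_polyB_eq_zero h₁ h₂ hp.1 hpm (σ := σ) ⟨?_, ?_⟩
  · refine Polynomial.eq_zero_of_dvd_of_natDegree_lt hA ?_
    rw [hd]; have := hp.natDegree_polyA_le (σ := σ) h₂ hpm hh; omega
  · refine Polynomial.eq_zero_of_dvd_of_natDegree_lt hB ?_
    rw [hd]; have := hp.natDegree_polyB_le (σ := σ) h₂ hpm hh; omega

theorem line_eq {p' : ℤ × ℤ} (h₁ : 0 < ω₁) (hpm : ω₁ * p.1 + ω₂ * p.2 = m)
    (hpm' : ω₁ * p'.1 + ω₂ * p'.2 = m) (e : p'.2 = p.2) : p' = p := by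
  refine Prod.ext ?_ e
  have h5 : (ω₁ : ℤ) ≠ 0 := by positivity
  refine mul_left_cancel₀ h5 ?_
  rw [e] at hpm'
  linarith

/-- At ξ = 0 the initial polynomials are monomials of degrees h and h + 1, which leaves the height h
as the only possibility on the line. Thus a genuine segment excludes stalling at the origin of the
chart. -/
theorem Stalls.line_subsingleton (hst : S.Stalls ω₁ ω₂ m σ 0 h) (h₁ : 0 < ω₁) (h₂ : 0 < ω₂)
    (hpm : ω₁ * p.1 + ω₂ * p.2 = m) (hh : p.2 = h) {p' : ℤ × ℤ} (hp' : p' ∈ S.support)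
    (hpm' : ω₁ * p'.1 + ω₂ * p'.2 = m) : p' = p := by
  obtain ⟨a, b, -, hA, hB⟩ := hst
  refine line_eq h₁ hpm hpm' ?_
  rcases coeff_ne_zero_of_mem_support h₁ h₂ hp' hpm' σ with ⟨l, e, hl⟩ | ⟨l, e, hl⟩
  · rw [hA, Polynomial.C_0, sub_zero, Polynomial.coeff_C_mul_X_pow] at hl
    split_ifs at hl with hlh
    · omega
    · exact absurd rfl hl
  · have hQ : S.polyQ ω₁ ω₂ m σ =
        Polynomial.C (b + ((σ : ℤ) : ℝ) * (ω₂ / ω₁) * a) * Polynomial.X ^ (h + 1) := by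
      rw [polyQ_eq, hA, hB]
      simp only [Polynomial.C_add, Polynomial.C_mul, Polynomial.C_0]
      ring
    rw [hQ, Polynomial.coeff_C_mul_X_pow] at hl
    split_ifs at hl with hlh
    · omega
    · exact absurd rfl hl

/-- The second highest coefficient of a power of X - ξ is a nonzero multiple of ξ. It is read off A
when a ≠ 0, and off the untwisted second component otherwise. -/
theorem Stalls.exists_lower (hst : S.Stalls ω₁ ω₂ m σ ξ h) (hξ : ξ ≠ 0) (hpos : 0 < h) :
    ∃ p' ∈ S.support, p'.2 = h - 1 ∧ ω₁ * p'.1 + ω₂ * p'.2 = m := by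
  obtain ⟨a, b, hab, hA, hB⟩ := hst
  by_cases ha : a = 0
  · have hb : b ≠ 0 := fun hb => hab ⟨ha, hb⟩
    have hl : (S.polyQ ω₁ ω₂ m σ).coeff h ≠ 0 := by
      rw [polyQ_eq, hA, hB, ha]
      simp only [Polynomial.C_0, zero_mul, mul_zero, add_zero, Polynomial.coeff_C_mul,
        sub_eq_add_neg, ← Polynomial.C_neg, Polynomial.coeff_X_add_C_pow]
      simp only [Nat.add_sub_cancel_left, pow_one, Nat.choose_succ_self_right]
      have : ((h + 1 : ℕ) : ℝ) ≠ 0 := by positivity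
      exact mul_ne_zero hb (mul_ne_zero (neg_ne_zero.2 hξ) this)
    obtain ⟨p', hp', e, hpm'⟩ := polyQ_coeff_ne_zero hl
    exact ⟨p', hp', by omega, hpm'⟩
  · have hl : (S.polyA ω₁ ω₂ m σ).coeff (h - 1) ≠ 0 := by
      rw [hA, Polynomial.coeff_C_mul, sub_eq_add_neg, ← Polynomial.C_neg,
        Polynomial.coeff_X_add_C_pow]
      refine mul_ne_zero ha (mul_ne_zero (pow_ne_zero _ (neg_ne_zero.2 hξ)) ?_)
      have : 0 < h.choose (h - 1) := Nat.choose_pos (by omega)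
      exact_mod_cast this.ne'
    obtain ⟨p', hp', e, hpm'⟩ := polyA_coeff_ne_zero hl
    exact ⟨p', hp', by omega, hpm'⟩

/-- Stalling off the origin of the chart forces the first weight to be one. -/
theorem Stalls.weight_eq_one (hst : S.Stalls ω₁ ω₂ m σ ξ h) (hξ : ξ ≠ 0) (hpos : 0 < h)
    (hpm : ω₁ * p.1 + ω₂ * p.2 = m) (hh : p.2 = h)
    (hco : Nat.Coprime ω₁ ω₂) : ω₁ = 1 := by
  obtain ⟨p', -, e, hpm'⟩ := hst.exists_lower hξ hpos
  -- Two points of the line at consecutive heights give ω₁(r' - r) = ω₂.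
  have hdvd : (ω₁ : ℤ) ∣ ω₂ := ⟨p'.1 - p.1, by
    have e2 : p.2 = p'.2 + 1 := by omega
    rw [e2] at hpm
    linarith⟩
  exact Nat.eq_one_of_dvd_coprimes hco dvd_rfl (by exact_mod_cast hdvd)

/-! ### The chart in the direction of `y` -/

theorem mem_support_swap : p ∈ S.swap.support ↔ p.swap ∈ S.support := by
  have hP : ∀ k l, taylorCoeff (fun q => S.swap.δ q * S.swap.P q) k l =
      taylorCoeff (fun q => S.δ q * S.Q q) l k := fun k l => taylorCoeff_swap S.analytic_δQ k l
  have hQ : ∀ k l, taylorCoeff (fun q => S.swap.δ q * S.swap.Q q) k l =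
      taylorCoeff (fun q => S.δ q * S.P q) l k := fun k l => taylorCoeff_swap S.analytic_δP k l
  constructor
  · rintro ⟨k, l, ⟨rfl, hc⟩ | ⟨rfl, hc⟩⟩
    · rw [hP] at hc; exact mem_support_Q hc
    · rw [hQ] at hc; exact mem_support_P hc
  · rintro ⟨k, l, ⟨e, hc⟩ | ⟨e, hc⟩⟩
    · obtain rfl : p = ((l : ℤ), (k : ℤ) - 1) := by simpa using congrArg Prod.swap e
      exact mem_support_Q (S := S.swap) (by rw [hQ]; exact hc)
    · obtain rfl : p = ((l : ℤ) - 1, (k : ℤ)) := by simpa using congrArg Prod.swap e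
      exact mem_support_P (S := S.swap) (by rw [hP]; exact hc)

/-- In exchanged coordinates the abscissa 0 or -1 of p becomes a height, so p produces a nonzero
coefficient of index 0 or 1 in the initial polynomials. A positive height at the chart origin would
kill those coefficients. This is where controllability enters. -/
theorem isElementary_of_y_transform (hT : S.IsStrictTransform ω₁ ω₂ (.y σ) T) (h₁ : 0 < ω₁)
    (h₂ : 0 < ω₂) (hp : p ∈ S.support) (hr : p.1 = 0 ∨ p.1 = -1) (hm : S.Above ω₁ ω₂ m)
    (hpm : ω₁ * p.1 + ω₂ * p.2 = m) : T.IsElementary := by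
  have hm' : S.swap.Above ω₂ ω₁ m := fun p' hp' => by
    have := hm _ (mem_support_swap.1 hp')
    simp only [Prod.fst_swap, Prod.snd_swap] at this
    linarith
  have hp' : p.swap ∈ S.swap.support := by rw [mem_support_swap]; simpa using hp
  have hpm' : ω₂ * p.swap.1 + ω₁ * p.swap.2 = m := by simp; linarith
  obtain ⟨s, -, hel, hdvd⟩ := IsXTransform.exists_height hT h₂ h₁ hm' hp' hpm'
  suffices hs : s ≤ 0 from (hel hs).swap
  by_contra hs
  obtain ⟨hA, hB⟩ := (hdvd 1).1 (by push_cast; omega)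
  rw [Polynomial.C_0, sub_zero] at hA hB
  rw [Polynomial.X_pow_dvd_iff] at hA hB
  have hA0 := hA 0 (by norm_num)
  have hB0 := hB 0 (by norm_num)
  have hB1 := hB 1 (by norm_num)
  rcases coeff_ne_zero_of_mem_support h₂ h₁ hp' hpm' σ with ⟨l, e, hl⟩ | ⟨l, e, hl⟩
  · simp only [Prod.snd_swap] at e
    have : l = 0 := by omega
    subst this
    exact hl hA0
  · simp only [Prod.snd_swap] at e
    have : l = 0 ∨ l = 1 := by omega
    rw [polyQ_eq, Polynomial.coeff_add, Polynomial.coeff_C_mul] at hl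
    rcases this with rfl | rfl
    · rw [hB0, Polynomial.coeff_X_mul_zero] at hl
      simp at hl
    · rw [hB1, Polynomial.coeff_X_mul, hA0] at hl
      simp at hl

theorem NonTrivial.swap (hS : S.NonTrivial) : S.swap.NonTrivial := by
  refine ⟨fun h => hS.1 ?_, fun h => hS.2 ?_⟩
  · filter_upwards [eventually_swap h] with q hq using hq
  · filter_upwards [eventually_swap h] with q hq using ⟨hq.2, hq.1⟩

theorem exists_isStrictTransform (hS : S.NonTrivial) (h₁ : 0 < ω₁) (h₂ : 0 < ω₂)
    (q : DivisorPoint) : ∃ T, S.IsStrictTransform ω₁ ω₂ q T := by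
  cases q with
  | x σ ξ => exact exists_isXTransform hS h₁ h₂ σ ξ
  | y σ =>
    obtain ⟨U, hU⟩ := exists_isXTransform hS.swap h₂ h₁ σ 0
    exact ⟨U.swap, hU⟩

/-! ### Shears -/

theorem taylorCoeff_zero_congr {f g : ℝ × ℝ → ℝ} (h : ∀ y, f (0, y) = g (0, y)) (l : ℕ) :
    taylorCoeff f 0 l = taylorCoeff g 0 l := by
  simp [taylorCoeff, h]

variable {φ ψ : ℝ → ℝ}

/-- A shear along a curve tangent to the stalling direction keeps the main vertex, and pushes the
rest of the support off the line through it. -/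
theorem shear_of_stalls {β : ℕ} (hβ : 0 < β) (hp : S.MainPoint p) (hr : p.1 = 0 ∨ p.1 = -1)
    (hm : S.Above 1 β m) (hpm : ((1 : ℕ) : ℤ) * p.1 + β * p.2 = m) (hh : p.2 = h)
    (hst : S.Stalls 1 β m σ ξ h)
    (hφ : AnalyticAt ℝ φ 0) (h0 : φ 0 = 0) (hy : ¬ S.divY) (hψ : AnalyticAt ℝ ψ 0) (hψ0 : ψ 0 = 0)
    (hφψ : ∀ᶠ u in 𝓝 (0 : ℝ), φ (((σ : ℤ) : ℝ) * u) = u ^ β * (ξ + ψ u)) :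
    (S.shear φ hφ h0 hy).MainPoint p ∧ ∀ p' ∈ (S.shear φ hφ h0 hy).support, p' ≠ p →
      m < ((1 : ℕ) : ℤ) * p'.1 + β * p'.2 := by
  obtain ⟨gF, hgF, hFe, hF0⟩ := exists_weighted_quotient S.analytic_δP one_pos hβ σ hm.weight_P
  obtain ⟨gG, hgG, hGe, hG0⟩ := exists_weighted_quotient S.analytic_δQ one_pos hβ σ hm.weight_Q
  set S' := S.shear φ hφ h0 hy with hS'
  set s : ℝ := ((σ : ℤ) : ℝ) with hs
  have hσ : s * s = 1 := unit_mul_self σ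
  -- Upstairs the shear is the translation v ↦ v + ξ + ψ(u), which carries the chart origin to (0,
  -- ξ). The sheared initial forms are therefore the old ones translated by ξ, that is monomials.
  let τ : ℝ × ℝ → ℝ × ℝ := fun q => (q.1, q.2 + ξ + ψ q.1)
  have hψ' : AnalyticAt ℝ (fun q : ℝ × ℝ => ψ q.1) ((0 : ℝ), (0 : ℝ)) :=
    AnalyticAt.fun_comp_of_eq (f := Prod.fst) (g := ψ) hψ analyticAt_fst rfl
  have hτ : AnalyticAt ℝ τ ((0 : ℝ), (0 : ℝ)) :=
    AnalyticAt.prod (by fun_prop) (AnalyticAt.fun_add (by fun_prop) hψ')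
  have hτ0 : τ (0, 0) = (0, ξ) := by simp [τ, hψ0]
  have hτlim : Tendsto τ (𝓝 (0, 0)) (𝓝 (0, ξ)) := by
    have := hτ.continuousAt.tendsto; rwa [hτ0] at this
  have aF : AnalyticAt ℝ (fun q => gF (τ q)) ((0 : ℝ), (0 : ℝ)) := (hgF ξ).comp_of_eq hτ hτ0
  have aG : AnalyticAt ℝ (fun q => gG (τ q)) ((0 : ℝ), (0 : ℝ)) := (hgG ξ).comp_of_eq hτ hτ0
  have hdψ : AnalyticAt ℝ (fun q : ℝ × ℝ => deriv ψ q.1) ((0 : ℝ), (0 : ℝ)) :=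
    AnalyticAt.fun_comp_of_eq (f := Prod.fst) (g := deriv ψ) hψ.deriv analyticAt_fst rfl
  have hfst : Tendsto (fun q : ℝ × ℝ => q.1) (𝓝 (0, 0)) (𝓝 0) := continuous_fst.tendsto _
  have hsub : ∀ u t : ℝ, φ (s * u) = u ^ β * (ξ + ψ u) →
      u ^ β * t + φ (s * u) = u ^ β * (t + ξ + ψ u) := fun u t h => by rw [h]; ring
  have eF : ∀ᶠ q in 𝓝 ((0 : ℝ), (0 : ℝ)), q.1 ≠ 0 →
      S'.δ (s * q.1 ^ 1, q.1 ^ β * q.2) * S'.P (s * q.1 ^ 1, q.1 ^ β * q.2) =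
        q.1 ^ (m + (1 : ℕ)) * gF (τ q) := by
    filter_upwards [hτlim.eventually (hFe ξ), hfst.eventually hφψ] with q hq hφq hq0
    rw [← hq hq0]
    simp only [hS', shear, pow_one]
    rw [hsub _ _ hφq]
  have hdφ : ∀ᶠ u in 𝓝 (0 : ℝ), u ≠ 0 → deriv φ (s * u) =
      s * u ^ (β - 1) * (β * (ξ + ψ u) + u * deriv ψ u) := by
    have hsl : Tendsto (fun u : ℝ => s * u) (𝓝 0) (𝓝 0) := by
      have : Continuous fun u : ℝ => s * u := by fun_prop
      simpa using this.tendsto 0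
    filter_upwards [hφψ.eventually_nhds, hψ.eventually_analyticAt,
      hsl.eventually hφ.eventually_analyticAt] with u hu hψu hφu hu0
    have h1 : HasDerivAt (fun u => φ (s * u)) (deriv φ (s * u) * (s * 1)) u :=
      HasDerivAt.comp u hφu.differentiableAt.hasDerivAt ((hasDerivAt_id' u).const_mul s)
    have h2 : HasDerivAt (fun u => u ^ β * (ξ + ψ u))
        ((β * u ^ (β - 1)) * (ξ + ψ u) + u ^ β * deriv ψ u) u :=
      (hasDerivAt_pow β u).fun_mul (hψu.differentiableAt.hasDerivAt.const_add ξ)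
    have h3 := (h1.congr_of_eventuallyEq (f₁ := fun u => u ^ β * (ξ + ψ u))
      (hu.mono fun u hu => hu.symm)).unique h2
    have e2 : u ^ (β - 1) * u = u ^ β := by rw [← pow_succ, Nat.sub_add_cancel hβ]
    rw [← e2] at h3
    linear_combination s * h3 - deriv φ (s * u) * hσ
  have eG : ∀ᶠ q in 𝓝 ((0 : ℝ), (0 : ℝ)), q.1 ≠ 0 →
      S'.δ (s * q.1 ^ 1, q.1 ^ β * q.2) * S'.Q (s * q.1 ^ 1, q.1 ^ β * q.2) =
        q.1 ^ (m + β) * (gG (τ q) -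
          s * (β * (ξ + ψ q.1) + q.1 * deriv ψ q.1) * gF (τ q)) := by
    filter_upwards [hτlim.eventually (hFe ξ), hτlim.eventually (hGe ξ), hfst.eventually hφψ,
      hfst.eventually hdφ] with q hqF hqG hφq hdq hq0
    have hqF := hqF hq0
    have hqG := hqG hq0
    have e2 : q.1 ^ (β - 1) * q.1 = q.1 ^ β := by rw [← pow_succ, Nat.sub_add_cancel hβ]
    simp only [hS', shear, pow_one]
    rw [hsub _ _ hφq, hdq hq0]
    simp only [τ, pow_one] at hqF hqG ⊢
    rw [zpow_add₀ hq0, zpow_natCast] at hqF hqG ⊢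
    rw [pow_one] at hqF
    rw [mul_sub, mul_left_comm, hqF, hqG, ← e2]
    ring
  have aG' : AnalyticAt ℝ (fun q => gG (τ q) -
      s * (β * (ξ + ψ q.1) + q.1 * deriv ψ q.1) * gF (τ q)) ((0 : ℝ), (0 : ℝ)) := by
    refine aG.fun_sub (AnalyticAt.fun_mul (AnalyticAt.fun_mul analyticAt_const
      (AnalyticAt.fun_add ?_ ?_)) aF)
    · exact analyticAt_const.fun_mul (analyticAt_const.fun_add hψ')
    · exact AnalyticAt.fun_mul (by fun_prop) hdψ
  obtain ⟨wP, iP⟩ := weighted_order_of_quotient (f := fun q => S'.δ q * S'.P q) S'.analytic_δP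
    one_pos hβ σ aF eF
  obtain ⟨wQ, iQ⟩ := weighted_order_of_quotient (f := fun q => S'.δ q * S'.Q q) S'.analytic_δQ
    one_pos hβ σ aG' eG
  obtain ⟨a, b, hab, hA, hB⟩ := hst
  have hA' : S'.polyA 1 β m σ = Polynomial.C a * Polynomial.X ^ h := by
    refine polynomial_eq_of_eventually (t := 0) ?_
    filter_upwards [iP] with v hv
    rw [polyA, ← hv]
    simp only [τ, hψ0, hF0, add_zero]
    change (S.polyA 1 β m σ).eval (v + ξ) = _
    rw [hA]
    simp
  have hQ' : S'.polyQ 1 β m σ = Polynomial.C (b + s * β * a) * Polynomial.X ^ (h + 1) := by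
    refine polynomial_eq_of_eventually (t := 0) ?_
    filter_upwards [iQ] with v hv
    rw [polyQ, ← hv]
    simp only [τ, hψ0, hF0, hG0, add_zero]
    change (S.polyQ 1 β m σ).eval (v + ξ) - s * (β * ξ + 0 * _) * (S.polyA 1 β m σ).eval (v + ξ) = _
    rw [polyQ_eq, hA, hB]
    simp
    ring
  have habove : S'.Above 1 β m := above_of_weights wP wQ
  have honly : ∀ p' ∈ S'.support, ((1 : ℕ) : ℤ) * p'.1 + β * p'.2 = m → p' = p := by
    intro p' hp' hpm'
    refine line_eq one_pos hpm hpm' ?_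
    rcases coeff_ne_zero_of_mem_support one_pos hβ hp' hpm' σ with ⟨l, e, hl⟩ | ⟨l, e, hl⟩
    · rw [hA', Polynomial.coeff_C_mul_X_pow] at hl
      split_ifs at hl with hlh
      · omega
      · exact absurd rfl hl
    · rw [hQ', Polynomial.coeff_C_mul_X_pow] at hl
      split_ifs at hl with hlh
      · omega
      · exact absurd rfl hl
  have hmem : p ∈ S'.support := by
    by_cases ha : a = 0
    · have hb : b ≠ 0 := fun hb => hab ⟨ha, hb⟩
      obtain ⟨p', hp', -, hpm'⟩ := polyQ_coeff_ne_zero (S := S') (ω₁ := 1) (ω₂ := β) (m := m)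
        (σ := σ) (l := h + 1) (by rw [hQ', Polynomial.coeff_C_mul_X_pow, if_pos rfl]; simpa [ha])
      rwa [honly p' hp' hpm'] at hp'
    · obtain ⟨p', hp', -, hpm'⟩ := polyA_coeff_ne_zero (S := S') (ω₁ := 1) (ω₂ := β) (m := m)
        (σ := σ) (l := h) (by rwa [hA', Polynomial.coeff_C_mul_X_pow, if_pos rfl])
      rwa [honly p' hp' hpm'] at hp'
  refine ⟨⟨hmem, fun p' hp' => ⟨?_, fun e => ?_⟩⟩, fun p' hp' hne =>
    lt_of_le_of_ne (habove p' hp') fun e => hne (honly p' hp' e.symm)⟩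
  -- For p.1 = -1 nothing can lie further left. For p.1 = 0 a point of abscissa -1 would come from
  -- δP on {x = 0}, which the shear fixes pointwise.
  · rcases hr with hr | hr
    · obtain ⟨k, l, ⟨rfl, hc⟩ | ⟨rfl, hc⟩⟩ := hp'
      · have hk : k ≠ 0 := by
          rintro rfl
          rw [taylorCoeff_zero_congr (g := fun q => S.δ q * S.P q)
            (by intro y; simp [hS', shear, h0])] at hc
          have := (hp.2 _ (mem_support_P hc)).1
          rw [hr] at this
          norm_num at this
        dsimp only
        omega
      · dsimp only
        omega
    · have := (neg_one_le_of_mem_support hp').1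
      omega
  · have h1 := habove p' hp'
    rw [e, ← hpm] at h1
    have h2 : (β : ℤ) * p.2 ≤ β * p'.2 := by linarith
    exact le_of_mul_le_mul_left h2 (by exact_mod_cast hβ)

/-- The second end of the new main segment is below p and strictly above the old line, so the new
line descends more slowly. -/
theorem MainPoint.weight_lt {β β' : ℕ} (hp : S.MainPoint p)
    (hlt : ∀ p' ∈ S.support, p' ≠ p → ((1 : ℕ) : ℤ) * p.1 + β * p.2 < ((1 : ℕ) : ℤ) * p'.1 + β * p'.2)
    (hw : S.IsMainWeight 1 β') : β < β' := by
  obtain ⟨-, hβ', -, -, p', hp', hne, e⟩ := hp.isMainWeight_iff.1 hw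
  have h1 := hlt p' hp' hne
  have h2 := (hp.2 p' hp')
  push_cast at e h1
  have h3 : p'.2 < p.2 := by
    by_contra hcon
    push Not at hcon
    have hβZ : (0 : ℤ) < β' := by exact_mod_cast hβ'
    have h4 : p'.1 = p.1 := by nlinarith
    have h5 : (β' : ℤ) * p'.2 = β' * p.2 := by rw [h4] at e; linarith
    exact hne (Prod.ext h4 (mul_left_cancel₀ hβZ.ne' h5))
  by_contra hcon
  push Not at hcon
  have : (β' : ℤ) ≤ β := by exact_mod_cast hcon
  nlinarith

end ConstrainedGerm

namespace ConstrainedGerm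

variable {S T : ConstrainedGerm} {ω₁ ω₂ : ℕ} {σ : ℤˣ} {ξ : ℝ}

/-! ### Bézout relations up to a power of `x` -/

/-- The ideal generated by the components of the field contains `x ^ N`. -/
def FieldBezout (S : ConstrainedGerm) (N : ℕ) : Prop :=
  ∃ A B : ℝ × ℝ → ℝ, AnalyticAt ℝ A 0 ∧ AnalyticAt ℝ B 0 ∧
    ∀ᶠ q in 𝓝 (0 : ℝ × ℝ), A q * S.P q + B q * S.Q q = q.1 ^ N

/-- The ideal generated by `δ` and `∂δ/∂y` contains `x ^ N`. -/
def ImpasseBezout (S : ConstrainedGerm) (N : ℕ) : Prop :=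
  ∃ A B : ℝ × ℝ → ℝ, AnalyticAt ℝ A 0 ∧ AnalyticAt ℝ B 0 ∧
    ∀ᶠ q in 𝓝 (0 : ℝ × ℝ), A q * S.δ q + B q * fderiv ℝ S.δ q (0, 1) = q.1 ^ N

/-- Off `{x = 0}`, the field has no zeros and `δ` has simple zeros on vertical lines, in the form of
Bézout relations. Unlike the absence of common factors, this passes to strict transforms. -/
structure Tame (S : ConstrainedGerm) : Prop where
  field : ∃ N, S.FieldBezout N
  impasse : ∃ N, S.ImpasseBezout N

theorem not_eventually_fst_pow_eq_zero (N : ℕ) : ¬ ∀ᶠ q in 𝓝 (0 : ℝ × ℝ), q.1 ^ N = 0 := by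
  intro h
  have h1 : ∀ᶠ x in 𝓝 (0 : ℝ), x ^ N = 0 :=
    (Continuous.tendsto' (by fun_prop : Continuous fun x : ℝ => (x, (0 : ℝ))) 0 0 rfl).eventually h
  have h2 : ∀ᶠ x in 𝓝[≠] (0 : ℝ), False := by
    filter_upwards [h1.filter_mono nhdsWithin_le_nhds, self_mem_nhdsWithin] with x hx hx0
    exact pow_ne_zero N hx0 hx
  exact (NormedField.nhdsNE_neBot (0 : ℝ)).ne (eventually_false_iff_eq_bot.1 h2)

theorem Tame.nonTrivial (h : S.Tame) : S.NonTrivial := by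
  constructor
  · intro h0
    obtain ⟨N, A, B, -, -, hAB⟩ := h.impasse
    refine not_eventually_fst_pow_eq_zero N ?_
    filter_upwards [hAB, h0.eventually_nhds] with q hq hq0
    have h1 : fderiv ℝ S.δ q = 0 := by
      rw [Filter.EventuallyEq.fderiv_eq (f₁ := S.δ) (f := fun _ => (0 : ℝ)) hq0]; simp
    rw [← hq, h1, hq0.self_of_nhds]
    simp
  · intro h0
    obtain ⟨N, A, B, -, -, hAB⟩ := h.field
    refine not_eventually_fst_pow_eq_zero N ?_
    filter_upwards [hAB, h0] with q hq hq0
    rw [← hq, hq0.1, hq0.2]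
    simp

theorem tendsto_shear {φ : ℝ → ℝ} (hφ : AnalyticAt ℝ φ 0) (h0 : φ 0 = 0) :
    Tendsto (fun q : ℝ × ℝ => (q.1, q.2 + φ q.1)) (𝓝 0) (𝓝 0) := by
  have hφ1 : AnalyticAt ℝ (fun q : ℝ × ℝ => φ q.1) 0 :=
    AnalyticAt.fun_comp (f := Prod.fst) (g := φ) hφ analyticAt_fst
  have : AnalyticAt ℝ (fun q : ℝ × ℝ => (q.1, q.2 + φ q.1)) 0 :=
    analyticAt_fst.prod (analyticAt_snd.add hφ1)
  have := this.continuousAt.tendsto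
  simp only [Prod.fst_zero, Prod.snd_zero, h0, add_zero] at this
  exact this

theorem FieldBezout.shear {N : ℕ} (h : S.FieldBezout N) {φ : ℝ → ℝ} (hφ : AnalyticAt ℝ φ 0)
    (h0 : φ 0 = 0) (hy : ¬ S.divY) : (S.shear φ hφ h0 hy).FieldBezout N := by
  have hφ2 : AnalyticAt ℝ (fun q : ℝ × ℝ => deriv φ q.1) 0 :=
    AnalyticAt.fun_comp (f := Prod.fst) (g := deriv φ) hφ.deriv analyticAt_fst
  obtain ⟨A, B, hA, hB, hAB⟩ := h
  refine ⟨fun q => A (q.1, q.2 + φ q.1) + deriv φ q.1 * B (q.1, q.2 + φ q.1),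
    fun q => B (q.1, q.2 + φ q.1), (analyticAt_shear hA hφ h0).fun_add
      (hφ2.fun_mul (analyticAt_shear hB hφ h0)), analyticAt_shear hB hφ h0, ?_⟩
  filter_upwards [(tendsto_shear hφ h0).eventually hAB] with q hq
  rw [← hq]
  simp only [ConstrainedGerm.shear]
  ring

/-- A shear translates each vertical line, so it commutes with ∂/∂y; this is why the relation
involves the vertical derivative only. -/
theorem ImpasseBezout.shear {N : ℕ} (h : S.ImpasseBezout N) {φ : ℝ → ℝ} (hφ : AnalyticAt ℝ φ 0)
    (h0 : φ 0 = 0) (hy : ¬ S.divY) : (S.shear φ hφ h0 hy).ImpasseBezout N := by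
  have hlim := tendsto_shear hφ h0
  obtain ⟨A, B, hA, hB, hAB⟩ := h
  refine ⟨fun q => A (q.1, q.2 + φ q.1), fun q => B (q.1, q.2 + φ q.1),
    analyticAt_shear hA hφ h0, analyticAt_shear hB hφ h0, ?_⟩
  filter_upwards [hlim.eventually hAB, hlim.eventually S.analytic_δ.eventually_analyticAt,
    (analyticAt_shear S.analytic_δ hφ h0).eventually_analyticAt] with q hq hd hd'
  rw [← hq]
  have : fderiv ℝ (S.shear φ hφ h0 hy).δ q (0, 1) =
      fderiv ℝ S.δ (q.1, q.2 + φ q.1) (0, 1) := by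
    rw [fderiv_apply_snd hd.differentiableAt]
    refine (fderiv_apply_snd (x := q.1) (y := q.2) hd'.differentiableAt).trans ?_
    exact deriv_comp_add_const (fun v => S.δ (q.1, v)) (φ q.1) q.2
  rw [this]
  rfl

theorem Tame.shear (h : S.Tame) {φ : ℝ → ℝ} (hφ : AnalyticAt ℝ φ 0) (h0 : φ 0 = 0)
    (hy : ¬ S.divY) : (S.shear φ hφ h0 hy).Tame :=
  ⟨h.field.imp fun _ h => h.shear hφ h0 hy, h.impasse.imp fun _ h => h.shear hφ h0 hy⟩

theorem tendsto_xBlowUp (h₁ : 0 < ω₁) (h₂ : 0 < ω₂) :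
    Tendsto (xBlowUp ω₁ ω₂ σ ξ) (𝓝 0) (𝓝 0) := by
  have : Continuous (xBlowUp ω₁ ω₂ σ ξ) := by unfold xBlowUp; fun_prop
  have h := this.tendsto 0
  rwa [show xBlowUp ω₁ ω₂ σ ξ 0 = 0 by simp [xBlowUp, h₁.ne', h₂.ne']] at h

theorem analyticAt_comp_xBlowUp {f : ℝ × ℝ → ℝ} (hf : AnalyticAt ℝ f 0) (h₁ : 0 < ω₁)
    (h₂ : 0 < ω₂) : AnalyticAt ℝ (fun q => f (xBlowUp ω₁ ω₂ σ ξ q)) 0 := by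
  have h : AnalyticAt ℝ (xBlowUp ω₁ ω₂ σ ξ) 0 :=
    AnalyticAt.prod (analyticAt_const.fun_mul (analyticAt_fst.fun_pow ω₁))
      ((analyticAt_fst.fun_pow ω₂).fun_mul (analyticAt_const.fun_add analyticAt_snd))
  exact hf.comp_of_eq h (by simp [xBlowUp, h₁.ne', h₂.ne'])

/-- Pull the relations back: x ^ N becomes ± u ^ (ω₁N), X becomes u ^ d times the image of the new
field, and a vertical derivative downstairs picks up u ^ ω₂ because vertical lines go to vertical
lines. Only powers of u are lost, and these are harmless. -/
theorem IsXTransform.tame (hT : S.IsXTransform ω₁ ω₂ σ ξ T) (h₁ : 0 < ω₁) (h₂ : 0 < ω₂)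
    (h : S.Tame) : T.Tame := by
  have hlim := tendsto_xBlowUp (σ := σ) (ξ := ξ) h₁ h₂
  have hσ : ∀ N : ℕ, (((σ : ℤ) : ℝ)) ^ N * (((σ : ℤ) : ℝ)) ^ N = 1 := fun N => by
    rw [← mul_pow, unit_mul_self, one_pow]
  constructor
  · obtain ⟨N, A, B, hA, hB, hAB⟩ := h.field
    obtain ⟨d, hd⟩ := hT.field
    have aA := analyticAt_comp_xBlowUp (σ := σ) (ξ := ξ) hA h₁ h₂
    have aB := analyticAt_comp_xBlowUp (σ := σ) (ξ := ξ) hB h₁ h₂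
    set s : ℝ := ((σ : ℤ) : ℝ)
    let A' : ℝ × ℝ → ℝ := fun q => s ^ N * q.1 ^ (d + d.natAbs).toNat *
      (s * ω₁ * q.1 ^ (ω₁ - 1) * A (xBlowUp ω₁ ω₂ σ ξ q) +
        ω₂ * (ξ + q.2) * q.1 ^ (ω₂ - 1) * B (xBlowUp ω₁ ω₂ σ ξ q))
    let B' : ℝ × ℝ → ℝ := fun q => s ^ N * q.1 ^ (d + d.natAbs).toNat *
      (q.1 ^ ω₂ * B (xBlowUp ω₁ ω₂ σ ξ q))
    have aA' : AnalyticAt ℝ A' 0 := by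
      refine AnalyticAt.fun_mul (by fun_prop) (AnalyticAt.fun_add (AnalyticAt.fun_mul (by fun_prop) aA)
        (AnalyticAt.fun_mul (by fun_prop) aB))
    have aB' : AnalyticAt ℝ B' 0 :=
      AnalyticAt.fun_mul (by fun_prop) (AnalyticAt.fun_mul (by fun_prop) aB)
    -- The exponent d may be negative; multiplying by u ^ |d| keeps the coefficients analytic.
    refine ⟨ω₁ * N + d.natAbs, A', B', aA', aB', ?_⟩
    refine eventuallyEq_of_off_divisor ((aA'.fun_mul T.analytic_P).fun_add
      (aB'.fun_mul T.analytic_Q)) (by fun_prop) ?_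
    filter_upwards [hlim.eventually hAB, hd] with q hq hdq hq0
    have hX := hdq hq0
    rw [fderiv_xBlowUp] at hX
    simp only [X, Prod.smul_mk, Prod.mk.injEq, smul_eq_mul] at hX
    rw [hX.1, hX.2] at hq
    have e1 : q.1 ^ (d + d.natAbs).toNat = q.1 ^ d * q.1 ^ d.natAbs := by
      rw [← zpow_natCast q.1 d.natAbs, ← zpow_add₀ hq0, ← zpow_natCast, Int.toNat_of_nonneg (by omega)]
    have e2 : (xBlowUp ω₁ ω₂ σ ξ q).1 ^ N = s ^ N * q.1 ^ (ω₁ * N) := by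
      simp only [xBlowUp]; rw [mul_pow, ← pow_mul]
    rw [e2] at hq
    simp only [A', B']
    rw [e1, pow_add]
    linear_combination s ^ N * q.1 ^ d.natAbs * hq + q.1 ^ (ω₁ * N) * q.1 ^ d.natAbs * hσ N
  · obtain ⟨N, A, B, hA, hB, hAB⟩ := h.impasse
    obtain ⟨d, hd⟩ := hT.impasse
    have aA := analyticAt_comp_xBlowUp (σ := σ) (ξ := ξ) hA h₁ h₂
    have aB := analyticAt_comp_xBlowUp (σ := σ) (ξ := ξ) hB h₁ h₂
    set s : ℝ := ((σ : ℤ) : ℝ)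
    refine ⟨ω₁ * N + ω₂, fun q => s ^ N * q.1 ^ (ω₂ + d) * A (xBlowUp ω₁ ω₂ σ ξ q),
      fun q => s ^ N * q.1 ^ d * B (xBlowUp ω₁ ω₂ σ ξ q),
      AnalyticAt.fun_mul (by fun_prop) aA, AnalyticAt.fun_mul (by fun_prop) aB, ?_⟩
    filter_upwards [hlim.eventually hAB, hd.eventually_nhds,
      hlim.eventually S.analytic_δ.eventually_analyticAt,
      T.analytic_δ.eventually_analyticAt] with q hq hdq hSq hTq
    have e0 := hdq.self_of_nhds
    have e1 : HasFDerivAt (fun q => S.δ (xBlowUp ω₁ ω₂ σ ξ q))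
        ((fderiv ℝ S.δ (xBlowUp ω₁ ω₂ σ ξ q)).comp (fderiv ℝ (xBlowUp ω₁ ω₂ σ ξ) q)) q :=
      hSq.differentiableAt.hasFDerivAt.comp q
        (hasFDerivAt_xBlowUp ω₁ ω₂ σ ξ q).differentiableAt.hasFDerivAt
    have hx : HasFDerivAt (fun q : ℝ × ℝ => q.1) (ContinuousLinearMap.fst ℝ ℝ ℝ) q :=
      hasFDerivAt_fst
    have e2 : HasFDerivAt (fun q : ℝ × ℝ => q.1 ^ d * T.δ q) _ q :=
      (hx.pow d).mul hTq.differentiableAt.hasFDerivAt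
    have e3 := congrArg (fun L => L (0, 1))
      ((e1.congr_of_eventuallyEq (f₁ := fun q : ℝ × ℝ => q.1 ^ d * T.δ q)
        (hdq.mono fun _ h => h.symm)).unique e2)
    simp only [ContinuousLinearMap.comp_apply, fderiv_xBlowUp, mul_zero, mul_one, zero_add] at e3
    have e4 : ((0 : ℝ), q.1 ^ ω₂) = q.1 ^ ω₂ • ((0 : ℝ), (1 : ℝ)) := by simp
    rw [e4, map_smul] at e3
    simp at e3
    have e5 : (xBlowUp ω₁ ω₂ σ ξ q).1 ^ N = s ^ N * q.1 ^ (ω₁ * N) := by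
      simp only [xBlowUp]; rw [mul_pow, ← pow_mul]
    rw [e5, e0] at hq
    rw [pow_add, pow_add]
    linear_combination s ^ N * q.1 ^ ω₂ * hq - s ^ N * B (xBlowUp ω₁ ω₂ σ ξ q) * e3 +
      q.1 ^ (ω₁ * N) * q.1 ^ ω₂ * hσ N

end ConstrainedGerm

namespace ConstrainedGerm

/-! ### Order of vanishing of functions of one variable -/

/-- The function of one variable is divisible by `x ^ M` in the ring of analytic germs. -/
def VanishesTo (M : ℕ) (f : ℝ → ℝ) : Prop :=
  ∃ g : ℝ → ℝ, AnalyticAt ℝ g 0 ∧ ∀ᶠ x in 𝓝 (0 : ℝ), f x = x ^ M * g x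

namespace VanishesTo

variable {M N : ℕ} {f g : ℝ → ℝ}

theorem iff_le_order (hf : AnalyticAt ℝ f 0) : VanishesTo M f ↔ M ≤ analyticOrderAt f 0 := by
  rw [natCast_le_analyticOrderAt hf]
  simp [VanishesTo]

theorem zero_of_analyticAt (hf : AnalyticAt ℝ f 0) : VanishesTo 0 f :=
  ⟨f, hf, Eventually.of_forall fun x => by simp⟩

theorem congr (h : VanishesTo M f) (e : ∀ᶠ x in 𝓝 (0 : ℝ), g x = f x) : VanishesTo M g := by
  obtain ⟨k, hk, hke⟩ := h
  exact ⟨k, hk, by filter_upwards [hke, e] with x h1 h2; rw [h2, h1]⟩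

theorem mono (h : VanishesTo M f) (hN : N ≤ M) : VanishesTo N f := by
  obtain ⟨k, hk, hke⟩ := h
  refine ⟨fun x => x ^ (M - N) * k x, by fun_prop, ?_⟩
  filter_upwards [hke] with x hx
  rw [hx, ← mul_assoc, ← pow_add, Nat.add_sub_cancel' hN]

theorem add (h : VanishesTo M f) (h' : VanishesTo M g) : VanishesTo M (fun x => f x + g x) := by
  obtain ⟨k, hk, hke⟩ := h
  obtain ⟨k', hk', hke'⟩ := h'
  exact ⟨fun x => k x + k' x, by fun_prop, by
    filter_upwards [hke, hke'] with x h1 h2; rw [h1, h2]; ring⟩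

theorem mul_left (h : VanishesTo M f) (hg : AnalyticAt ℝ g 0) :
    VanishesTo M (fun x => g x * f x) := by
  obtain ⟨k, hk, hke⟩ := h
  exact ⟨fun x => g x * k x, by fun_prop, by filter_upwards [hke] with x h1; rw [h1]; ring⟩

theorem neg (h : VanishesTo M f) : VanishesTo M (fun x => - f x) :=
  (h.mul_left (g := fun _ => -1) analyticAt_const).congr (Eventually.of_forall fun x => by simp)

theorem sub (h : VanishesTo M f) (h' : VanishesTo M g) : VanishesTo M (fun x => f x - g x) :=
  (h.add h'.neg).congr (Eventually.of_forall fun x => by ring)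

theorem of_pow_mul (h : VanishesTo M (fun x => x ^ N * f x)) (hf : AnalyticAt ℝ f 0) :
    VanishesTo (M - N) f := by
  rcases le_total M N with hMN | hMN
  · rw [Nat.sub_eq_zero_of_le hMN]; exact zero_of_analyticAt hf
  obtain ⟨k, hk, hke⟩ := h
  refine ⟨k, hk, ?_⟩
  have h1 : f =ᶠ[𝓝 0] fun x => x ^ (M - N) * k x := by
    refine (hf.frequently_eq_iff_eventually_eq (by fun_prop)).1 ?_
    refine Filter.Eventually.frequently ?_
    filter_upwards [hke.filter_mono nhdsWithin_le_nhds, self_mem_nhdsWithin] with x hx hx0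
    refine mul_left_cancel₀ (pow_ne_zero N hx0) ?_
    rw [hx, ← mul_assoc, ← pow_add, Nat.add_sub_cancel' hMN]
  exact h1

theorem le_of_pow (h : VanishesTo M (fun x => x ^ N)) : M ≤ N := by
  by_contra hcon
  push Not at hcon
  obtain ⟨k, hk, hke⟩ := (h.congr (g := fun x => x ^ N * 1)
    (Eventually.of_forall fun x => by simp)).of_pow_mul analyticAt_const
  have := hke.self_of_nhds
  rw [zero_pow (by omega), zero_mul] at this
  exact one_ne_zero this

theorem eventually_eq_zero (hf : AnalyticAt ℝ f 0) (h : ∀ M, ∃ M', M ≤ M' ∧ VanishesTo M' f) :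
    ∀ᶠ x in 𝓝 (0 : ℝ), f x = 0 := by
  rw [← analyticOrderAt_eq_top, ENat.eq_top_iff_forall_ge]
  intro M
  obtain ⟨M', hM, hv⟩ := h M
  exact (iff_le_order hf).1 (hv.mono hM)

theorem of_iteratedDeriv (hf : AnalyticAt ℝ f 0) (h : ∀ k < M, iteratedDeriv k f 0 = 0) :
    VanishesTo M f :=
  (iff_le_order hf).2 ((natCast_le_analyticOrderAt_iff_iteratedDeriv_eq_zero hf).2 h)

theorem analyticAt (h : VanishesTo M f) : AnalyticAt ℝ f 0 := by
  obtain ⟨k, hk, hke⟩ := h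
  have : AnalyticAt ℝ (fun x => x ^ M * k x) 0 := by fun_prop
  exact this.congr (hke.mono fun _ h => h.symm)

theorem iteratedDeriv_eq_zero (h : VanishesTo M f) {k : ℕ} (hk : k < M) :
    iteratedDeriv k f 0 = 0 :=
  (natCast_le_analyticOrderAt_iff_iteratedDeriv_eq_zero h.analyticAt).1
    ((iff_le_order h.analyticAt).1 h) k hk

theorem deriv (h : VanishesTo (M + 1) f) : VanishesTo M (deriv f) := by
  refine of_iteratedDeriv h.analyticAt.deriv fun k hk => ?_
  rw [← iteratedDeriv_succ']
  exact h.iteratedDeriv_eq_zero (by omega)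

theorem pow_mul (hf : AnalyticAt ℝ f 0) : VanishesTo M (fun x => x ^ M * f x) :=
  ⟨f, hf, Eventually.of_forall fun _ => rfl⟩

end VanishesTo

/-! ### Orders along the axis `{y = 0}` -/

theorem eventually_slice_fst {p : ℝ × ℝ → Prop} (h : ∀ᶠ q in 𝓝 (0 : ℝ × ℝ), p q) :
    ∀ᶠ x in 𝓝 (0 : ℝ), p (x, 0) :=
  (Continuous.tendsto' (by fun_prop : Continuous fun x : ℝ => (x, (0 : ℝ))) 0 0 rfl).eventually h

theorem analyticAt_slice_fst {f : ℝ × ℝ → ℝ} (hf : AnalyticAt ℝ f 0) :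
    AnalyticAt ℝ (fun x => f (x, 0)) 0 :=
  AnalyticAt.comp_of_eq hf (f := fun x : ℝ => (x, (0 : ℝ))) (analyticAt_id.prod analyticAt_const) rfl

theorem analyticAt_fderiv_snd {f : ℝ × ℝ → ℝ} (hf : AnalyticAt ℝ f 0) :
    AnalyticAt ℝ (fun q => fderiv ℝ f q (0, 1)) 0 :=
  (ContinuousLinearMap.analyticAt (ContinuousLinearMap.apply ℝ ℝ ((0 : ℝ), (1 : ℝ))) _).comp
    hf.fderiv

theorem vanishesTo_slice {f : ℝ × ℝ → ℝ} (hf : AnalyticAt ℝ f 0) {M : ℕ}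
    (h : ∀ k < M, taylorCoeff f k 0 = 0) : VanishesTo M fun x => f (x, 0) := by
  refine VanishesTo.of_iteratedDeriv (analyticAt_slice_fst hf) fun k hk => ?_
  have := h k hk
  simp only [taylorCoeff, iteratedDeriv_zero] at this
  simpa [Nat.factorial_ne_zero] using this

theorem vanishesTo_slice_fderiv {f : ℝ × ℝ → ℝ} (hf : AnalyticAt ℝ f 0) {M : ℕ}
    (h : ∀ k < M, taylorCoeff f k 1 = 0) : VanishesTo M fun x => fderiv ℝ f (x, 0) (0, 1) := by
  refine VanishesTo.of_iteratedDeriv (analyticAt_slice_fst (analyticAt_fderiv_snd hf))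
    fun k hk => ?_
  have := h k hk
  have e : (fun x => iteratedDeriv 1 (fun y => f (x, y)) 0) =ᶠ[𝓝 0]
      fun x => fderiv ℝ f (x, 0) (0, 1) := by
    filter_upwards [eventually_slice_fst hf.eventually_analyticAt] with x hx
    rw [fderiv_apply_snd hx.differentiableAt, iteratedDeriv_one]
  rw [taylorCoeff, e.iteratedDeriv_eq] at this
  simpa [Nat.factorial_ne_zero] using this

variable {S : ConstrainedGerm} {N N' M : ℕ} {p : ℤ × ℤ} {h β : ℕ}

theorem FieldBezout.vanishesTo (hN : S.FieldBezout N)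
    (hF : VanishesTo M fun x => S.δ (x, 0) * S.P (x, 0))
    (hG : VanishesTo M fun x => S.δ (x, 0) * S.Q (x, 0)) :
    VanishesTo M fun x => x ^ N * S.δ (x, 0) := by
  obtain ⟨A, B, hA, hB, hAB⟩ := hN
  refine ((hF.mul_left (analyticAt_slice_fst hA)).add (hG.mul_left (analyticAt_slice_fst hB))).congr ?_
  filter_upwards [eventually_slice_fst hAB] with x hx
  linear_combination - S.δ (x, 0) * hx

/-- By the product rule, x^(N+N')R = x^N R(Aδ + B∂δ/∂y) is a combination of x^N δ and x^N ∂(δR)/∂y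
along the axis, since ∂δ/∂y · R = ∂(δR)/∂y - δ∂R/∂y. -/
theorem ImpasseBezout.vanishesTo (hN' : S.ImpasseBezout N') {R : ℝ × ℝ → ℝ}
    (hR : AnalyticAt ℝ R 0) (hδ : VanishesTo M fun x => x ^ N * S.δ (x, 0))
    (hF' : VanishesTo M fun x => fderiv ℝ (fun q => S.δ q * R q) (x, 0) (0, 1)) :
    VanishesTo (M - (N + N')) fun x => R (x, 0) := by
  obtain ⟨A, B, hA, hB, hAB⟩ := hN'
  refine VanishesTo.of_pow_mul ?_ (analyticAt_slice_fst hR)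
  have hxN : AnalyticAt ℝ (fun x : ℝ => x ^ N) 0 := by fun_prop
  have h1 := (hF'.mul_left hxN).sub (hδ.mul_left (analyticAt_slice_fst (analyticAt_fderiv_snd hR)))
  have h2 := (hδ.mul_left ((analyticAt_slice_fst hA).fun_mul (analyticAt_slice_fst hR))).add
    (h1.mul_left (analyticAt_slice_fst hB))
  refine h2.congr ?_
  filter_upwards [eventually_slice_fst hAB,
    eventually_slice_fst S.analytic_δ.eventually_analyticAt,
    eventually_slice_fst hR.eventually_analyticAt] with x hx hδx hRx
  have e : fderiv ℝ (fun q => S.δ q * R q) (x, 0) (0, 1) =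
      S.δ (x, 0) * fderiv ℝ R (x, 0) (0, 1) + R (x, 0) * fderiv ℝ S.δ (x, 0) (0, 1) := by
    rw [fderiv_fun_mul hδx.differentiableAt hRx.differentiableAt]
    simp
  rw [e, pow_add]
  linear_combination - x ^ N * R (x, 0) * hx

/-- Orders along `{y = 0}` when the polygon lies above a line of small slope through the main
vertex: `δ` and `Q` almost vanish there, and the height is one. -/
theorem vanishesTo_of_above (hN : S.FieldBezout N) (hN' : S.ImpasseBezout N')
    (hab : ∀ p' ∈ S.support, p.1 + β * p.2 ≤ p'.1 + β * p'.2) (hr : p.1 = 0 ∨ p.1 = -1)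
    (hh : p.2 = h) (hpos : 0 < h) :
    VanishesTo (β - 1 - N) (fun x => S.δ (x, 0)) ∧
      VanishesTo (β - 1 - (N + N')) (fun x => S.Q (x, 0)) ∧ (2 ≤ h → β - 1 ≤ N + (N + N')) := by
  have hβ : (0 : ℤ) ≤ β := by positivity
  -- One unit below the main vertex the line has moved β to the right, and p.1 ≥ -1; hence the bound
  -- β - 1.
  have cP : ∀ k l : ℕ, l < h → k < β - 1 → taylorCoeff (fun q => S.δ q * S.P q) k l = 0 := by
    intro k l hl hk
    by_contra hne
    have h1 := hab _ (mem_support_P hne)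
    dsimp only at h1
    rw [hh] at h1
    have h2 : (β : ℤ) * l ≤ β * (h - 1) := mul_le_mul_of_nonneg_left (by omega) hβ
    rw [mul_sub] at h2
    omega
  have cQ : ∀ k l : ℕ, l ≤ h → k < β - 1 → taylorCoeff (fun q => S.δ q * S.Q q) k l = 0 := by
    intro k l hl hk
    by_contra hne
    have h1 := hab _ (mem_support_Q hne)
    dsimp only at h1
    rw [hh] at h1
    have h2 : (β : ℤ) * (l - 1) ≤ β * (h - 1) := mul_le_mul_of_nonneg_left (by omega) hβ
    rw [mul_sub (β : ℤ) h 1] at h2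
    omega
  have vδ := hN.vanishesTo (vanishesTo_slice S.analytic_δP fun k hk => cP k 0 hpos hk)
    (vanishesTo_slice S.analytic_δQ fun k hk => cQ k 0 hpos.le hk)
  have vQ := hN'.vanishesTo S.analytic_Q vδ
    (vanishesTo_slice_fderiv S.analytic_δQ fun k hk => cQ k 1 hpos hk)
  refine ⟨vδ.of_pow_mul (analyticAt_slice_fst S.analytic_δ), vQ, fun h2 => ?_⟩
  -- Height at least two makes the y-linear part of δP nearly vanish too, so P and Q both vanish to
  -- high order on the axis; the field relation bounds this order by N.
  have vP := hN'.vanishesTo S.analytic_P vδ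
    (vanishesTo_slice_fderiv S.analytic_δP fun k hk => cP k 1 h2 hk)
  obtain ⟨A, B, hA, hB, hAB⟩ := hN
  have h3 := ((vP.mul_left (analyticAt_slice_fst hA)).add
    (vQ.mul_left (analyticAt_slice_fst hB))).congr (g := fun x => x ^ N)
    (by filter_upwards [eventually_slice_fst hAB] with x hx using hx.symm)
  have := h3.le_of_pow
  omega

/-- When the main segment is horizontal and the height positive, the height is one and the axis
`{y = 0}` is an invariant curve contained in the impasse set. -/
theorem Tame.of_horizontal (hS : S.Tame) (hp : S.MainPoint p) (hr : p.1 = 0 ∨ p.1 = -1)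
    (hh : p.2 = h) (hpos : 0 < h) (hhor : S.MainSegmentHorizontal) :
    h = 1 ∧ (∀ᶠ x in 𝓝 (0 : ℝ), S.δ (x, 0) = 0) ∧ ∀ᶠ x in 𝓝 (0 : ℝ), S.Q (x, 0) = 0 := by
  obtain ⟨N, hN⟩ := hS.field
  obtain ⟨N', hN'⟩ := hS.impasse
  have hhor := hp.horizontal_iff.1 hhor
  -- A horizontal segment lies above the lines of every slope, so all the order estimates hold with
  -- β arbitrarily large.
  have hab : ∀ β : ℕ, ∀ p' ∈ S.support, p.1 + β * p.2 ≤ p'.1 + β * p'.2 := fun β p' hp' =>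
    add_le_add (hp.2 p' hp').1 (mul_le_mul_of_nonneg_left (hhor p' hp') (by positivity))
  have key := fun β => vanishesTo_of_above hN hN' (hab β) hr hh hpos
  refine ⟨?_, VanishesTo.eventually_eq_zero (analyticAt_slice_fst S.analytic_δ) fun M =>
    ⟨_, ?_, (key (M + N + 1)).1⟩, VanishesTo.eventually_eq_zero
      (analyticAt_slice_fst S.analytic_Q) fun M => ⟨_, ?_, (key (M + N + N' + 1)).2.1⟩⟩
  · by_contra hne
    have := (key (N + N + N' + 2)).2.2 (by omega)
    omega
  · omega
  · omega

end ConstrainedGerm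

namespace ConstrainedGerm

/-! ### Implicit curves with simple zeros off the origin -/

theorem exists_analytic_implicit {H : ℝ × ℝ → ℝ} (hH : AnalyticAt ℝ H 0) (h0 : H 0 = 0)
    (hd : fderiv ℝ H 0 (0, 1) ≠ 0) :
    ∃ w : ℝ → ℝ, AnalyticAt ℝ w 0 ∧ w 0 = 0 ∧ ∀ᶠ x in 𝓝 (0 : ℝ), H (x, w x) = 0 := by
  -- The smoothness exponent ⊤ means analytic, so the implicit function is analytic too.
  have hc : ContDiffAt ℝ ⊤ H 0 := hH.contDiffAt
  have hinv : (fderiv ℝ H 0 ∘L .inr ℝ ℝ ℝ).IsInvertible := by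
    let e : ℝ ≃L[ℝ] ℝ := ContinuousLinearEquiv.unitsEquivAut ℝ (Units.mk0 _ hd)
    refine ⟨e, ?_⟩
    ext
    simp [e]
  refine ⟨hc.implicitFunction (by simp) hinv, (hc.contDiffAt_implicitFunction (by simp) hinv).analyticAt,
    hc.implicitFunction_apply_self (by simp) hinv, ?_⟩
  have := hc.eventually_apply_implicitFunction (by simp) hinv
  rwa [h0] at this

theorem exists_eq_slice_add {f : ℝ × ℝ → ℝ} (hf : AnalyticAt ℝ f 0) :
    ∃ R : ℝ × ℝ → ℝ, AnalyticAt ℝ R 0 ∧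
      (∀ᶠ q in 𝓝 (0 : ℝ × ℝ), f q = f (q.1, 0) + q.2 * R q) ∧
      ∀ᶠ x in 𝓝 (0 : ℝ), R (x, 0) = fderiv ℝ f (x, 0) (0, 1) := by
  have h1 : AnalyticAt ℝ (fun q : ℝ × ℝ => f (q.1, 0)) 0 :=
    AnalyticAt.fun_comp (f := Prod.fst) (g := fun x => f (x, 0)) (analyticAt_slice_fst hf)
      analyticAt_fst
  obtain ⟨R, hR, hRe⟩ := exists_eq_y_mul (hf.fun_sub h1) (Eventually.of_forall fun x => sub_self _)
  refine ⟨R, hR, by filter_upwards [hRe] with q hq; rw [← hq]; ring, ?_⟩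
  have h2 := deriv_x_mul (f := fun q => f q.swap - f (q.2, 0)) (analyticAt_swap hR)
    (by filter_upwards [eventually_swap hRe] with q hq using hq)
  filter_upwards [h2, eventually_slice_fst hf.eventually_analyticAt] with x hx hfx
  rw [fderiv_apply_snd hfx.differentiableAt]
  simpa using hx.symm

theorem analyticAt_graph {f : ℝ × ℝ → ℝ} (hf : AnalyticAt ℝ f 0) {η : ℝ → ℝ}
    (hη : AnalyticAt ℝ η 0) (h0 : η 0 = 0) : AnalyticAt ℝ (fun x => f (x, η x)) 0 :=
  AnalyticAt.comp_of_eq hf (f := fun x : ℝ => (x, η x)) (analyticAt_id.prod hη) (by simp [h0])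

theorem eventually_graph {p : ℝ × ℝ → Prop} {η : ℝ → ℝ} (hη : AnalyticAt ℝ η 0) (h0 : η 0 = 0)
    (h : ∀ᶠ q in 𝓝 (0 : ℝ × ℝ), p q) : ∀ᶠ x in 𝓝 (0 : ℝ), p (x, η x) := by
  have h1 : AnalyticAt ℝ (fun x : ℝ => (x, η x)) 0 := analyticAt_id.prod hη
  have h2 := h1.continuousAt.tendsto
  rw [h0] at h2
  exact h2.eventually h

/-- A Hensel-type argument: on the axis f vanishes to order more than 2K, whereas the relation
limits the order of ∂f/∂y to some c ≤ K. An approximate root of this quality can be corrected to an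
exact one. -/
theorem exists_root_curve {f A B : ℝ × ℝ → ℝ} {K : ℕ} (hf : AnalyticAt ℝ f 0)
    (hA : AnalyticAt ℝ A 0)
    (hB : AnalyticAt ℝ B 0)
    (hAB : ∀ᶠ q in 𝓝 (0 : ℝ × ℝ), A q * f q + B q * fderiv ℝ f q (0, 1) = q.1 ^ K)
    (hv : VanishesTo (2 * K + 2) fun x => f (x, 0)) :
    ∃ η : ℝ → ℝ, VanishesTo (K + 1) η ∧ ∀ᶠ x in 𝓝 (0 : ℝ), f (x, η x) = 0 := by
  have hABx := eventually_slice_fst hAB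
  have ae := analyticAt_slice_fst (analyticAt_fderiv_snd hf)
  have hle : ∀ c, VanishesTo c (fun x => fderiv ℝ f (x, 0) (0, 1)) → c ≤ K := by
    intro c hc
    by_contra hcon
    have h1 := ((hv.mono (N := K + 1) (by omega)).mul_left (analyticAt_slice_fst hA)).add
      ((hc.mono (N := K + 1) (by omega)).mul_left (analyticAt_slice_fst hB))
    have := (h1.congr (g := fun x => x ^ K) (hABx.mono fun x hx => hx.symm)).le_of_pow
    omega
  have hfin : analyticOrderAt (fun x => fderiv ℝ f (x, 0) (0, 1)) 0 ≠ ⊤ := by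
    intro htop
    have := hle (K + 1) ((VanishesTo.iff_le_order ae).2 (by rw [htop]; exact le_top))
    omega
  obtain ⟨c, hc⟩ := ENat.ne_top_iff_exists.1 hfin
  obtain ⟨e₀, he₀, hne, hee⟩ := (ae.analyticOrderAt_eq_natCast).1 hc.symm
  have hcK : c ≤ K := hle c ⟨e₀, he₀, by simpa using hee⟩
  obtain ⟨d₀, hd₀, hde⟩ := hv.mono (N := c + K + 2) (by omega)
  obtain ⟨R₁, hR₁, hR₁e, hR₁0⟩ := exists_eq_slice_add hf
  obtain ⟨R₂, hR₂, hR₂e, -⟩ := exists_eq_slice_add hR₁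
  have aπ : AnalyticAt ℝ (fun q : ℝ × ℝ => (q.1, q.1 ^ (K + 1) * q.2)) 0 :=
    analyticAt_fst.prod (by fun_prop)
  have hπ : Tendsto (fun q : ℝ × ℝ => (q.1, q.1 ^ (K + 1) * q.2)) (𝓝 0) (𝓝 0) := by
    have := aπ.continuousAt.tendsto
    rwa [show ((0 : ℝ × ℝ).1, (0 : ℝ × ℝ).1 ^ (K + 1) * (0 : ℝ × ℝ).2) = 0 by simp] at this
  have aR : AnalyticAt ℝ (fun q : ℝ × ℝ => R₂ (q.1, q.1 ^ (K + 1) * q.2)) 0 :=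
    hR₂.comp_of_eq aπ (by simp)
  have ad : AnalyticAt ℝ (fun q : ℝ × ℝ => d₀ q.1) 0 :=
    AnalyticAt.fun_comp (f := Prod.fst) (g := d₀) hd₀ analyticAt_fst
  have ae' : AnalyticAt ℝ (fun q : ℝ × ℝ => e₀ q.1) 0 :=
    AnalyticAt.fun_comp (f := Prod.fst) (g := e₀) he₀ analyticAt_fst
  -- H is f(x, x^(K+1) w) divided by x^(c+K+1). Its linear coefficient in w is the unit e₀, and the
  -- quadratic term still carries x^(K+1-c), a positive power.
  let H : ℝ × ℝ → ℝ := fun q => q.1 * d₀ q.1 + e₀ q.1 * q.2 +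
    q.1 ^ (K + 1 - c) * q.2 ^ 2 * R₂ (q.1, q.1 ^ (K + 1) * q.2)
  have aH : AnalyticAt ℝ H 0 := by
    refine AnalyticAt.fun_add (AnalyticAt.fun_add (AnalyticAt.fun_mul (by fun_prop) ad)
      (AnalyticAt.fun_mul ae' (by fun_prop))) (AnalyticAt.fun_mul (by fun_prop) aR)
  have hKc : K + 1 - c ≠ 0 := by omega
  obtain ⟨w, hw, hw0, hHw⟩ := exists_analytic_implicit aH (by simp [H]) (by
    rw [show (0 : ℝ × ℝ) = (0, 0) from rfl, fderiv_apply_snd aH.differentiableAt]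
    have : (fun v => H (0, v)) = fun v => e₀ 0 * v := by funext v; simp [H, hKc]
    rw [this]
    simpa using hne)
  refine ⟨fun x => x ^ (K + 1) * w x, VanishesTo.pow_mul hw, ?_⟩
  have hlim := fun {p : ℝ × ℝ → Prop} => eventually_graph (p := p) hw hw0
  filter_upwards [hHw, hlim (hπ.eventually hR₁e), hlim (hπ.eventually hR₂e), hR₁0, hde, hee]
    with x h1 h2 h3 h4 h5 h6
  simp only [H] at h1
  simp only [sub_zero, smul_eq_mul] at h6
  rw [h2, h3, h4, h6, h5]
  have e : x ^ (K + 1) * x ^ (K + 1) = x ^ (c + K + 1) * x ^ (K + 1 - c) := by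
    rw [← pow_add, ← pow_add]; congr 1; omega
  have e' : x ^ (c + K + 2) = x ^ (c + K + 1) * x := pow_succ _ _
  have e'' : x ^ (K + 1) * x ^ c = x ^ (c + K + 1) := by rw [← pow_add]; congr 1; omega
  linear_combination x ^ (c + K + 1) * h1 + d₀ x * e' + w x * e₀ x * e'' +
    w x ^ 2 * R₂ (x, x ^ (K + 1) * w x) * e

/-! ### Infinite sequences of monomial shears -/

/-- The partial sums of `∑ α n x ^ β n`. -/
def partialSum (α : ℕ → ℝ) (β : ℕ → ℕ) (n : ℕ) (x : ℝ) : ℝ := ∑ i ∈ Finset.range n, α i * x ^ β i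

variable {α : ℕ → ℝ} {β : ℕ → ℕ}

theorem analyticAt_partialSum (n : ℕ) : AnalyticAt ℝ (partialSum α β n) 0 := by
  unfold partialSum
  exact Finset.analyticAt_fun_sum _ fun i _ => by fun_prop

theorem partialSum_zero_right (hβ : ∀ n, 0 < β n) (n : ℕ) : partialSum α β n 0 = 0 :=
  Finset.sum_eq_zero fun i _ => by simp [(hβ i).ne']

theorem vanishesTo_partialSum_sub (hβ : StrictMono β) {n m : ℕ} (hnm : n ≤ m) :
    VanishesTo (β n) fun x => partialSum α β m x - partialSum α β n x := by
  induction m, hnm using Nat.le_induction with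
  | base => exact ⟨fun _ => 0, analyticAt_const, Eventually.of_forall fun x => by simp⟩
  | succ m hm ih =>
    have h1 : VanishesTo (β m) fun x => x ^ β m * α m := VanishesTo.pow_mul analyticAt_const
    refine (ih.add (h1.mono (hβ.monotone hm))).congr (Eventually.of_forall fun x => ?_)
    simp only [partialSum, Finset.sum_range_succ]
    ring

/-- The coefficients of a germ of which all partial sums are good approximations. -/
theorem hasSum_of_vanishesTo (hβ : StrictMono β) {φ : ℝ → ℝ} (hφ : AnalyticAt ℝ φ 0)
    (h : ∀ K, ∃ m₀, ∀ m ≥ m₀, VanishesTo K fun x => φ x - partialSum α β m x) :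
    ∀ᶠ x in 𝓝 (0 : ℝ), HasSum (fun n => α n * x ^ β n) (φ x) := by
  obtain ⟨c, hc⟩ : ∃ c : ℕ → ℝ, ∀ᶠ x in 𝓝 (0 : ℝ), HasSum (fun k => c k * x ^ k) (φ x) := by
    obtain ⟨q, hq⟩ := hφ
    rw [hasFPowerSeriesAt_iff] at hq
    exact ⟨q.coeff, by filter_upwards [hq] with x hx; simpa [mul_comm] using hx⟩
  let a : ℕ → ℕ → ℝ := fun m k => ∑ i ∈ Finset.range m, if k = β i then α i else 0
  have ha : ∀ m x, HasSum (fun k => a m k * x ^ k) (partialSum α β m x) := by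
    intro m x
    have : (fun k => a m k * x ^ k) =
        fun k => ∑ i ∈ Finset.range m, (if k = β i then α i else 0) * x ^ k := by
      funext k; simp only [a, Finset.sum_mul]
    rw [this]
    refine hasSum_sum fun i _ => ?_
    convert hasSum_single (β i) ?_ using 1
    · simp
    · intro k hk; simp [hk]
  -- Closeness beyond order k fixes the k-th coefficient, so φ has the limiting coefficients of the
  -- partial sums; strict growth of β keeps the monomials from colliding.
  have hca : ∀ k, ∃ m₀, ∀ m ≥ m₀, c k = a m k := by
    intro k
    obtain ⟨m₀, hm₀⟩ := h (k + 1)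
    refine ⟨m₀, fun m hm => ?_⟩
    have h1 : ∀ᶠ x in 𝓝 (0 : ℝ), HasSum (fun k => (c k - a m k) * x ^ k)
        (φ x - partialSum α β m x) := by
      filter_upwards [hc] with x hx
      exact (hx.sub (ha m x)).congr_left fun k => by ring
    have h2 := iteratedDeriv_eq_of_hasSum h1 k
    rw [(hm₀ m hm).iteratedDeriv_eq_zero (by omega)] at h2
    have h3 : (k.factorial : ℝ) ≠ 0 := by positivity
    have := (mul_eq_zero.1 h2.symm).resolve_left h3
    linarith
  have h1 : ∀ n, c (β n) = α n := by
    intro n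
    obtain ⟨m₀, hm₀⟩ := hca (β n)
    rw [hm₀ (max m₀ (n + 1)) (le_max_left _ _)]
    simp only [a]
    rw [Finset.sum_eq_single n]
    · simp
    · intro i _ hi
      rw [if_neg]
      exact fun e => hi (hβ.injective e.symm)
    · intro hn
      exact absurd (Finset.mem_range.2 (by omega)) hn
  have h2 : ∀ k ∉ Set.range β, c k = 0 := by
    intro k hk
    obtain ⟨m₀, hm₀⟩ := hca k
    rw [hm₀ m₀ le_rfl]
    refine Finset.sum_eq_zero fun i _ => if_neg fun e => hk ⟨i, e.symm⟩
  filter_upwards [hc] with x hx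
  have h3 := (hβ.injective.hasSum_iff (f := fun k => c k * x ^ k) (a := φ x)
    fun k hk => by simp [h2 k hk]).2 hx
  refine h3.congr_left fun n => ?_
  simp [h1]

variable {S : ConstrainedGerm} {N N' h : ℕ} {p : ℤ × ℤ}

/-- An infinite sequence of shears along which the polygon gets steeper and steeper converges, and
its limit is an invariant curve contained in the impasse set. -/
theorem Tame.exists_invariant_curve (hS : S.Tame) (hy : ¬ S.divY) (hβ0 : ∀ n, 0 < β n)
    (hβ : StrictMono β) (hr : p.1 = 0 ∨ p.1 = -1) (hh : p.2 = h) (hpos : 0 < h)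
    (hab : ∀ n, ∀ p' ∈ (S.shear (partialSum α β n) (analyticAt_partialSum n)
      (partialSum_zero_right hβ0 n) hy).support, p.1 + β n * p.2 ≤ p'.1 + β n * p'.2) :
    h = 1 ∧ ∃ φ : ℝ → ℝ, AnalyticAt ℝ φ 0 ∧ φ 0 = 0 ∧
      (∀ᶠ x in 𝓝 (0 : ℝ), S.δ (x, φ x) = 0) ∧
      (∀ᶠ x in 𝓝 (0 : ℝ), S.Q (x, φ x) = deriv φ x * S.P (x, φ x)) ∧
      (∀ᶠ x in 𝓝 (0 : ℝ), HasSum (fun n => α n * x ^ β n) (φ x)) ∧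
      VanishesTo (β 0 + 1) fun x => φ x - α 0 * x ^ β 0 := by
  obtain ⟨N, hN⟩ := hS.field
  obtain ⟨N', hN'⟩ := hS.impasse
  let Φ := partialSum α β
  have aΦ : ∀ n, AnalyticAt ℝ (Φ n) 0 := analyticAt_partialSum
  have Φ0 : ∀ n, Φ n 0 = 0 := partialSum_zero_right hβ0
  let T : ℕ → ConstrainedGerm := fun n => S.shear (Φ n) (aΦ n) (Φ0 n) hy
  have key : ∀ n, _ := fun n => vanishesTo_of_above (hN.shear (aΦ n) (Φ0 n) hy)
    (hN'.shear (aΦ n) (Φ0 n) hy) (hab n) hr hh hpos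
  have hid : ∀ n, n ≤ β n := hβ.id_le
  refine ⟨?_, ?_⟩
  · by_contra hne
    have h1 := (key (N + (N + N') + 2)).2.2 (by omega)
    have h2 := hid (N + (N + N') + 2)
    omega
  -- Since n₀ ≤ β n₀, the impasse function restricted to the n₀-th axis vanishes to order at least
  -- 2N' + 2, as needed to find an exact root.
  let n₀ := N + 2 * N' + 3
  have hn₀ : n₀ ≤ β n₀ := hid n₀
  obtain ⟨η, hη, hηe⟩ : ∃ η : ℝ → ℝ, VanishesTo (N' + 1) η ∧
      ∀ᶠ x in 𝓝 (0 : ℝ), (T n₀).δ (x, η x) = 0 := by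
    obtain ⟨A, B, hA, hB, hAB⟩ := hN'.shear (aΦ n₀) (Φ0 n₀) hy
    exact exists_root_curve (T n₀).analytic_δ hA hB hAB ((key n₀).1.mono (by omega))
  let φ : ℝ → ℝ := fun x => η x + Φ n₀ x
  have aφ : AnalyticAt ℝ φ 0 := hη.analyticAt.fun_add (aΦ n₀)
  have η0 : η 0 = 0 := by
    obtain ⟨k, -, hke⟩ := hη
    simpa using hke.self_of_nhds
  have φ0 : φ 0 = 0 := by simp [φ, η0, Φ0]
  have hδφ : ∀ᶠ x in 𝓝 (0 : ℝ), S.δ (x, φ x) = 0 := hηe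
  let U := S.shear φ aφ φ0 hy
  have hUδ : ∀ᶠ x in 𝓝 (0 : ℝ), U.δ (x, 0) = 0 := by
    filter_upwards [hδφ] with x hx
    simpa [U, ConstrainedGerm.shear] using hx
  have hε : ∀ m, n₀ ≤ m → VanishesTo (N' + 1) fun x => φ x - Φ m x := by
    intro m hm
    refine (hη.sub ((vanishesTo_partialSum_sub (α := α) hβ hm).mono (N := N' + 1)
      (by omega))).congr (Eventually.of_forall fun x => ?_)
    simp only [φ, Φ]
    ring
  have aε : ∀ m, AnalyticAt ℝ (fun x => -(φ x - Φ m x)) 0 := fun m => (aφ.fun_sub (aΦ m)).fun_neg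
  have ε0 : ∀ m, -(φ 0 - Φ m 0) = 0 := fun m => by simp [φ0, Φ0]
  have close : ∀ m, n₀ ≤ m → VanishesTo (β m - 1 - N - N') fun x => φ x - Φ m x := by
    intro m hm
    obtain ⟨A, B, hA, hB, hAB⟩ := hN'.shear aφ φ0 hy
    obtain ⟨D₁, hD₁, hD₁e, hD₁0⟩ := exists_eq_slice_add U.analytic_δ
    obtain ⟨D₂, hD₂, hD₂e, -⟩ := exists_eq_slice_add hD₁
    obtain ⟨k, hk, hke⟩ := hε m hm
    -- Write ε = φ - Φ m. Expanding δ at its root φ and using the relation there, -Bδ on the m-th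
    -- axis equals x^N' · w · ε. The a priori bound ε = x^(N'+1) k makes w a unit, so the order of δ
    -- controls that of ε.
    let w : ℝ → ℝ := fun x => 1 - x * (k x * (B (x, 0) * D₂ (x, -(φ x - Φ m x))))
    have aw : AnalyticAt ℝ w 0 := by
      refine analyticAt_const.fun_sub (AnalyticAt.fun_mul analyticAt_id (hk.fun_mul
        ((analyticAt_slice_fst hB).fun_mul (analyticAt_graph hD₂ (aε m) (ε0 m)))))
    have w0 : w 0 ≠ 0 := by simp [w]
    have hv := ((key m).1.mul_left (analyticAt_slice_fst hB)).neg
    have hv2 : VanishesTo (β m - 1 - N - N') fun x => w x * (φ x - Φ m x) := by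
      refine VanishesTo.of_pow_mul (hv.congr ?_) (aw.fun_mul (aφ.fun_sub (aΦ m)))
      have hg := fun {p : ℝ × ℝ → Prop} => eventually_graph (p := p) (aε m) (ε0 m)
      filter_upwards [hg hD₁e, hg hD₂e, eventually_slice_fst hAB, hUδ, hD₁0, hke]
        with x h1 h2 h3 h4 h5 h6
      have e : (T m).δ (x, 0) = U.δ (x, -(φ x - Φ m x)) := by
        simp only [T, U, ConstrainedGerm.shear]; congr 2; ring
      change _ = -(B (x, 0) * (T m).δ (x, 0))
      change A (x, 0) * U.δ (x, 0) + B (x, 0) * fderiv ℝ U.δ (x, 0) (0, 1) = x ^ N' at h3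
      rw [h4, ← h5, mul_zero, zero_add] at h3
      rw [e, h1, h4, h2, zero_add]
      simp only [w]
      have h7 : x * k x * x ^ N' = φ x - Φ m x := by rw [h6]; ring
      linear_combination -(φ x - Φ m x) * h3 -
        (φ x - Φ m x) * B (x, 0) * D₂ (x, -(φ x - Φ m x)) * h7
    have hw' : AnalyticAt ℝ (fun x => (w x)⁻¹) 0 := aw.fun_inv w0
    refine (hv2.mul_left hw').congr ?_
    filter_upwards [aw.continuousAt.eventually_ne w0] with x hx
    rw [inv_mul_cancel_left₀ hx]
  have hclose : ∀ K, ∃ m₀, ∀ m ≥ m₀, VanishesTo K fun x => φ x - Φ m x := by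
    intro K
    refine ⟨n₀ + K + N + N' + 1, fun m hm => (close m (by omega)).mono ?_⟩
    have := hid m
    omega
  refine ⟨φ, aφ, φ0, hδφ, ?_, hasSum_of_vanishesTo hβ aφ hclose, ?_⟩
  -- On the straightened axis, U.Q differs from the Q component of the m-th system by terms in ε = φ
  -- - Φ m and its derivative. All of them have order tending to infinity with m, so U.Q vanishes
  -- there.
  · have hUQ : ∀ᶠ x in 𝓝 (0 : ℝ), U.Q (x, 0) = 0 := by
      refine VanishesTo.eventually_eq_zero (analyticAt_slice_fst U.analytic_Q) fun M => ⟨M, le_rfl, ?_⟩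
      obtain ⟨m₀, hm₀⟩ := hclose (M + 1)
      let m := m₀ + M + N + N' + 1
      have hm : β m ≥ m := hid m
      have v1 := hm₀ m (by omega)
      have v2 : VanishesTo M fun x => (T m).Q (x, 0) := (key m).2.1.mono (by omega)
      obtain ⟨Q₁, hQ₁, hQ₁e, -⟩ := exists_eq_slice_add U.analytic_Q
      have aP := analyticAt_graph U.analytic_P (aε m) (ε0 m)
      have aQ := analyticAt_graph hQ₁ (aε m) (ε0 m)
      refine ((((v1.mono (Nat.le_succ M)).mul_left aQ).add v2).sub (v1.deriv.mul_left aP)).congr ?_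
      filter_upwards [eventually_graph (aε m) (ε0 m) hQ₁e, aφ.eventually_analyticAt,
        (aΦ m).eventually_analyticAt] with x h1 h2 h3
      have hd : deriv (fun x => φ x - Φ m x) x = deriv φ x - deriv (Φ m) x :=
        deriv_fun_sub h2.differentiableAt h3.differentiableAt
      have e1 : x = x ∧ -(φ x - Φ m x) + φ x = 0 + Φ m x := ⟨rfl, by ring⟩
      have e2 : U.Q (x, -(φ x - Φ m x)) = S.Q (x, 0 + Φ m x) - deriv φ x * S.P (x, 0 + Φ m x) := by
        simp only [U, ConstrainedGerm.shear, e1.2]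
      have e3 : U.P (x, -(φ x - Φ m x)) = S.P (x, 0 + Φ m x) := by
        simp only [U, ConstrainedGerm.shear, e1.2]
      have e4 : (T m).Q (x, 0) = S.Q (x, 0 + Φ m x) - deriv (Φ m) x * S.P (x, 0 + Φ m x) := rfl
      rw [hd, e3, e4]
      rw [e2] at h1
      linear_combination -h1
    filter_upwards [hUQ] with x hx
    simp only [U, ConstrainedGerm.shear, zero_add] at hx
    linarith
  · obtain ⟨m₀, hm₀⟩ := hclose (β 0 + 1)
    have h1 := hm₀ (m₀ + 1) (by omega)
    have h2 := (vanishesTo_partialSum_sub (α := α) hβ (show 1 ≤ m₀ + 1 by omega)).mono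
      (N := β 0 + 1) (hβ (by norm_num))
    refine (h1.add h2).congr (Eventually.of_forall fun x => ?_)
    simp [Φ, partialSum, Finset.sum_range_succ]

end ConstrainedGerm

namespace ConstrainedGerm

variable {S T : ConstrainedGerm} {ω₁ ω₂ : ℕ} {m : ℤ} {σ : ℤˣ} {ξ : ℝ} {p : ℤ × ℤ} {φ ψ : ℝ → ℝ}

/-! ### Invariant curves contained in the impasse set -/

theorem eventually_of_punctured {f : ℝ → ℝ} (hf : AnalyticAt ℝ f 0)
    (h : ∀ᶠ x in 𝓝 (0 : ℝ), x ≠ 0 → f x = 0) : ∀ᶠ x in 𝓝 (0 : ℝ), f x = 0 :=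
  (hf.eventually_eq_zero_or_eventually_ne_zero).resolve_right fun hne => by
    have : ∀ᶠ x in 𝓝[≠] (0 : ℝ), False := by
      filter_upwards [hne, h.filter_mono nhdsWithin_le_nhds, self_mem_nhdsWithin] with x h1 h2 h3
      exact h1 (h2 h3)
    exact (NormedField.nhdsNE_neBot (0 : ℝ)).ne (eventually_false_iff_eq_bot.1 this)

/-- The strict transform of an invariant curve contained in the impasse set. -/
theorem IsXTransform.invariant_curve (hT : S.IsXTransform ω₁ ω₂ σ ξ T) (h₁ : 0 < ω₁)
    (hφ : AnalyticAt ℝ φ 0)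
    (hδ : ∀ᶠ x in 𝓝 (0 : ℝ), S.δ (x, φ x) = 0)
    (hQ : ∀ᶠ x in 𝓝 (0 : ℝ), S.Q (x, φ x) = deriv φ x * S.P (x, φ x))
    (hψ : AnalyticAt ℝ ψ 0) (hψ0 : ψ 0 = 0)
    (hφψ : ∀ᶠ u in 𝓝 (0 : ℝ), φ (((σ : ℤ) : ℝ) * u ^ ω₁) = u ^ ω₂ * (ξ + ψ u)) :
    (∀ᶠ u in 𝓝 (0 : ℝ), T.δ (u, ψ u) = 0) ∧
      ∀ᶠ u in 𝓝 (0 : ℝ), T.Q (u, ψ u) = deriv ψ u * T.P (u, ψ u) := by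
  have hlim : Tendsto (fun u : ℝ => ((σ : ℤ) : ℝ) * u ^ ω₁) (𝓝 0) (𝓝 0) :=
    Continuous.tendsto' (by fun_prop) _ _ (by simp [h₁.ne'])
  constructor
  · refine eventually_of_punctured (analyticAt_graph T.analytic_δ hψ hψ0) ?_
    obtain ⟨d, hd⟩ := hT.impasse
    filter_upwards [eventually_graph hψ hψ0 hd, hlim.eventually hδ, hφψ] with u h1 h2 h3 hu
    rw [h3] at h2
    simp only [xBlowUp] at h1
    rw [h2] at h1
    exact (mul_eq_zero.1 h1.symm).resolve_left (pow_ne_zero d hu)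
  · obtain ⟨d, hd⟩ := hT.field
    have a1 := analyticAt_graph T.analytic_P hψ hψ0
    have a2 := analyticAt_graph T.analytic_Q hψ hψ0
    have := eventually_of_punctured (a2.fun_sub (hψ.deriv.fun_mul a1)) ?_
    · filter_upwards [this] with u hu using sub_eq_zero.1 hu
    filter_upwards [eventually_graph hψ hψ0 hd, hlim.eventually hQ, hφψ.eventually_nhds,
      hlim.eventually hφ.eventually_analyticAt, hψ.eventually_analyticAt] with u h1 h2 h3 h4 h5 hu
    have h1 := h1 hu
    rw [fderiv_xBlowUp] at h1
    simp only [X, Prod.smul_mk, Prod.mk.injEq, smul_eq_mul, xBlowUp] at h1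
    have hd1 : HasDerivAt (fun u => φ (((σ : ℤ) : ℝ) * u ^ ω₁))
        (deriv φ (((σ : ℤ) : ℝ) * u ^ ω₁) * (((σ : ℤ) : ℝ) * (ω₁ * u ^ (ω₁ - 1)))) u :=
      HasDerivAt.comp u h4.differentiableAt.hasDerivAt ((hasDerivAt_pow ω₁ u).const_mul _)
    have hd2 : HasDerivAt (fun u => u ^ ω₂ * (ξ + ψ u))
        ((ω₂ * u ^ (ω₂ - 1)) * (ξ + ψ u) + u ^ ω₂ * deriv ψ u) u :=
      (hasDerivAt_pow ω₂ u).fun_mul (h5.differentiableAt.hasDerivAt.const_add ξ)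
    have hd3 := (hd1.congr_of_eventuallyEq (f₁ := fun u => u ^ ω₂ * (ξ + ψ u))
      (h3.mono fun u hu => hu.symm)).unique hd2
    rw [h3.self_of_nhds, h1.1, h1.2] at h2
    refine (mul_eq_zero.1 (?_ : (u ^ d * u ^ ω₂) * _ = 0)).resolve_left
      (mul_ne_zero (zpow_ne_zero d hu) (pow_ne_zero ω₂ hu))
    linear_combination h2 + u ^ d * T.P (u, ψ u) * hd3

theorem eventually_eq_of_mul {f g : ℝ → ℝ} {n : ℕ} (hf : ContinuousAt f 0) (hg : ContinuousAt g 0)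
    (h : ∀ᶠ v in 𝓝 (0 : ℝ), v ^ n * f v = v ^ n * g v) : f 0 = g 0 := by
  refine tendsto_nhds_unique_of_eventuallyEq (l := 𝓝[≠] (0 : ℝ))
    (hf.tendsto.mono_left nhdsWithin_le_nhds) (hg.tendsto.mono_left nhdsWithin_le_nhds) ?_
  filter_upwards [h.filter_mono nhdsWithin_le_nhds, self_mem_nhdsWithin] with v h1 h2
  exact mul_left_cancel₀ (pow_ne_zero n h2) h1

/-- At a point where the height stalls at one, the strict transform is elementary if the impasse set
contains an invariant curve through the point. -/
theorem IsXTransform.isElementary_of_curve (hT : S.IsXTransform ω₁ ω₂ σ ξ T) (h₁ : 0 < ω₁)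
    (h₂ : 0 < ω₂) (hm : S.Above ω₁ ω₂ m) (hp : p ∈ S.support) (hpm : ω₁ * p.1 + ω₂ * p.2 = m)
    (hst : S.Stalls ω₁ ω₂ m σ ξ 1) (hφ : AnalyticAt ℝ φ 0)
    (hδ : ∀ᶠ x in 𝓝 (0 : ℝ), S.δ (x, φ x) = 0)
    (hQ : ∀ᶠ x in 𝓝 (0 : ℝ), S.Q (x, φ x) = deriv φ x * S.P (x, φ x))
    (hψ : AnalyticAt ℝ ψ 0) (hψ0 : ψ 0 = 0)
    (hφψ : ∀ᶠ u in 𝓝 (0 : ℝ), φ (((σ : ℤ) : ℝ) * u ^ ω₁) = u ^ ω₂ * (ξ + ψ u)) :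
    T.IsElementary := by
  obtain ⟨hTδ, hTQ⟩ := hT.invariant_curve h₁ hφ hδ hQ hψ hψ0 hφψ
  obtain ⟨P, hP, hPe, hA, hB⟩ := hT.exists_log_initial h₁ h₂ hm hp hpm
  obtain ⟨a, b, hab, eA, eB⟩ := hst
  have hψ1 : AnalyticAt ℝ (fun q : ℝ × ℝ => ψ q.1) 0 :=
    AnalyticAt.fun_comp (f := Prod.fst) (g := ψ) hψ analyticAt_fst
  have hψ2 : AnalyticAt ℝ (fun q : ℝ × ℝ => deriv ψ q.1) 0 :=
    AnalyticAt.fun_comp (f := Prod.fst) (g := deriv ψ) hψ.deriv analyticAt_fst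
  obtain ⟨D, hD, hDe⟩ := exists_eq_y_mul (analyticAt_shear T.analytic_δ hψ hψ0)
    (by simpa using hTδ)
  obtain ⟨B, hBa, hBe⟩ := exists_eq_y_mul ((analyticAt_shear T.analytic_Q hψ hψ0).fun_sub
    (hψ2.fun_mul (analyticAt_shear T.analytic_P hψ hψ0)))
    (by filter_upwards [hTQ] with x hx; simp [hx])
  have hTP : ∀ᶠ v in 𝓝 (0 : ℝ), T.P (0, v) = 0 := by
    filter_upwards [eventually_slice (x := 0) (y := 0) hPe] with v hv
    simpa using hv
  have hδv : ∀ᶠ v in 𝓝 (0 : ℝ), T.δ (0, v) = v * D (0, v) := by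
    filter_upwards [eventually_slice (x := 0) (y := 0) hDe] with v hv
    simpa [hψ0] using hv
  have hQv : ∀ᶠ v in 𝓝 (0 : ℝ), T.Q (0, v) = v * B (0, v) := by
    filter_upwards [eventually_slice (x := 0) (y := 0) hBe, hTP] with v hv hv'
    simpa [hψ0, hv'] using hv
  have cD : ContinuousAt (fun v => D (0, v)) 0 := (analyticAt_slice hD).continuousAt
  have cB : ContinuousAt (fun v => B (0, v)) 0 := (analyticAt_slice hBa).continuousAt
  have cP : ContinuousAt (fun v => P (0, v)) 0 := (analyticAt_slice hP).continuousAt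
  -- On the divisor δ = vD and Q = vB while A = a(X - ξ) and B = b(X - ξ)², so a and b are products
  -- containing D(0). As they are not both zero, D(0) ≠ 0 and the impasse set is smooth, and the
  -- eigenvalues P(0), B(0) of the triangular linearization do not both vanish.
  have e1 : ((σ : ℤ) : ℝ) * ω₁ * (D (0, 0) * P (0, 0)) = a := by
    refine eventually_eq_of_mul (f := fun v => ((σ : ℤ) : ℝ) * ω₁ * (D (0, v) * P (0, v)))
      (g := fun _ => a) (n := 1) (by fun_prop) continuousAt_const ?_
    filter_upwards [hA, hδv] with v h1 h2
    rw [eA, h2] at h1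
    simp at h1
    linarith
  have e2 : D (0, 0) * B (0, 0) = b := by
    refine eventually_eq_of_mul (f := fun v => D (0, v) * B (0, v))
      (g := fun _ => b) (n := 2) (by fun_prop) continuousAt_const ?_
    filter_upwards [hB, hδv, hQv] with v h1 h2 h3
    rw [eB, h2, h3] at h1
    simp at h1
    linarith
  have hD0 : D (0, 0) ≠ 0 := fun h => hab ⟨by rw [← e1, h]; simp, by rw [← e2, h]; simp⟩
  have hPB : P (0, 0) ≠ 0 ∨ B (0, 0) ≠ 0 := by
    by_contra hcon
    push Not at hcon
    exact hab ⟨by rw [← e1, hcon.1]; simp, by rw [← e2, hcon.2]; simp⟩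
  have hP0 : T.P (0, 0) = 0 := hTP.self_of_nhds
  have hQ0 : T.Q (0, 0) = 0 := by simpa using hQv.self_of_nhds
  have hδ0 : T.δ (0, 0) = 0 := by simpa using hδv.self_of_nhds
  have slope : ∀ {f g : ℝ → ℝ}, AnalyticAt ℝ g 0 → (∀ᶠ v in 𝓝 (0 : ℝ), f v = v * g v) →
      deriv f 0 = g 0 := fun {f g} hg h => by
    have h1 : f =ᶠ[𝓝 0] fun v => v * g v := h
    rw [h1.deriv_eq]
    simpa using ((hasDerivAt_id' (0 : ℝ)).fun_mul hg.differentiableAt.hasDerivAt).deriv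
  refine Or.inr (Or.inr ⟨isSemiHyperbolic_of_triangular (Prod.ext hP0 hQ0) ?_ ?_, hδ0, ?_, ?_⟩)
  · refine (fderiv_apply_snd (x := 0) (y := 0) T.analytic_P.differentiableAt).trans ?_
    rw [Filter.EventuallyEq.deriv_eq (f := fun _ => (0 : ℝ)) hTP, deriv_const]
  · refine hPB.imp (fun h => ?_) fun h => ?_
    · refine ne_of_eq_of_ne (fderiv_apply_fst (x := 0) (y := 0) T.analytic_P.differentiableAt) ?_
      rwa [slope (g := fun u => P (u, 0)) (analyticAt_slice_fst hP) (eventually_slice_fst hPe)]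
    · refine ne_of_eq_of_ne (fderiv_apply_snd (x := 0) (y := 0) T.analytic_Q.differentiableAt) ?_
      rwa [slope (analyticAt_slice hBa) hQv]
  · intro h
    refine hD0 ?_
    have := fderiv_apply_snd (x := 0) (y := 0) T.analytic_δ.differentiableAt
    rw [slope (analyticAt_slice hD) hδv] at this
    rw [← this, show ((0 : ℝ), (0 : ℝ)) = 0 from rfl, h]
    simp
  · have aτ : AnalyticAt ℝ (fun q : ℝ × ℝ => (q.1, q.2 - ψ q.1)) 0 :=
      analyticAt_fst.prod (analyticAt_snd.sub hψ1)
    have hτ : Tendsto (fun q : ℝ × ℝ => (q.1, q.2 - ψ q.1)) (𝓝 0) (𝓝 0) := by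
      have := aτ.continuousAt.tendsto
      rwa [show ((0 : ℝ × ℝ).1, (0 : ℝ × ℝ).2 - ψ (0 : ℝ × ℝ).1) = 0 by simp [hψ0]] at this
    have aD : AnalyticAt ℝ (fun q : ℝ × ℝ => D (q.1, q.2 - ψ q.1)) 0 :=
      hD.comp_of_eq aτ (by simp [hψ0])
    have hfst : Tendsto (fun q : ℝ × ℝ => q.1) (𝓝 0) (𝓝 0) :=
      continuous_fst.tendsto' _ _ rfl
    have hδe : ∀ᶠ q in 𝓝 (0 : ℝ × ℝ), T.δ q = (q.2 - ψ q.1) * D (q.1, q.2 - ψ q.1) := by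
      filter_upwards [hτ.eventually hDe] with q hq
      simpa using hq
    filter_upwards [hδe.eventually_nhds, aD.eventually_analyticAt,
      aD.continuousAt.eventually_ne (y := 0) (by simpa [hψ0] using hD0),
      hfst.eventually hψ.eventually_analyticAt, hfst.eventually hTQ] with q h1 h2 h3 h4 h5 h6
    have h7 : q.2 = ψ q.1 := by
      rw [h1.self_of_nhds] at h6
      exact sub_eq_zero.1 ((mul_eq_zero.1 h6).resolve_right h3)
    have hl : HasFDerivAt (fun q : ℝ × ℝ => q.2 - ψ q.1) (ContinuousLinearMap.snd ℝ ℝ ℝ -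
        deriv ψ q.1 • ContinuousLinearMap.fst ℝ ℝ ℝ) q :=
      hasFDerivAt_snd.sub (h4.differentiableAt.hasDerivAt.comp_hasFDerivAt q hasFDerivAt_fst)
    have h8 : T.δ =ᶠ[𝓝 q] fun q => (q.2 - ψ q.1) * D (q.1, q.2 - ψ q.1) := h1
    rw [h8.fderiv_eq, (hl.fun_mul h2.differentiableAt.hasFDerivAt).fderiv]
    have h9 : T.Q q = deriv ψ q.1 * T.P q := by
      rw [← h7] at h5; exact h5
    simp [h7, X, h9]

end ConstrainedGerm

namespace ConstrainedGerm

variable {S S' T : ConstrainedGerm} {ω₁ ω₂ : ℕ} {m : ℤ} {σ : ℤˣ} {ξ : ℝ} {p : ℤ × ℤ} {h : ℕ}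

/-! ### One blow-up -/

theorem MainPoint.above_of_weight (hp : S.MainPoint p)
    (hw : S.IsMainWeight ω₁ ω₂ ∨ (S.MainSegmentHorizontal ∧ 0 < ω₁ ∧ 0 < ω₂)) :
    0 < ω₁ ∧ 0 < ω₂ ∧ S.Above ω₁ ω₂ (ω₁ * p.1 + ω₂ * p.2) := by
  rcases hw with hw | ⟨hw, h₁, h₂⟩
  · obtain ⟨h₁, h₂, -, hab, -⟩ := hp.isMainWeight_iff.1 hw
    exact ⟨h₁, h₂, hab⟩
  · refine ⟨h₁, h₂, fun p' hp' => ?_⟩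
    have h1 := hp.horizontal_iff.1 hw p' hp'
    have h2 := (hp.2 p' hp').1
    gcongr

/-- A germ is resolved if, after one blow-up, all points of the `x` charts can be resolved. -/
theorem resolvable_of_blowUp (hch : AdmissibleChange S S') (hS' : S'.Tame) (hp : S'.MainPoint p)
    (hr : p.1 = 0 ∨ p.1 = -1) (hh : 0 ≤ p.2)
    (hw : S'.IsMainWeight ω₁ ω₂ ∨ (S'.MainSegmentHorizontal ∧ 0 < ω₁ ∧ 0 < ω₂))
    (hres : ∀ σ ξ T, S'.IsXTransform ω₁ ω₂ σ ξ T → ∃ n, T.ResolvedBy n) :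
    ∃ n, S.ResolvedBy n := by
  classical
  obtain ⟨h₁, h₂, hm⟩ := hp.above_of_weight hw
  choose T hT using fun q => exists_isStrictTransform hS'.nonTrivial h₁ h₂ q
  let Z : Set DivisorPoint := {q | S'.OnDivisor q ∧ ¬ (T q).IsElementary}
  have hZ : Z.Finite := by
    -- A point of positive height is a common root of A and B, which are not both zero.
    let R : ℤˣ → Set ℝ := fun σ => {ξ | (S'.polyA ω₁ ω₂ (ω₁ * p.1 + ω₂ * p.2) σ).IsRoot ξ ∧
      (S'.polyB ω₁ ω₂ (ω₁ * p.1 + ω₂ * p.2) σ).IsRoot ξ}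
    have hR : ∀ σ, (R σ).Finite := by
      intro σ
      rcases not_and_or.1 (not_polyA_polyB_eq_zero h₁ h₂ hp.1 rfl (σ := σ)) with hne | hne
      · exact (Polynomial.finite_setOfPred_isRoot hne).subset fun ξ hξ => hξ.1
      · exact (Polynomial.finite_setOfPred_isRoot hne).subset fun ξ hξ => hξ.2
    refine (Set.finite_iUnion fun σ => (hR σ).image (DivisorPoint.x σ)).subset ?_
    rintro (⟨σ, ξ⟩ | σ) ⟨hq, hne⟩
    · obtain ⟨s, -, hel, hdvd⟩ := IsXTransform.exists_height (hT (.x σ ξ)) h₁ h₂ hm hp.1 rfl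
      have hs : ((1 : ℕ) : ℤ) ≤ s := by
        by_contra hcon
        exact hne (hel (by push_cast at hcon; omega))
      obtain ⟨hA, hB⟩ := (hdvd 1).1 hs
      refine Set.mem_iUnion.2 ⟨σ, ξ, ⟨?_, ?_⟩, rfl⟩
      · exact Polynomial.dvd_iff_isRoot.1 (by simpa using hA)
      · exact Polynomial.dvd_iff_isRoot.1 ((dvd_pow_self _ (by norm_num)).trans hB)
    · exact absurd (isElementary_of_y_transform (hT (.y σ)) h₁ h₂ hp.1 hr hm rfl) hne
  have hc : ∀ q, ∃ n, q ∈ hZ.toFinset → (T q).ResolvedBy n := by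
    intro q
    by_cases hq : q ∈ hZ.toFinset
    · cases q with
      | x σ ξ => exact (hres σ ξ _ (hT (.x σ ξ))).imp fun n hn _ => hn
      | y σ =>
        refine absurd (isElementary_of_y_transform (hT (.y σ)) h₁ h₂ hp.1 hr hm rfl) ?_
        exact (hZ.mem_toFinset.1 hq).2
    · exact ⟨0, fun h => absurd h hq⟩
  choose c hc using hc
  refine ⟨_, ResolvedBy.blowUp S S' ω₁ ω₂ T hZ.toFinset c hch
    (controllable_iff.2 ⟨p, hp, hr, hh⟩) hw (fun q _ => hT q) (fun q hq hqZ => ?_)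
    (fun q hq => (hZ.mem_toFinset.1 hq).1) hc⟩
  by_contra hne
  exact hqZ (hZ.mem_toFinset.2 ⟨hq, hne⟩)

/-- Tame germs with controllable polygon of the given height can be resolved. -/
def ResolvesHeight (h : ℕ) : Prop :=
  ∀ S : ConstrainedGerm, S.Tame → ∀ p, S.MainPoint p → (p.1 = 0 ∨ p.1 = -1) → p.2 = h →
    ∃ n, S.ResolvedBy n

/-- In an induction on the height, only the points where the height stalls matter. -/
theorem resolvable_of_stalls (IH : ∀ h' < h, ResolvesHeight h') (hch : AdmissibleChange S S')
    (hS' : S'.Tame) (hp : S'.MainPoint p) (hr : p.1 = 0 ∨ p.1 = -1) (hh : p.2 = h)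
    (hw : S'.IsMainWeight ω₁ ω₂ ∨ (S'.MainSegmentHorizontal ∧ 0 < ω₁ ∧ 0 < ω₂))
    (hres : ∀ σ ξ T, S'.IsXTransform ω₁ ω₂ σ ξ T → 0 < h →
      S'.Stalls ω₁ ω₂ (ω₁ * p.1 + ω₂ * p.2) σ ξ h → T.MainPoint (0, (h : ℤ)) →
      ∃ n, T.ResolvedBy n) : ∃ n, S.ResolvedBy n := by
  obtain ⟨h₁, h₂, hm⟩ := hp.above_of_weight hw
  refine resolvable_of_blowUp hch hS' hp hr (by omega) hw fun σ ξ T hT => ?_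
  obtain ⟨s, hs, hel, hdvd⟩ := IsXTransform.exists_height hT h₁ h₂ hm hp.1 rfl
  by_cases hs0 : s ≤ 0
  · exact ⟨0, .elementary T (hel hs0)⟩
  have hle : s ≤ h := by
    by_contra hcon
    exact hp.not_dvd_succ h₁ h₂ rfl hh ((hdvd (h + 1)).1 (by push_cast; omega))
  lift s to ℕ using by omega
  rcases hle.lt_or_eq with hlt | heq
  · exact IH s (by exact_mod_cast hlt) T (hT.tame h₁ h₂ hS') _ hs (Or.inl rfl) rfl
  · obtain ⟨hA, hB⟩ := (hdvd h).1 heq.ge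
    exact hres σ ξ T hT (by omega) (hp.stalls_of_dvd h₁ h₂ rfl hh hA hB) (heq ▸ hs)

/-- Stalling away from the chart origin would give a support point one unit below the main vertex.
-/
theorem MainPoint.stalls_horizontal (hp : S.MainPoint p) (hh : p.2 = h) (hpos : 0 < h)
    (hhor : S.MainSegmentHorizontal) (hst : S.Stalls ω₁ ω₂ m σ ξ h) : ξ = 0 := by
  by_contra hξ
  obtain ⟨p', hp', e, -⟩ := hst.exists_lower hξ hpos
  have := hp.horizontal_iff.1 hhor p' hp'
  omega

/-- Tameness makes the axis {y = 0} an invariant curve in the impasse set and the height one; the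
stalling points lie on its transform, hence are elementary. Any weights would do, and (1, 1) is
used. -/
theorem resolvable_of_horizontal (IH : ∀ h' < h, ResolvesHeight h') (hch : AdmissibleChange S S')
    (hS' : S'.Tame) (hp : S'.MainPoint p) (hr : p.1 = 0 ∨ p.1 = -1) (hh : p.2 = h)
    (hhor : S'.MainSegmentHorizontal) : ∃ n, S.ResolvedBy n := by
  have hw : S'.IsMainWeight 1 1 ∨ (S'.MainSegmentHorizontal ∧ 0 < 1 ∧ 0 < 1) :=
    Or.inr ⟨hhor, one_pos, one_pos⟩
  refine resolvable_of_stalls IH hch hS' hp hr hh hw fun σ ξ T hT hpos hst _ => ?_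
  obtain rfl := hp.stalls_horizontal hh hpos hhor hst
  obtain ⟨rfl, hδ, hQ⟩ := hS'.of_horizontal hp hr hh hpos hhor
  obtain ⟨h₁, h₂, hm⟩ := hp.above_of_weight hw
  refine ⟨0, .elementary T (hT.isElementary_of_curve (φ := fun _ => 0) (ψ := fun _ => 0) h₁ h₂ hm
    hp.1 rfl hst analyticAt_const hδ ?_ analyticAt_const rfl (Eventually.of_forall fun u => by simp))⟩
  filter_upwards [hQ] with x hx
  simpa using hx

theorem MainPoint.stalls_ne_zero (hp : S.MainPoint p) (hh : p.2 = h)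
    (hw : S.IsMainWeight ω₁ ω₂) (hst : S.Stalls ω₁ ω₂ (ω₁ * p.1 + ω₂ * p.2) σ ξ h) : ξ ≠ 0 := by
  rintro rfl
  obtain ⟨h₁, h₂, -, -, p', hp', hne, e⟩ := hp.isMainWeight_iff.1 hw
  exact hne (hst.line_subsingleton h₁ h₂ rfl hh hp' e)

/-! ### Admissible changes -/

theorem AdmissibleChange.monomialShear (hch : AdmissibleChange S S') {α : ℝ} {β : ℕ} (hβ : 0 < β)
    (hy : ¬ S'.divY) : AdmissibleChange S (S'.monomialShear α β hβ hy) := by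
  induction hch with
  | refl S => exact .step _ _ α β hβ hy (.refl _)
  | step S T α' β' hβ' hy' _ ih => exact .step _ _ α' β' hβ' hy' (ih hy)

theorem eq_of_components {S T : ConstrainedGerm} (hδ : S.δ = T.δ) (hP : S.P = T.P)
    (hQ : S.Q = T.Q) (hx : S.divX = T.divX) (hy : S.divY = T.divY) : S = T := by
  cases S; cases T
  simp only at hδ hP hQ hx hy
  subst hδ hP hQ hx hy
  rfl

variable {α : ℕ → ℝ} {β : ℕ → ℕ}

/-- Monomial shears compose additively, so n of them amount to one shear by a partial sum; this lets
the estimates compare every stage with the original system. -/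
theorem eq_shear_partialSum {T : ℕ → ConstrainedGerm} (h0 : T 0 = S) (hy : ¬ S.divY)
    (hβ : ∀ n, 0 < β n) (h : ∀ n, ∃ (hβ : 0 < β n) (hn : ¬ (T n).divY),
      T (n + 1) = (T n).monomialShear (α n) (β n) hβ hn) (n : ℕ) :
    T n = S.shear (partialSum α β n) (analyticAt_partialSum n) (partialSum_zero_right hβ n) hy := by
  induction n with
  | zero =>
    rw [h0]
    have e : partialSum α β 0 = fun _ => 0 := by funext x; simp [partialSum]
    refine eq_of_components ?_ ?_ ?_ rfl rfl <;> funext q <;> simp [shear, e]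
  | succ n ih =>
    obtain ⟨hβn, hn, e⟩ := h n
    have e1 : ∀ x, partialSum α β (n + 1) x = partialSum α β n x + α n * x ^ β n := fun x => by
      simp [partialSum, Finset.sum_range_succ]
    have e2 : ∀ q : ℝ × ℝ, q.2 + α n * q.1 ^ β n + partialSum α β n q.1 =
      q.2 + partialSum α β (n + 1) q.1 := fun q => by rw [e1]; ring
    have hd : Differentiable ℝ (partialSum α β n) := by unfold partialSum; fun_prop
    have hd' : Differentiable ℝ fun x : ℝ => α n * x ^ β n := by fun_prop
    have e3 : ∀ x, deriv (partialSum α β (n + 1)) x =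
        deriv (partialSum α β n) x + deriv (fun x : ℝ => α n * x ^ β n) x := fun x => by
      rw [show partialSum α β (n + 1) = fun x => partialSum α β n x + α n * x ^ β n from funext e1]
      exact deriv_fun_add (hd x) (hd' x)
    rw [e]
    have c1 : ∀ (U V : ConstrainedGerm) (hU : ¬ U.divY) (hV : ¬ V.divY), U = V →
        U.monomialShear (α n) (β n) hβn hU = V.monomialShear (α n) (β n) hβn hV := by
      rintro U _ hU hV rfl; rfl
    rw [c1 _ (S.shear _ _ _ hy) hn hy ih]
    refine eq_of_components ?_ ?_ ?_ rfl rfl <;> funext q <;>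
      simp only [monomialShear, shear, e2, e3]
    ring

/-! ### The induction -/

/-- If the germ cannot be resolved, there is a shear that makes the polygon steeper. -/
theorem exists_monomialShear_of_not_resolvable (IH : ∀ h' < h, ResolvesHeight h')
    (hch : AdmissibleChange S S') (hS' : S'.Tame) (hp : S'.MainPoint p)
    (hr : p.1 = 0 ∨ p.1 = -1) (hh : p.2 = h) (hy : ¬ S'.divY) (hno : ¬ ∃ n, S.ResolvedBy n) :
    ∃ (α : ℝ) (β : ℕ) (hβ : 0 < β), 0 < h ∧ S'.IsMainWeight 1 β ∧
      (S'.monomialShear α β hβ hy).MainPoint p ∧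
      ∀ p' ∈ (S'.monomialShear α β hβ hy).support, p' ≠ p →
        ((1 : ℕ) : ℤ) * p.1 + β * p.2 < ((1 : ℕ) : ℤ) * p'.1 + β * p'.2 := by
  by_contra hcon
  refine hno ?_
  by_cases hhor : S'.MainSegmentHorizontal
  · exact resolvable_of_horizontal IH hch hS' hp hr hh hhor
  obtain ⟨ω₁, ω₂, hw⟩ := hp.exists_isMainWeight hhor
  refine resolvable_of_stalls IH hch hS' hp hr hh (Or.inl hw) fun σ ξ T hT hpos hst _ => ?_
  refine absurd ?_ hcon
  have hξ := hp.stalls_ne_zero hh hw hst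
  obtain ⟨-, h₂, hco, hab, -⟩ := hp.isMainWeight_iff.1 hw
  obtain rfl := hst.weight_eq_one hξ hpos rfl hh hco
  -- In the chart x = σu, y = u^ω₂ v, the curve y = αx^ω₂ is v = ασ^ω₂; it passes through ξ exactly
  -- for this α, as σ² = 1.
  refine ⟨ξ * ((σ : ℤ) : ℝ) ^ ω₂, ω₂, h₂, hpos, hw, ?_⟩
  refine shear_of_stalls (ψ := fun _ => 0) h₂ hp hr hab rfl hh hst _ _ hy analyticAt_const rfl
    (Eventually.of_forall fun u => ?_)
  have : (((σ : ℤ) : ℝ) ^ ω₂) * (((σ : ℤ) : ℝ) ^ ω₂) = 1 := by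
    rw [← mul_pow, unit_mul_self, one_pow]
  rw [mul_pow]
  linear_combination ξ * u ^ ω₂ * this

/-- The stalled points of the first blow-up lie on the invariant curve. -/
theorem isElementary_of_curve_of_stalls {φ : ℝ → ℝ} {α : ℝ} {β : ℕ} (hS : S.Tame)
    (hp : S.MainPoint p) (hw : S.IsMainWeight 1 β) (hφ : AnalyticAt ℝ φ 0)
    (hδ : ∀ᶠ x in 𝓝 (0 : ℝ), S.δ (x, φ x) = 0)
    (hQ : ∀ᶠ x in 𝓝 (0 : ℝ), S.Q (x, φ x) = deriv φ x * S.P (x, φ x))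
    (hφα : VanishesTo (β + 1) fun x => φ x - α * x ^ β)
    (hT : S.IsXTransform 1 β σ ξ T) (hst : S.Stalls 1 β (((1 : ℕ) : ℤ) * p.1 + β * p.2) σ ξ 1) :
    T.IsElementary := by
  obtain ⟨h₁, h₂, hm⟩ := hp.above_of_weight (Or.inl hw)
  obtain ⟨k, hk, hke⟩ := hφα
  set s : ℝ := ((σ : ℤ) : ℝ) with hs
  have hlim : Tendsto (fun u : ℝ => s * u) (𝓝 0) (𝓝 0) :=
    Continuous.tendsto' (by fun_prop) _ _ (by simp)
  have hks : AnalyticAt ℝ (fun u => k (s * u)) 0 :=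
    AnalyticAt.fun_comp_of_eq (g := k) (f := fun u => s * u) hk (by fun_prop) (by simp)
  let ψ : ℝ → ℝ := fun u => s ^ (β + 1) * u * k (s * u)
  have hψ : AnalyticAt ℝ ψ 0 := AnalyticAt.fun_mul (by fun_prop) hks
  have hψ0 : ψ 0 = 0 := by simp [ψ]
  have hφψ : ∀ᶠ u in 𝓝 (0 : ℝ), φ (s * u ^ 1) = u ^ β * (α * s ^ β + ψ u) := by
    filter_upwards [hlim.eventually hke] with u hu
    rw [pow_one, sub_eq_iff_eq_add.1 hu]
    simp only [ψ]
    ring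
  obtain ⟨U, hU⟩ := exists_isXTransform hS.nonTrivial h₁ h₂ σ (α * s ^ β)
  have hUδ := (hU.invariant_curve h₁ hφ hδ hQ hψ hψ0 hφψ).1.self_of_nhds
  rw [hψ0] at hUδ
  obtain ⟨P, -, -, hA, hB⟩ := hU.exists_log_initial h₁ h₂ hm hp.1 rfl
  have hA := hA.self_of_nhds
  have hB := hB.self_of_nhds
  obtain ⟨a, b, hab, eA, eB⟩ := id hst
  -- The curve meets the divisor at ασ^β, where the transformed δ vanishes, so A and B vanish there.
  -- Stalling leaves ξ as their only common zero.
  have hξ : α * s ^ β = ξ := by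
    rw [hUδ, eA] at hA
    rw [hUδ, eB] at hB
    simp at hA hB
    by_contra hne
    exact hab ⟨hA.resolve_right (sub_ne_zero.2 hne), hB.resolve_right (sub_ne_zero.2 hne)⟩
  rw [hξ] at hφψ
  exact hT.isElementary_of_curve h₁ h₂ hm hp.1 rfl hst hφ hδ hQ hψ hψ0 hφψ

/-- If no resolution existed, every admissible coordinate system keeping the main vertex would call
for a further shear. The resulting infinite sequence produces an invariant curve, and with it one
blow-up in the original coordinates makes every stalling point elementary: a contradiction. -/
theorem resolvable_of_not_divY (IH : ∀ h' < h, ResolvesHeight h') (hS : S.Tame)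
    (hp : S.MainPoint p) (hr : p.1 = 0 ∨ p.1 = -1) (hh : p.2 = h) (hy : ¬ S.divY) :
    ∃ n, S.ResolvedBy n := by
  by_contra hno
  let Good := {S' : ConstrainedGerm // AdmissibleChange S S' ∧ S'.Tame ∧ S'.MainPoint p ∧ ¬ S'.divY}
  have step : ∀ S' : Good, ∃ (S'' : Good) (α : ℝ) (β : ℕ) (hβ : 0 < β), 0 < h ∧
      S'.1.IsMainWeight 1 β ∧ S''.1 = S'.1.monomialShear α β hβ S'.2.2.2.2 ∧
      ∀ p' ∈ S''.1.support, p' ≠ p →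
        ((1 : ℕ) : ℤ) * p.1 + β * p.2 < ((1 : ℕ) : ℤ) * p'.1 + β * p'.2 := by
    rintro ⟨S', hch, hS', hp', hy'⟩
    obtain ⟨α, β, hβ, hpos, hw, hp'', hlt⟩ :=
      exists_monomialShear_of_not_resolvable IH hch hS' hp' hr hh hy' hno
    exact ⟨⟨_, hch.monomialShear hβ hy', hS'.shear _ _ _, hp'', hy'⟩, α, β, hβ, hpos, hw, rfl, hlt⟩
  choose next α β hβ hpos hw hnext hlt using step
  let G : ℕ → Good := fun n => next^[n] ⟨S, .refl S, hS, hp, hy⟩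
  have hG : ∀ n, G (n + 1) = next (G n) := fun n => Function.iterate_succ_apply' next n _
  have hmono : StrictMono fun n => β (G n) := strictMono_nat_of_lt_succ fun n => by
    refine MainPoint.weight_lt (G (n + 1)).2.2.2.1 ?_ (hw (G (n + 1)))
    have := hlt (G n)
    rwa [← hG] at this
  have hshear := eq_shear_partialSum (T := fun n => (G n).1) (S := S) (α := fun n => α (G n))
    (β := fun n => β (G n)) rfl hy (fun n => hβ (G n)) fun n => ⟨hβ (G n), (G n).2.2.2.2, by
      rw [← hnext, hG]⟩
  obtain ⟨rfl, φ, hφ, -, hδ, hQ, -, hφα⟩ := hS.exists_invariant_curve (p := p) (h := h)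
    (α := fun n => α (G n)) (β := fun n => β (G n)) hy (fun n => hβ (G n)) hmono hr hh
    (hpos (G 0)) fun n p' hp' => by
      rw [← hshear n] at hp'
      have := (MainPoint.isMainWeight_iff (G n).2.2.2.1).1 (hw (G n))
      simpa using this.2.2.2.1 p' hp'
  refine hno (resolvable_of_stalls IH (.refl S) hS hp hr hh (Or.inl (hw (G 0)))
    fun σ ξ T hT _ hst _ => ⟨0, .elementary T ?_⟩)
  exact isElementary_of_curve_of_stalls hS hp (hw (G 0)) hφ hδ hQ hφα hT hst

/-- When {y = 0} belongs to the boundary, blow up without any change. A stalling point has ξ ≠ 0, so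
its strict transform has no boundary component {y = 0}, and the unrestricted case applies at the
same height under the same induction hypothesis. -/
theorem resolvesHeight (h : ℕ) : ResolvesHeight h := by
  induction h using Nat.strong_induction_on with
  | _ h IH =>
    intro S hS p hp hr hh
    by_cases hy : S.divY
    · by_cases hhor : S.MainSegmentHorizontal
      · exact resolvable_of_horizontal IH (.refl S) hS hp hr hh hhor
      obtain ⟨ω₁, ω₂, hw⟩ := hp.exists_isMainWeight hhor
      obtain ⟨h₁, h₂, -⟩ := hp.above_of_weight (Or.inl hw)
      refine resolvable_of_stalls IH (.refl S) hS hp hr hh (Or.inl hw)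
        fun σ ξ T hT _ hst hTp => ?_
      refine resolvable_of_not_divY IH (hT.tame h₁ h₂ hS) hTp (Or.inl rfl) rfl fun hTy => ?_
      exact hp.stalls_ne_zero hh hw hst (hT.divY.1 hTy).2
    · exact resolvable_of_not_divY IH hS hp hr hh hy

theorem Tame.resolvable (hS : S.Tame) (hc : S.Controllable) : ∃ n, S.ResolvedBy n := by
  obtain ⟨p, hp, hr, h0⟩ := controllable_iff.1 hc
  exact resolvesHeight p.2.toNat S hS p hp hr (Int.toNat_of_nonneg h0).symm

/-! ### Convergence -/

theorem HeightStalls.stalls {α : ℝ} {β : ℕ} (hst : S.HeightStalls α β) (hp : S.MainPoint p)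
    (hh : p.2 = h) : 0 < h ∧ S.Stalls 1 β (((1 : ℕ) : ℤ) * p.1 + β * p.2) 1 α h := by
  obtain ⟨hw, T, v, w, hT, hv, hw', hpos, e⟩ := hst
  obtain ⟨h₁, h₂, hm⟩ := hp.above_of_weight (Or.inl hw)
  obtain rfl := hp.eq_of_isMainVertex hv
  obtain ⟨s, hs, -, hdvd⟩ := IsXTransform.exists_height hT h₁ h₂ hm hp.1 rfl
  obtain rfl := hs.eq_of_isMainVertex hw'
  dsimp only at e hpos
  have hsp : s = p.2 := by exact_mod_cast e
  have hp0 : 0 < p.2 := by exact_mod_cast hpos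
  obtain ⟨hA, hB⟩ := (hdvd h).1 (by omega)
  exact ⟨by omega, hp.stalls_of_dvd h₁ h₂ rfl hh hA hB⟩

/-- On the axis δP vanishes once and δQ, a product of two vanishing factors, twice; in logarithmic
notation both leave only points of height at least one. -/
theorem mainSegmentHorizontal_of_axis (hp : S.MainPoint p) (hh : p.2 = 1)
    (hδ : ∀ᶠ x in 𝓝 (0 : ℝ), S.δ (x, 0) = 0) (hQ : ∀ᶠ x in 𝓝 (0 : ℝ), S.Q (x, 0) = 0) :
    S.MainSegmentHorizontal := by
  have hzero : ∀ {f : ℝ × ℝ → ℝ} {k l : ℕ},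
      (∀ᶠ x in 𝓝 (0 : ℝ), iteratedDeriv l (fun y => f (x, y)) 0 = 0) → taylorCoeff f k l = 0 := by
    intro f k l h
    have h1 : (fun x => iteratedDeriv l (fun y => f (x, y)) 0) =ᶠ[𝓝 0] fun _ => 0 := h
    rw [taylorCoeff, h1.iteratedDeriv_eq]
    simp
  rw [hp.horizontal_iff, hh]
  rintro p' ⟨k, l, ⟨rfl, hc⟩ | ⟨rfl, hc⟩⟩
  · rcases Nat.eq_zero_or_pos l with rfl | hl
    · refine absurd (hzero ?_) hc
      filter_upwards [hδ] with x hx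
      simp [hx]
    · dsimp only; omega
  · rcases Nat.lt_or_ge l 2 with hl | hl
    · refine absurd (hzero ?_) hc
      filter_upwards [hδ, hQ, eventually_slice_fst S.analytic_δ.eventually_analyticAt,
        eventually_slice_fst S.analytic_Q.eventually_analyticAt] with x hx hx' hδx hQx
      interval_cases l
      · simp [hx]
      · rw [iteratedDeriv_one]
        have := (analyticAt_slice hδx).differentiableAt.hasDerivAt.fun_mul
          (analyticAt_slice hQx).differentiableAt.hasDerivAt
        rw [this.deriv, hx, hx']
        simp
    · dsimp only; omega

theorem Tame.convergence (hS : S.Tame) (hc : S.Controllable) (hy : ¬ S.divY)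
    {T : ℕ → ConstrainedGerm} {α : ℕ → ℝ} {β : ℕ → ℕ} (h0 : T 0 = S)
    (hT : ∀ n, (T n).HeightStalls (α n) (β n) ∧
      ∃ (hβ : 0 < β n) (hn : ¬ (T n).divY), T (n + 1) = (T n).monomialShear (α n) (β n) hβ hn) :
    ∃ (φ : ℝ → ℝ) (hφ : AnalyticAt ℝ φ 0) (h0 : φ 0 = 0),
      (∀ᶠ x in 𝓝 (0 : ℝ), HasSum (fun n => α n * x ^ β n) (φ x)) ∧
      (S.shear φ hφ h0 hy).Controllable ∧ (S.shear φ hφ h0 hy).MainSegmentHorizontal := by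
  obtain ⟨p, hp, hr, hp0⟩ := controllable_iff.1 hc
  obtain ⟨h, hh⟩ := Int.eq_ofNat_of_zero_le hp0
  have hβ : ∀ n, 0 < β n := fun n => (hT n).2.choose
  have step : ∀ n, (T n).MainPoint p → (T (n + 1)).MainPoint p ∧ ∀ p' ∈ (T (n + 1)).support,
      p' ≠ p → ((1 : ℕ) : ℤ) * p.1 + β n * p.2 < ((1 : ℕ) : ℤ) * p'.1 + β n * p'.2 := by
    intro n hpn
    obtain ⟨hst, hβn, hyn, e⟩ := hT n
    rw [e]
    obtain ⟨-, -, hm⟩ := hpn.above_of_weight (Or.inl hst.1)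
    exact shear_of_stalls (ψ := fun _ => 0) hβn hpn hr hm rfl hh (hst.stalls hpn hh).2 _ _ hyn
      analyticAt_const rfl (Eventually.of_forall fun u => by simp [mul_comm])
  have hpn : ∀ n, (T n).MainPoint p := by
    intro n
    induction n with
    | zero => rwa [h0]
    | succ n ih => exact (step n ih).1
  have hmono : StrictMono β := strictMono_nat_of_lt_succ fun n =>
    (hpn (n + 1)).weight_lt (step n (hpn n)).2 (hT (n + 1)).1.1
  have hshear := eq_shear_partialSum h0 hy hβ fun n => (hT n).2
  obtain ⟨hpos, hst⟩ := (hT 0).1.stalls (hpn 0) hh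
  obtain ⟨rfl, φ, hφ, hφ0, hδ, hQ, hsum, hφα⟩ := hS.exists_invariant_curve hy hβ hmono hr hh
    hpos fun n p' hp' => by
      rw [← hshear n] at hp'
      have := (hpn n).isMainWeight_iff.1 (hT n).1.1
      simpa using this.2.2.2.1 p' hp'
  obtain ⟨k, hk, hke⟩ := hφα
  rw [h0] at hst
  obtain ⟨-, h₂, hm⟩ := hp.above_of_weight (Or.inl (h0 ▸ (hT 0).1.1))
  -- The full shear by φ agrees with the first monomial shear to leading order, so the first stall
  -- alone shows that it keeps the main vertex.
  have hp' := (shear_of_stalls (ψ := fun u => u * k u) (hβ 0) hp hr hm rfl hh hst hφ hφ0 hy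
    (by fun_prop) (by simp) (by
      filter_upwards [hke] with u hu
      simp only [Units.val_one, Int.cast_one, one_mul]
      rw [sub_eq_iff_eq_add.1 hu]
      ring)).1
  refine ⟨φ, hφ, hφ0, hsum, controllable_iff.2 ⟨p, hp', hr, hp0⟩,
    mainSegmentHorizontal_of_axis hp' (by simpa using hh) ?_ ?_⟩
  · filter_upwards [hδ] with x hx
    simpa [ConstrainedGerm.shear] using hx
  · filter_upwards [hQ] with x hx
    simp [ConstrainedGerm.shear, hx]

end ConstrainedGerm

/-! ### Weighted absolutely summable sequences -/

/-- The sequence is absolutely summable with weights `r ^ l`. -/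
def WeightedSummable (r : ℝ) (a : ℕ → ℝ) : Prop := Summable fun l => |a l| * r ^ l

/-- The weighted `ℓ¹` norm. -/
def weightedNorm (r : ℝ) (a : ℕ → ℝ) : ℝ := ∑' l, |a l| * r ^ l

/-- The value of the power series with coefficients `a`. -/
def powerSum (a : ℕ → ℝ) (y : ℝ) : ℝ := ∑' l, a l * y ^ l

/-- The Cauchy product of two sequences. -/
def cauchyProd (a b : ℕ → ℝ) (l : ℕ) : ℝ :=
  ∑ k ∈ Finset.HasAntidiagonal.antidiagonal l, a k.1 * b k.2

namespace WeightedSummable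

variable {r : ℝ} {a b : ℕ → ℝ}

theorem summable_norm (ha : WeightedSummable r a) {y : ℝ} (hy : |y| ≤ r) :
    Summable fun l => ‖a l * y ^ l‖ :=
  Summable.of_nonneg_of_le (fun _ => norm_nonneg _) (fun l => by
    rw [Real.norm_eq_abs, abs_mul, abs_pow]; gcongr) ha

theorem hasSum (ha : WeightedSummable r a) {y : ℝ} (hy : |y| ≤ r) :
    HasSum (fun l => a l * y ^ l) (powerSum a y) :=
  (ha.summable_norm hy).of_norm.hasSum

theorem abs_mul_pow_le (ha : WeightedSummable r a) (hr : 0 ≤ r) (l : ℕ) :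
    |a l| * r ^ l ≤ weightedNorm r a :=
  ha.le_tsum l fun _ _ => by positivity

theorem cauchyProd_hasSum {F G : ℕ → ℝ} {s t : ℝ} (hF : HasSum F s) (hG : HasSum G t) :
    HasSum (cauchyProd F G) (s * t) :=
  (hF.mul hG (summable_mul_of_summable_norm (summable_norm_iff.2 hF.summable)
    (summable_norm_iff.2 hG.summable))).antidiagonal_sum

theorem cauchyProd_mul_pow (a b : ℕ → ℝ) (y : ℝ) (l : ℕ) :
    cauchyProd (fun l => a l * y ^ l) (fun l => b l * y ^ l) l = cauchyProd a b l * y ^ l := by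
  simp only [cauchyProd]
  rw [Finset.sum_mul]
  refine Finset.sum_congr rfl fun k hk => ?_
  rw [← Finset.HasAntidiagonal.mem_antidiagonal.1 hk, pow_add]
  ring

theorem cauchyProd (ha : WeightedSummable r a) (hb : WeightedSummable r b) (hr : 0 ≤ r) :
    WeightedSummable r (cauchyProd a b) ∧
      weightedNorm r (_root_.cauchyProd a b) ≤ weightedNorm r a * weightedNorm r b := by
  have h1 := cauchyProd_hasSum (Summable.hasSum ha) (Summable.hasSum hb)
  have h2 : ∀ l, |_root_.cauchyProd a b l| * r ^ l ≤
      _root_.cauchyProd (fun l => |a l| * r ^ l) (fun l => |b l| * r ^ l) l := by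
    intro l
    rw [cauchyProd_mul_pow (fun l => |a l|) (fun l => |b l|)]
    gcongr
    refine (Finset.abs_sum_le_sum_abs _ _).trans_eq ?_
    simp [_root_.cauchyProd, abs_mul]
  have h3 : WeightedSummable r (_root_.cauchyProd a b) :=
    Summable.of_nonneg_of_le (fun l => by positivity) h2 h1.summable
  exact ⟨h3, (Summable.tsum_le_tsum h2 h3 h1.summable).trans_eq h1.tsum_eq⟩

theorem powerSum_cauchyProd (ha : WeightedSummable r a) (hb : WeightedSummable r b)
    {y : ℝ} (hy : |y| ≤ r) : powerSum (_root_.cauchyProd a b) y = powerSum a y * powerSum b y := by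
  have h1 := cauchyProd_hasSum (ha.hasSum hy) (hb.hasSum hy)
  rw [funext (cauchyProd_mul_pow a b y)] at h1
  exact h1.tsum_eq

theorem sum {ι : Type*} {s : Finset ι} {a : ι → ℕ → ℝ} (h : ∀ i ∈ s, WeightedSummable r (a i))
    (hr : 0 ≤ r) : WeightedSummable r (fun l => ∑ i ∈ s, a i l) ∧
      weightedNorm r (fun l => ∑ i ∈ s, a i l) ≤ ∑ i ∈ s, weightedNorm r (a i) := by
  have h1 : HasSum (fun l => ∑ i ∈ s, |a i l| * r ^ l) (∑ i ∈ s, weightedNorm r (a i)) :=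
    hasSum_sum fun i hi => Summable.hasSum (h i hi)
  have h2 : ∀ l, |∑ i ∈ s, a i l| * r ^ l ≤ ∑ i ∈ s, |a i l| * r ^ l := by
    intro l
    rw [← Finset.sum_mul]
    gcongr
    exact Finset.abs_sum_le_sum_abs _ _
  have h3 : WeightedSummable r (fun l => ∑ i ∈ s, a i l) :=
    Summable.of_nonneg_of_le (fun l => by positivity) h2 h1.summable
  exact ⟨h3, (Summable.tsum_le_tsum h2 h3 h1.summable).trans_eq h1.tsum_eq⟩

theorem shift (ha : WeightedSummable r a) (hr : 0 < r) (d : ℕ) :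
    WeightedSummable r (fun l => a (l + d)) ∧
      weightedNorm r (fun l => a (l + d)) ≤ weightedNorm r a / r ^ d := by
  have hd : 0 < r ^ d := pow_pos hr d
  have h1 : Summable fun l => |a (l + d)| * r ^ (l + d) := (summable_nat_add_iff d).2 ha
  have e : ∀ l, |a (l + d)| * r ^ l = |a (l + d)| * r ^ (l + d) / r ^ d := fun l => by
    rw [pow_add]; field_simp
  refine ⟨(summable_congr e).2 (h1.div_const _), ?_⟩
  rw [weightedNorm, tsum_congr e, tsum_div_const]
  gcongr
  rw [weightedNorm, ← Summable.sum_add_tsum_nat_add d ha]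
  exact le_add_of_nonneg_left (Finset.sum_nonneg fun i _ => by positivity)

theorem powerSum_shift (ha : WeightedSummable r a) {y : ℝ} (hy : |y| ≤ r) (d : ℕ) :
    y ^ d * powerSum (fun l => a (l + d)) y =
      powerSum a y - ∑ l ∈ Finset.range d, a l * y ^ l := by
  rw [powerSum, ← tsum_mul_left, powerSum, ← Summable.sum_add_tsum_nat_add d (ha.hasSum hy).summable,
    add_sub_cancel_left]
  exact tsum_congr fun l => by rw [pow_add]; ring

end WeightedSummable

theorem analyticAt_of_hasSum {g : ℝ → ℝ} {c : ℕ → ℝ}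
    (h : ∀ᶠ y in 𝓝 (0 : ℝ), HasSum (fun l => c l * y ^ l) (g y)) : AnalyticAt ℝ g 0 := by
  have h1 : HasFPowerSeriesAt g (FormalMultilinearSeries.ofScalars ℝ c) 0 := by
    rw [hasFPowerSeriesAt_iff]
    filter_upwards [h] with y hy
    simpa [FormalMultilinearSeries.coeff_ofScalars, mul_comm] using hy
  exact h1.analyticAt

theorem HasDoubleSeries.weightedSummable {f : ℝ × ℝ → ℝ} {a : ℕ × ℕ → ℝ} {r : ℝ}
    (h : HasDoubleSeries f a r) (k : ℕ) : WeightedSummable r (fun l => a (k, l)) ∧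
      weightedNorm r (fun l => a (k, l)) ≤
        (∑' k : ℕ × ℕ, |a k| * r ^ (k.1 + k.2)) * r⁻¹ ^ k := by
  have hr := h.pos
  have h1 := h.summable.prod_factor k
  have e : ∀ l, |a (k, l)| * r ^ l = |a (k, l)| * r ^ (k + l) * r⁻¹ ^ k := fun l => by
    have : r ^ k ≠ 0 := (pow_pos hr k).ne'
    rw [pow_add, inv_pow]; field_simp
  refine ⟨(summable_congr e).2 (h1.mul_right _), ?_⟩
  rw [weightedNorm, tsum_congr e, tsum_mul_right]
  gcongr
  rw [h.summable.tsum_prod]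
  exact h.summable.prod.le_tsum k fun j _ => tsum_nonneg fun l => by positivity

theorem HasDoubleSeries.hasSum_powerSum {f : ℝ × ℝ → ℝ} {a : ℕ × ℕ → ℝ} {r : ℝ}
    (h : HasDoubleSeries f a r) {x y : ℝ} (hx : |x| ≤ r) (hy : |y| ≤ r) :
    HasSum (fun k => x ^ k * powerSum (fun l => a (k, l)) y) (f (x, y)) := by
  refine (h.hasSum x y hx hy).prod_fiberwise fun k => ?_
  have := ((h.weightedSummable k).1.hasSum hy).mul_left (x ^ k)
  exact this.congr_left fun l => by ring

/-! ### Weierstrass preparation -/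

/-- The coefficients (as series in `y`) of the solution `q` of `q + x τ (q g) = 1`, where `τ` is the
quotient of the division by `y ^ d`. -/
def prepSeq (g : ℕ → ℕ → ℝ) (d : ℕ) : ℕ → ℕ → ℝ
  | 0 => fun l => if l = 0 then 1 else 0
  | k + 1 => fun l => -∑ i : Fin (k + 1), cauchyProd (prepSeq g d i) (g (k - i)) (l + d)

/-- The coefficients of the product of the solution with `g`. -/
def prepProd (g : ℕ → ℕ → ℝ) (d k l : ℕ) : ℝ :=
  ∑ i ∈ Finset.range (k + 1), cauchyProd (prepSeq g d i) (g (k - i)) l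

section Prep

variable {g : ℕ → ℕ → ℝ} {d : ℕ} {r c M : ℝ}

theorem prepSeq_zero : prepSeq g d 0 = fun l => if l = 0 then 1 else 0 := by
  rw [prepSeq]

theorem prepSeq_succ (k : ℕ) : prepSeq g d (k + 1) = fun l => -prepProd g d k (l + d) := by
  rw [prepSeq]
  funext l
  rw [prepProd, Finset.sum_range]

/-- The ratio K = M + c/r^d is chosen so that K - M is the factor c/r^d lost on dividing by y^d: the
convolution of the K^i with the M^j, times K - M, telescopes to K^(k+1) - M^(k+1), and the bound
reproduces itself. -/
theorem prepProd_bound (hr : 0 < r) (hc : 0 ≤ c) (hM : 0 ≤ M)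
    (hg : ∀ j, WeightedSummable r (g j) ∧ weightedNorm r (g j) ≤ c * M ^ j) {k : ℕ}
    (hq : ∀ i ≤ k, WeightedSummable r (prepSeq g d i) ∧
      weightedNorm r (prepSeq g d i) ≤ (M + c / r ^ d) ^ i) :
    WeightedSummable r (prepProd g d k) ∧
      weightedNorm r (prepProd g d k) ≤ r ^ d * (M + c / r ^ d) ^ (k + 1) := by
  have hd : 0 < r ^ d := pow_pos hr d
  have h1 : ∀ i ∈ Finset.range (k + 1),
      WeightedSummable r (cauchyProd (prepSeq g d i) (g (k - i))) := fun i hi =>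
    ((hq i (by simpa [Nat.lt_succ_iff] using hi)).1.cauchyProd (hg _).1 hr.le).1
  obtain ⟨h2, h3⟩ := WeightedSummable.sum h1 hr.le
  refine ⟨h2, h3.trans ?_⟩
  have h4 : ∑ i ∈ Finset.range (k + 1), weightedNorm r (cauchyProd (prepSeq g d i) (g (k - i))) ≤
      ∑ i ∈ Finset.range (k + 1), (M + c / r ^ d) ^ i * M ^ (k + 1 - 1 - i) * c := by
    refine Finset.sum_le_sum fun i hi => ?_
    have hi' : i ≤ k := by simpa [Nat.lt_succ_iff] using hi
    refine ((hq i hi').1.cauchyProd (hg _).1 hr.le).2.trans ?_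
    rw [Nat.add_sub_cancel, mul_assoc, mul_comm (M ^ _)]
    have h5 : 0 ≤ weightedNorm r (g (k - i)) := tsum_nonneg fun l => by positivity
    exact mul_le_mul (hq i hi').2 (hg _).2 h5 (by positivity)
  refine h4.trans ?_
  rw [← Finset.sum_mul]
  have h5 := (Commute.all (M + c / r ^ d) M).geom_sum₂_mul (k + 1)
  rw [add_sub_cancel_left] at h5
  have h6 : c = r ^ d * (c / r ^ d) := by field_simp
  calc _ = r ^ d * ((∑ i ∈ Finset.range (k + 1), (M + c / r ^ d) ^ i * M ^ (k + 1 - 1 - i)) *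
        (c / r ^ d)) := by conv_lhs => rw [h6]
                           field_simp
    _ ≤ _ := by
      rw [h5]
      gcongr
      exact sub_le_self _ (by positivity)

theorem prepSeq_bound (hr : 0 < r) (hc : 0 ≤ c) (hM : 0 ≤ M)
    (hg : ∀ j, WeightedSummable r (g j) ∧ weightedNorm r (g j) ≤ c * M ^ j) (k : ℕ) :
    WeightedSummable r (prepSeq g d k) ∧
      weightedNorm r (prepSeq g d k) ≤ (M + c / r ^ d) ^ k := by
  have hd : 0 < r ^ d := pow_pos hr d
  induction k using Nat.strong_induction_on with
  | _ k ih =>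
    rcases k with _ | k
    · have h1 : HasSum (fun l => |prepSeq g d 0 l| * r ^ l) 1 := by
        rw [prepSeq_zero]
        convert hasSum_single 0 ?_ using 1
        · simp
        · intro l hl; simp [hl]
      exact ⟨h1.summable, by rw [weightedNorm, h1.tsum_eq, pow_zero]⟩
    · obtain ⟨h1, h2⟩ := prepProd_bound (d := d) (k := k) hr hc hM hg fun i hi => ih i (by omega)
      obtain ⟨h3, h4⟩ := h1.shift hr d
      rw [prepSeq_succ]
      have e : ∀ l, |-prepProd g d k (l + d)| * r ^ l = |prepProd g d k (l + d)| * r ^ l :=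
        fun l => by rw [abs_neg]
      refine ⟨(summable_congr e).2 h3, ?_⟩
      rw [weightedNorm, tsum_congr e]
      refine h4.trans ?_
      rw [div_le_iff₀ hd]
      linarith

end Prep

open ConstrainedGerm in
/-- Preparation of a germ that is `y ^ d` on the axis `{x = 0}`. -/
theorem exists_weierstrass_of_monomial {G : ℝ × ℝ → ℝ} (hG : AnalyticAt ℝ G 0) (d : ℕ) :
    ∃ (w : ℕ → ℝ → ℝ) (Q : ℝ × ℝ → ℝ), (∀ i, AnalyticAt ℝ (w i) 0 ∧ w i 0 = 0) ∧
      AnalyticAt ℝ Q 0 ∧ Q 0 = 1 ∧ ∀ᶠ q in 𝓝 (0 : ℝ × ℝ), Q q * (q.2 ^ d + q.1 * G q) =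
        q.2 ^ d + ∑ i ∈ Finset.range d, w i q.1 * q.2 ^ i := by
  obtain ⟨a, r, ha⟩ := hG.exists_hasDoubleSeries
  have hr := ha.pos
  have hd : 0 < r ^ d := pow_pos hr d
  set g : ℕ → ℕ → ℝ := fun k l => a (k, l) with hgdef
  set c := ∑' k : ℕ × ℕ, |a k| * r ^ (k.1 + k.2) with hcdef
  have hc : 0 ≤ c := tsum_nonneg fun k => by positivity
  have hM : 0 < r⁻¹ := inv_pos.2 hr
  have hg : ∀ j, WeightedSummable r (g j) ∧ weightedNorm r (g j) ≤ c * r⁻¹ ^ j :=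
    ha.weightedSummable
  set K := r⁻¹ + c / r ^ d with hK
  have hK0 : 0 < K := by positivity
  have hq : ∀ k, WeightedSummable r (prepSeq g d k) ∧ weightedNorm r (prepSeq g d k) ≤ K ^ k :=
    prepSeq_bound hr hc hM.le hg
  have hh : ∀ k, WeightedSummable r (prepProd g d k) ∧
      weightedNorm r (prepProd g d k) ≤ r ^ d * K ^ (k + 1) := fun k =>
    prepProd_bound hr hc hM.le hg fun i _ => hq i
  -- The k-th coefficient grows at most like K ^ k; this ρ makes the series in x dominated by powers
  -- of 1/2.
  set ρ := min r ((2 * K)⁻¹) with hρ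
  have hρ0 : 0 < ρ := lt_min hr (by positivity)
  have hρr : ρ ≤ r := min_le_left _ _
  have hρK : K * ρ ≤ 1 / 2 := by
    calc K * ρ ≤ K * (2 * K)⁻¹ := by gcongr; exact min_le_right _ _
      _ = 1 / 2 := by field_simp
  have hsum : Summable fun k : ℕ × ℕ => |prepSeq g d k.1 k.2| * ρ ^ (k.1 + k.2) := by
    have hle : ∀ k l, |prepSeq g d k l| * ρ ^ (k + l) ≤ |prepSeq g d k l| * r ^ l * ρ ^ k := by
      intro k l
      rw [pow_add, mul_comm (ρ ^ k), ← mul_assoc]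
      gcongr
    have hrow : ∀ k, Summable fun l => |prepSeq g d k l| * ρ ^ (k + l) := fun k =>
      Summable.of_nonneg_of_le (fun _ => by positivity) (hle k) ((hq k).1.mul_right _)
    rw [summable_prod_of_nonneg fun k => by positivity]
    refine ⟨hrow, Summable.of_nonneg_of_le (fun k => tsum_nonneg fun l => by positivity)
      (fun k => ?_) (summable_geometric_of_lt_one (r := 1 / 2) (by norm_num) (by norm_num))⟩
    refine ((hrow k).tsum_le_tsum (hle k) ((hq k).1.mul_right _)).trans ?_
    rw [tsum_mul_right]
    calc _ ≤ K ^ k * ρ ^ k := by gcongr; exact (hq k).2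
      _ = (K * ρ) ^ k := (mul_pow _ _ _).symm
      _ ≤ _ := by gcongr
  have hQ := HasDoubleSeries.of_summable (a := fun k => prepSeq g d k.1 k.2) hρ0 hsum
  set Q : ℝ × ℝ → ℝ := fun q => ∑' k : ℕ × ℕ, prepSeq g d k.1 k.2 * (q.1 ^ k.1 * q.2 ^ k.2)
  have hwsum : ∀ i x, |x| ≤ ρ → Summable fun k => prepProd g d k i * x ^ k := by
    intro i x hx
    refine Summable.of_norm_bounded (g := fun k => r ^ d * K / r ^ i * (1 / 2) ^ k)
      ((summable_geometric_of_lt_one (by norm_num) (by norm_num)).mul_left _) fun k => ?_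
    have h1 := ((hh k).1.abs_mul_pow_le hr.le i).trans (hh k).2
    rw [Real.norm_eq_abs, abs_mul, abs_pow]
    have h2 : |prepProd g d k i| ≤ r ^ d * K ^ (k + 1) / r ^ i := by
      rw [le_div_iff₀ (by positivity)]; exact h1
    calc _ ≤ r ^ d * K ^ (k + 1) / r ^ i * ρ ^ k := by gcongr
      _ = r ^ d * K / r ^ i * (K * ρ) ^ k := by rw [mul_pow, pow_succ]; ring
      _ ≤ _ := by gcongr
  have hev : ∀ᶠ x in 𝓝 (0 : ℝ), |x| ≤ ρ := hQ.eventually_abs_le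
  refine ⟨fun i x => x * ∑' k, prepProd g d k i * x ^ k, Q, fun i => ⟨?_, by simp⟩,
    hQ.analyticAt, ?_, ?_⟩
  · refine analyticAt_id.fun_mul (analyticAt_of_hasSum (c := fun k => prepProd g d k i) ?_)
    filter_upwards [hev] with x hx using (hwsum i x hx).hasSum
  · have h0 : |(0 : ℝ)| ≤ ρ := by simpa using hρ0.le
    refine (hQ.hasSum 0 0 h0 h0).unique ?_
    convert hasSum_single ((0, 0) : ℕ × ℕ) ?_ using 1
    · simp [prepSeq_zero]
    · rintro ⟨k, l⟩ hkl
      rcases Nat.eq_zero_or_pos k with rfl | hk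
      · rcases Nat.eq_zero_or_pos l with rfl | hl
        · exact absurd rfl hkl
        · simp [hl.ne']
      · simp [hk.ne']
  · filter_upwards [hQ.eventually_abs_le_prod] with q hqρ
    obtain ⟨x, y⟩ := q
    obtain ⟨hx, hy⟩ := hqρ
    dsimp only at hx hy ⊢
    have hyr := hy.trans hρr
    have sQ := hQ.hasSum_powerSum hx hy
    have sG := ha.hasSum_powerSum (hx.trans hρr) hyr
    have sQG := WeightedSummable.cauchyProd_hasSum sQ sG
    have eQG : ∀ k, cauchyProd (fun k => x ^ k * powerSum (prepSeq g d k) y)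
        (fun k => x ^ k * powerSum (g k) y) k = x ^ k * powerSum (prepProd g d k) y := by
      intro k
      have h1 : powerSum (prepProd g d k) y =
          ∑ i ∈ Finset.range (k + 1), powerSum (prepSeq g d i) y * powerSum (g (k - i)) y := by
        have h2 : HasSum (fun l => prepProd g d k l * y ^ l) (∑ i ∈ Finset.range (k + 1),
            powerSum (prepSeq g d i) y * powerSum (g (k - i)) y) := by
          simp only [prepProd, Finset.sum_mul]
          refine hasSum_sum fun i _ => ?_
          rw [← (hq i).1.powerSum_cauchyProd (hg (k - i)).1 hyr]
          exact ((hq i).1.cauchyProd (hg (k - i)).1 hr.le).1.hasSum hyr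
        exact h2.tsum_eq
      rw [h1, Finset.mul_sum, cauchyProd, Finset.Nat.sum_antidiagonal_eq_sum_range_succ
        (fun i j => (x ^ i * powerSum (prepSeq g d i) y) * (x ^ j * powerSum (g j) y))]
      refine Finset.sum_congr rfl fun i hi => ?_
      have hi' : i + (k - i) = k := Nat.add_sub_cancel' (by simpa [Nat.lt_succ_iff] using hi)
      calc _ = x ^ (i + (k - i)) * (powerSum (prepSeq g d i) y * powerSum (g (k - i)) y) := by
            rw [pow_add]; ring
        _ = _ := by rw [hi']
    have sQG' : HasSum (fun k => x ^ k * powerSum (prepProd g d k) y) (Q (x, y) * G (x, y)) :=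
      sQG.congr_left fun k => (eQG k).symm
    have sQ1 : HasSum (fun k => x ^ (k + 1) * powerSum (prepSeq g d (k + 1)) y)
        (Q (x, y) - 1) := by
      have h1 := (hasSum_nat_add_iff' 1).2 sQ
      have h2 : powerSum (prepSeq g d 0) y = 1 := by
        have : HasSum (fun l => prepSeq g d 0 l * y ^ l) 1 := by
          rw [prepSeq_zero]
          convert hasSum_single 0 ?_ using 1
          · simp
          · intro l hl; simp [hl]
        exact this.tsum_eq
      simpa [h2] using h1
    have eshift : ∀ k, y ^ d * powerSum (prepSeq g d (k + 1)) y =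
        -(powerSum (prepProd g d k) y - ∑ l ∈ Finset.range d, prepProd g d k l * y ^ l) := by
      intro k
      rw [← (hh k).1.powerSum_shift hyr d, prepSeq_succ, ← mul_neg]
      simp only [powerSum, neg_mul, tsum_neg]
    -- The recursion cancels every multiple of y ^ d in QG against the corresponding term of y ^ d(Q
    -- - 1); only remainders of degree less than d survive.
    have sW : HasSum (fun k => x ^ (k + 1) * ∑ l ∈ Finset.range d, prepProd g d k l * y ^ l)
        (y ^ d * (Q (x, y) - 1) + x * (Q (x, y) * G (x, y))) := by
      refine ((sQ1.mul_left (y ^ d)).add (sQG'.mul_left x)).congr_left fun k => ?_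
      linear_combination -x ^ (k + 1) * eshift k
    have sW' : HasSum (fun k => x ^ (k + 1) * ∑ l ∈ Finset.range d, prepProd g d k l * y ^ l)
        (∑ i ∈ Finset.range d, x * (∑' k, prepProd g d k i * x ^ k) * y ^ i) := by
      have h1 : HasSum (fun k => ∑ i ∈ Finset.range d, x * (prepProd g d k i * x ^ k) * y ^ i)
          (∑ i ∈ Finset.range d, x * (∑' k, prepProd g d k i * x ^ k) * y ^ i) :=
        hasSum_sum fun i _ => ((hwsum i x hx).hasSum.mul_left x).mul_right _
      refine h1.congr_left fun k => ?_
      rw [Finset.mul_sum]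
      exact Finset.sum_congr rfl fun i _ => by rw [pow_succ]; ring
    have := sW.unique sW'
    linear_combination this

open ConstrainedGerm in
/-- The Weierstrass preparation theorem. -/
theorem exists_weierstrass {f : ℝ × ℝ → ℝ} (hf : AnalyticAt ℝ f 0)
    (hne : ¬ ∀ᶠ y in 𝓝 (0 : ℝ), f (0, y) = 0) :
    ∃ (d : ℕ) (w : ℕ → ℝ → ℝ) (U : ℝ × ℝ → ℝ), (∀ i, AnalyticAt ℝ (w i) 0 ∧ w i 0 = 0) ∧
      AnalyticAt ℝ U 0 ∧ U 0 ≠ 0 ∧ ∀ᶠ q in 𝓝 (0 : ℝ × ℝ),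
        f q = U q * (q.2 ^ d + ∑ i ∈ Finset.range d, w i q.1 * q.2 ^ i) := by
  have hs : AnalyticAt ℝ (fun y => f (0, y)) 0 := analyticAt_slice hf
  have hfin : analyticOrderAt (fun y => f (0, y)) 0 ≠ ⊤ := fun h => hne (analyticOrderAt_eq_top.1 h)
  obtain ⟨d, hd⟩ := ENat.ne_top_iff_exists.1 hfin
  obtain ⟨e, he, he0, hee⟩ := hs.analyticOrderAt_eq_natCast.1 hd.symm
  have he2 : AnalyticAt ℝ (fun q : ℝ × ℝ => e q.2) 0 :=
    AnalyticAt.fun_comp (f := Prod.snd) (g := e) he analyticAt_snd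
  have hne2 : ∀ᶠ q in 𝓝 (0 : ℝ × ℝ), e q.2 ≠ 0 := he2.continuousAt.eventually_ne he0
  have ha : AnalyticAt ℝ (fun q : ℝ × ℝ => f q * (e q.2)⁻¹ - q.2 ^ d) 0 :=
    (hf.fun_mul (he2.fun_inv he0)).fun_sub (by fun_prop)
  obtain ⟨G, hG, hGe⟩ := exists_eq_x_mul ha (by
    filter_upwards [hee, he.continuousAt.eventually_ne he0] with y h1 h2
    simp only [sub_zero, smul_eq_mul] at h1
    rw [h1, mul_assoc, mul_inv_cancel₀ h2, mul_one, sub_self])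
  obtain ⟨w, Q, hw, hQ, hQ0, hWe⟩ := exists_weierstrass_of_monomial hG d
  have hQ1 : Q 0 ≠ 0 := by rw [hQ0]; exact one_ne_zero
  refine ⟨d, w, fun q => e q.2 * (Q q)⁻¹, hw, he2.fun_mul (hQ.fun_inv hQ1),
    mul_ne_zero he0 (inv_ne_zero hQ1), ?_⟩
  filter_upwards [hGe, hWe, hne2, hQ.continuousAt.eventually_ne hQ1] with q h1 h2 h3 h4
  rw [← h2, ← h1]
  field_simp
  ring

/-! ### Monic polynomials over an integrally closed domain -/

namespace Polynomial

variable {R F : Type*} [CommRing R] [Field F]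

/-- A polynomial that becomes a power of `X` over the residue field. -/
structure IsWeierstrass (v : R →+* F) (W : Polynomial R) : Prop where
  monic : W.Monic
  map_eq : W.map v = X ^ W.natDegree

variable {v : R →+* F} {V W : Polynomial R}

theorem IsWeierstrass.coeff_zero_of_dvd (hW : W.IsWeierstrass v) {D : Polynomial R} (hD : D.Monic)
    (hDW : D ∣ W) (hdeg : D.natDegree ≠ 0) : v (D.coeff 0) = 0 := by
  have h1 : D.map v ∣ X ^ W.natDegree := hW.map_eq ▸ Polynomial.map_dvd v hDW
  obtain ⟨i, -, hi⟩ := (dvd_prime_pow prime_X _).1 h1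
  have h2 : i = D.natDegree := by
    have := natDegree_eq_of_degree_eq (degree_eq_degree_of_associated hi)
    rw [natDegree_X_pow, hD.natDegree_map] at this
    exact this.symm
  have h3 : X ∣ D.map v := (dvd_pow_self X (h2 ▸ hdeg)).trans hi.symm.dvd
  simpa using X_dvd_iff.1 h3

/-- Gauss's lemma: over an integrally closed domain, a factor over the fraction field of a monic
polynomial is, up to a constant, already defined over the ring. -/
theorem exists_monic_lift_of_dvd [IsDomain R] [IsIntegrallyClosed R] (hW : W.Monic)
    {z : Polynomial (FractionRing R)}
    (hz : ¬ IsUnit z) (hzW : z ∣ W.map (algebraMap R (FractionRing R))) :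
    ∃ D : Polynomial R, D.Monic ∧ D.natDegree ≠ 0 ∧
      Associated (D.map (algebraMap R (FractionRing R))) z := by
  have hz0 : z ≠ 0 := by
    rintro rfl
    exact (hW.map (algebraMap R (FractionRing R))).ne_zero (zero_dvd_iff.1 hzW)
  obtain ⟨D, hD⟩ := IsIntegrallyClosed.eq_map_mul_C_of_dvd (FractionRing R) hW hzW
  have hlc : z.leadingCoeff ≠ 0 := leadingCoeff_ne_zero.2 hz0
  have hass : Associated (D.map (algebraMap R (FractionRing R))) z :=
    ⟨(isUnit_C.2 hlc.isUnit).unit, hD⟩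
  have hmon : (D.map (algebraMap R (FractionRing R))).Monic := by
    have := congrArg leadingCoeff hD
    rw [leadingCoeff_mul, leadingCoeff_C] at this
    exact mul_right_cancel₀ hlc (by rw [this, one_mul])
  have hDm : D.Monic := monic_of_injective (IsFractionRing.injective R (FractionRing R)) hmon
  refine ⟨D, hDm, fun h => hz ?_, hass⟩
  rw [hDm.natDegree_eq_zero.1 h, Polynomial.map_one] at hass
  exact (associated_one_iff_isUnit.1 hass.symm)

theorem exists_bezout_of_isCoprime [IsDomain R]
    (h : IsCoprime (V.map (algebraMap R (FractionRing R))) (W.map (algebraMap R (FractionRing R)))) :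
    ∃ (c : R) (A B : Polynomial R), c ≠ 0 ∧ A * V + B * W = C c := by
  obtain ⟨a, b, hab⟩ := h
  obtain ⟨c, hc, ha⟩ := IsLocalization.integerNormalization_spec (nonZeroDivisors R) a
  obtain ⟨d, hd, hb⟩ := IsLocalization.integerNormalization_spec (nonZeroDivisors R) b
  refine ⟨c * d, C d * IsLocalization.integerNormalization (nonZeroDivisors R) a,
    C c * IsLocalization.integerNormalization (nonZeroDivisors R) b,
    mul_ne_zero (nonZeroDivisors.ne_zero hc) (nonZeroDivisors.ne_zero hd), ?_⟩
  refine map_injective _ (IsFractionRing.injective R (FractionRing R)) ?_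
  simp only [Polynomial.map_add, Polynomial.map_mul, map_C, ha, hb, Algebra.smul_def,
    C_mul, Polynomial.algebraMap_apply]
  linear_combination C (algebraMap R (FractionRing R) c) * C (algebraMap R (FractionRing R) d) * hab

/-- A common factor over the fraction field would lift to a monic one of positive degree. Over the
residue field it divides a power of X, so its constant term reduces to zero, which is excluded.
Coprimality then follows, and denominators are cleared. -/
theorem IsWeierstrass.exists_bezout [IsDomain R] [IsIntegrallyClosed R]
    (hV : V.IsWeierstrass v) (hW : W.Monic)
    (h : ¬ ∃ D : Polynomial R, D ∣ V ∧ D ∣ W ∧ v (D.coeff 0) = 0) :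
    ∃ (c : R) (A B : Polynomial R), c ≠ 0 ∧ A * V + B * W = C c := by
  refine exists_bezout_of_isCoprime (isCoprime_of_dvd _ _
    (fun h => (hV.monic.map _).ne_zero h.1) fun z hz _ hzV hzW => h ?_)
  obtain ⟨D, hD, hdeg, hass⟩ := exists_monic_lift_of_dvd hV.monic hz hzV
  have hDV := hV.monic.dvd_of_fraction_map_dvd_fraction_map hD (hass.dvd.trans hzV)
  exact ⟨D, hDV, hW.dvd_of_fraction_map_dvd_fraction_map hD (hass.dvd.trans hzW),
    hV.coeff_zero_of_dvd hD hDV hdeg⟩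

theorem IsWeierstrass.exists_bezout_derivative [IsDomain R] [IsIntegrallyClosed R] [CharZero R]
    (hW : W.IsWeierstrass v)
    (h : ¬ ∃ D : Polynomial R, D ^ 2 ∣ W ∧ v (D.coeff 0) = 0) :
    ∃ (c : R) (A B : Polynomial R), c ≠ 0 ∧ A * W + B * derivative W = C c := by
  have : CharZero (FractionRing R) :=
    charZero_of_injective_algebraMap (IsFractionRing.injective R (FractionRing R))
  have hsq : Squarefree (W.map (algebraMap R (FractionRing R))) := by
    intro z hz
    by_contra hu
    refine h ?_
    obtain ⟨D, hD, hdeg, hass⟩ := exists_monic_lift_of_dvd hW.monic hu ((dvd_mul_left z z).trans hz)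
    have hDV := hW.monic.dvd_of_fraction_map_dvd_fraction_map hD
      (hass.dvd.trans ((dvd_mul_left z z).trans hz))
    refine ⟨D, hW.monic.dvd_of_fraction_map_dvd_fraction_map (K := FractionRing R) (hD.pow 2) ?_,
      hW.coeff_zero_of_dvd hD hDV hdeg⟩
    rw [Polynomial.map_pow, pow_two]
    exact (mul_dvd_mul hass.dvd hass.dvd).trans hz
  have hsep := (separable_def _).1 (PerfectField.separable_iff_squarefree.2 hsq)
  rw [derivative_map] at hsep
  exact exists_bezout_of_isCoprime hsep

end Polynomial

/-! ### Rings of analytic germs -/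

/-- The ring of germs at the origin of real analytic functions. -/
def analyticGerms (E : Type*) [NormedAddCommGroup E] [NormedSpace ℝ E] :
    Subring (Germ (𝓝 (0 : E)) ℝ) where
  carrier := {g | ∃ f : E → ℝ, AnalyticAt ℝ f 0 ∧ (f : Germ (𝓝 (0 : E)) ℝ) = g}
  mul_mem' := by
    rintro _ _ ⟨f, hf, rfl⟩ ⟨g, hg, rfl⟩
    exact ⟨f * g, hf.mul hg, rfl⟩
  one_mem' := ⟨1, analyticAt_const, rfl⟩
  add_mem' := by
    rintro _ _ ⟨f, hf, rfl⟩ ⟨g, hg, rfl⟩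
    exact ⟨f + g, hf.add hg, rfl⟩
  zero_mem' := ⟨0, analyticAt_const, rfl⟩
  neg_mem' := by
    rintro _ ⟨f, hf, rfl⟩
    exact ⟨-f, hf.neg, rfl⟩

namespace analyticGerms

variable {E : Type*} [NormedAddCommGroup E] [NormedSpace ℝ E]

/-- The germ of an analytic function. -/
def germ (f : E → ℝ) (hf : AnalyticAt ℝ f 0) : analyticGerms E := ⟨f, f, hf, rfl⟩

theorem exists_rep (g : analyticGerms E) : ∃ f hf, g = germ f hf := by
  obtain ⟨_, f, hf, rfl⟩ := g
  exact ⟨f, hf, rfl⟩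

theorem germ_eq_iff {f g : E → ℝ} {hf : AnalyticAt ℝ f 0} {hg : AnalyticAt ℝ g 0} :
    germ f hf = germ g hg ↔ ∀ᶠ q in 𝓝 (0 : E), f q = g q := by
  rw [Subtype.ext_iff]
  exact Germ.coe_eq

theorem germ_eq_zero_iff {f : E → ℝ} {hf : AnalyticAt ℝ f 0} :
    germ f hf = 0 ↔ ∀ᶠ q in 𝓝 (0 : E), f q = 0 :=
  germ_eq_iff (hg := analyticAt_const)

theorem germ_eq_one_iff {f : E → ℝ} {hf : AnalyticAt ℝ f 0} :
    germ f hf = 1 ↔ ∀ᶠ q in 𝓝 (0 : E), f q = 1 :=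
  germ_eq_iff (hg := analyticAt_const)

theorem germ_mul {f g : E → ℝ} (hf : AnalyticAt ℝ f 0) (hg : AnalyticAt ℝ g 0) :
    germ f hf * germ g hg = germ (fun q => f q * g q) (hf.fun_mul hg) := rfl

theorem germ_add {f g : E → ℝ} (hf : AnalyticAt ℝ f 0) (hg : AnalyticAt ℝ g 0) :
    germ f hf + germ g hg = germ (fun q => f q + g q) (hf.fun_add hg) := rfl

theorem germ_pow {f : E → ℝ} (hf : AnalyticAt ℝ f 0) (n : ℕ) :
    germ f hf ^ n = germ (fun q => f q ^ n) (hf.fun_pow n) := rfl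

/-- The value at the origin. -/
def eval (E : Type*) [NormedAddCommGroup E] [NormedSpace ℝ E] : analyticGerms E →+* ℝ :=
  Germ.valueRingHom.comp (analyticGerms E).subtype

theorem eval_germ {f : E → ℝ} (hf : AnalyticAt ℝ f 0) : eval E (germ f hf) = f 0 := rfl

instance : CharZero (analyticGerms E) := (eval E).charZero

theorem isUnit_germ {f : E → ℝ} (hf : AnalyticAt ℝ f 0) (h0 : f 0 ≠ 0) : IsUnit (germ f hf) := by
  refine IsUnit.of_mul_eq_one (germ (fun q => (f q)⁻¹) (hf.fun_inv h0)) ?_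
  rw [germ_mul, germ_eq_one_iff]
  filter_upwards [hf.continuousAt.eventually_ne h0] with q hq
  exact mul_inv_cancel₀ hq

/-- The coordinate in the ring of germs of one variable. -/
def param : analyticGerms ℝ := germ (fun x => x) analyticAt_id

/-- Every nonzero germ in x is a power of x times a unit. Hence the ring is a valuation ring and
integrally closed, and any nonzero constant in a Bézout relation can be replaced by a power of x. -/
theorem exists_eq_param_pow_mul {g : analyticGerms ℝ} (hg : g ≠ 0) :
    ∃ (n : ℕ) (u : (analyticGerms ℝ)ˣ), g = param ^ n * u := by
  obtain ⟨f, hf, rfl⟩ := exists_rep g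
  have hfin : analyticOrderAt f 0 ≠ ⊤ := fun h => hg (germ_eq_zero_iff.2 (analyticOrderAt_eq_top.1 h))
  obtain ⟨n, hn⟩ := ENat.ne_top_iff_exists.1 hfin
  obtain ⟨e, he, he0, hee⟩ := hf.analyticOrderAt_eq_natCast.1 hn.symm
  refine ⟨n, (isUnit_germ he he0).unit, ?_⟩
  rw [IsUnit.unit_spec, param, germ_pow, germ_mul, germ_eq_iff]
  filter_upwards [hee] with x hx
  simpa using hx

instance : Nontrivial (analyticGerms E) := (eval E).domain_nontrivial

instance : NoZeroDivisors (analyticGerms ℝ) where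
  eq_zero_or_eq_zero_of_mul_eq_zero {a b} h := by
    obtain ⟨f, hf, rfl⟩ := exists_rep a
    obtain ⟨g, hg, rfl⟩ := exists_rep b
    exact (ConstrainedGerm.eventually_zero_or_of_mul hf hg
      (germ_eq_zero_iff.1 (germ_mul hf hg ▸ h))).imp germ_eq_zero_iff.2 germ_eq_zero_iff.2

instance : IsDomain (analyticGerms ℝ) := NoZeroDivisors.to_isDomain _

instance : ValuationRing (analyticGerms ℝ) := by
  refine ValuationRing.iff_dvd_total.2 ⟨fun a b => ?_⟩
  rcases eq_or_ne a 0 with rfl | ha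
  · exact Or.inr (dvd_zero b)
  rcases eq_or_ne b 0 with rfl | hb
  · exact Or.inl (dvd_zero a)
  obtain ⟨n, u, rfl⟩ := exists_eq_param_pow_mul ha
  obtain ⟨m, v, rfl⟩ := exists_eq_param_pow_mul hb
  rcases le_total n m with h | h
  · exact Or.inl (by simpa using pow_dvd_pow param h)
  · exact Or.inr (by simpa using pow_dvd_pow param h)

instance : IsIntegrallyClosed (analyticGerms ℝ) :=
  GCDMonoid.toIsIntegrallyClosed

/-! ### Weierstrass polynomials as germs in two variables -/

/-- Germs of functions of `x` as germs of functions of `(x, y)`. -/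
def ofFst : analyticGerms ℝ →+* analyticGerms (ℝ × ℝ) where
  toFun g := ⟨(g : Germ (𝓝 (0 : ℝ)) ℝ).compTendsto Prod.fst (continuous_fst.tendsto' _ _ rfl), by
    obtain ⟨f, hf, rfl⟩ := exists_rep g
    exact ⟨fun q => f q.1, AnalyticAt.fun_comp (f := Prod.fst) (g := f) hf analyticAt_fst, rfl⟩⟩
  map_one' := rfl
  map_zero' := rfl
  map_mul' a b := by
    obtain ⟨f, hf, rfl⟩ := exists_rep a
    obtain ⟨g, hg, rfl⟩ := exists_rep b
    rfl
  map_add' a b := by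
    obtain ⟨f, hf, rfl⟩ := exists_rep a
    obtain ⟨g, hg, rfl⟩ := exists_rep b
    rfl

/-- The germ of `x`. -/
def coordX : analyticGerms (ℝ × ℝ) := germ (fun q => q.1) analyticAt_fst

/-- The germ of `y`. -/
def coordY : analyticGerms (ℝ × ℝ) := germ (fun q => q.2) analyticAt_snd

/-- A polynomial in `y` with coefficients analytic in `x`, as a germ. -/
def ofPolynomial : Polynomial (analyticGerms ℝ) →+* analyticGerms (ℝ × ℝ) :=
  Polynomial.eval₂RingHom ofFst coordY

theorem ofPolynomial_C (c : analyticGerms ℝ) : ofPolynomial (Polynomial.C c) = ofFst c :=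
  Polynomial.eval₂_C _ _

theorem ofPolynomial_X : ofPolynomial Polynomial.X = coordY := Polynomial.eval₂_X _ _

theorem eval_ofPolynomial (p : Polynomial (analyticGerms ℝ)) :
    eval (ℝ × ℝ) (ofPolynomial p) = eval ℝ (p.coeff 0) := by
  refine (Polynomial.hom_eval₂ p ofFst (eval (ℝ × ℝ)) coordY).trans ?_
  rw [show eval (ℝ × ℝ) coordY = 0 from rfl, Polynomial.eval₂_at_zero]
  obtain ⟨f, hf, e⟩ := exists_rep (p.coeff 0)
  rw [e]
  rfl

theorem sum_germ {s : Finset ℕ} {f : ℕ → E → ℝ} (hf : ∀ i, AnalyticAt ℝ (f i) 0) :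
    ∑ i ∈ s, germ (f i) (hf i) =
      germ (fun q => ∑ i ∈ s, f i q) (Finset.analyticAt_fun_sum _ fun i _ => hf i) := by
  induction s using Finset.cons_induction with
  | empty => simp; rfl
  | cons i s hi ih =>
    rw [Finset.sum_cons, ih, germ_add]
    refine germ_eq_iff.2 (Eventually.of_forall fun q => ?_)
    rw [Finset.sum_cons]

/-- The polynomial `y ^ d + ∑ w i y ^ i`. -/
def weierstrassPoly (d : ℕ) (w : ℕ → ℝ → ℝ) (hw : ∀ i, AnalyticAt ℝ (w i) 0) :
    Polynomial (analyticGerms ℝ) :=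
  Polynomial.X ^ d + ∑ i ∈ Finset.range d, Polynomial.C (germ (w i) (hw i)) * Polynomial.X ^ i

variable {d : ℕ} {w : ℕ → ℝ → ℝ} {hw : ∀ i, AnalyticAt ℝ (w i) 0}

theorem degree_lower_lt : (∑ i ∈ Finset.range d,
    Polynomial.C (germ (w i) (hw i)) * Polynomial.X ^ i).degree < (d : WithBot ℕ) := by
  rw [Finset.sum_range]
  exact Polynomial.degree_sum_fin_lt fun i : Fin d => germ (w i) (hw i)

theorem isWeierstrass_weierstrassPoly (h0 : ∀ i, w i 0 = 0) :
    (weierstrassPoly d w hw).IsWeierstrass (eval ℝ) := by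
  refine ⟨Polynomial.monic_X_pow_add degree_lower_lt, ?_⟩
  have hdeg : (weierstrassPoly d w hw).natDegree = d := by
    refine Polynomial.natDegree_eq_of_degree_eq_some ?_
    rw [weierstrassPoly, Polynomial.degree_add_eq_left_of_degree_lt, Polynomial.degree_X_pow]
    rw [Polynomial.degree_X_pow]
    exact degree_lower_lt
  rw [hdeg, weierstrassPoly]
  simp [Polynomial.map_sum, eval_germ, h0]

theorem analyticAt_comp_fst {f : ℝ → ℝ} (hf : AnalyticAt ℝ f 0) :
    AnalyticAt ℝ (fun q : ℝ × ℝ => f q.1) 0 :=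
  AnalyticAt.fun_comp (f := Prod.fst) (g := f) hf analyticAt_fst

theorem ofPolynomial_monomial {f : ℝ → ℝ} (hf : AnalyticAt ℝ f 0) (i : ℕ) :
    ofPolynomial (Polynomial.C (germ f hf) * Polynomial.X ^ i) =
      germ (fun q => f q.1 * q.2 ^ i)
        ((analyticAt_comp_fst hf).fun_mul (analyticAt_snd.fun_pow i)) := by
  rw [map_mul, map_pow, ofPolynomial_C, ofPolynomial_X]
  rfl

theorem analyticAt_weierstrass (d : ℕ) (hw : ∀ i, AnalyticAt ℝ (w i) 0) :
    AnalyticAt ℝ (fun q : ℝ × ℝ => q.2 ^ d + ∑ i ∈ Finset.range d, w i q.1 * q.2 ^ i) 0 :=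
  (analyticAt_snd.fun_pow d).fun_add (Finset.analyticAt_fun_sum _ fun i _ =>
    (analyticAt_comp_fst (hw i)).fun_mul (analyticAt_snd.fun_pow i))

theorem ofPolynomial_weierstrassPoly : ofPolynomial (weierstrassPoly d w hw) =
    germ _ (analyticAt_weierstrass d hw) := by
  rw [weierstrassPoly, map_add, map_pow, ofPolynomial_X, map_sum]
  simp only [ofPolynomial_monomial]
  rw [sum_germ fun i => (analyticAt_comp_fst (hw i)).fun_mul (analyticAt_snd.fun_pow i)]
  rfl

theorem analyticAt_weierstrass_deriv (d : ℕ) (hw : ∀ i, AnalyticAt ℝ (w i) 0) :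
    AnalyticAt ℝ (fun q : ℝ × ℝ => d * q.2 ^ (d - 1) +
      ∑ i ∈ Finset.range d, w i q.1 * (i * q.2 ^ (i - 1))) 0 :=
  (analyticAt_const.fun_mul (analyticAt_snd.fun_pow _)).fun_add
    (Finset.analyticAt_fun_sum _ fun i _ => (analyticAt_comp_fst (hw i)).fun_mul
      (analyticAt_const.fun_mul (analyticAt_snd.fun_pow _)))

theorem natCast_eq_germ (n : ℕ) : (n : analyticGerms E) = germ (fun _ => (n : ℝ)) analyticAt_const := by
  induction n with
  | zero => simp; rfl
  | succ n ih =>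
    rw [Nat.cast_succ, ih, show (1 : analyticGerms E) = germ (fun _ => 1) analyticAt_const from rfl,
      germ_add]
    refine germ_eq_iff.2 (Eventually.of_forall fun q => ?_)
    simp

theorem ofPolynomial_derivative_weierstrassPoly :
    ofPolynomial (Polynomial.derivative (weierstrassPoly d w hw)) =
      germ _ (analyticAt_weierstrass_deriv d hw) := by
  have h : ∀ i, ofPolynomial (Polynomial.derivative
      (Polynomial.C (germ (w i) (hw i)) * Polynomial.X ^ i)) =
      germ (fun q => w i q.1 * (i * q.2 ^ (i - 1))) ((analyticAt_comp_fst (hw i)).fun_mul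
        (analyticAt_const.fun_mul (analyticAt_snd.fun_pow _))) := by
    intro i
    rw [Polynomial.derivative_C_mul, Polynomial.derivative_X_pow, map_mul, map_mul, map_pow,
      ofPolynomial_C, ofPolynomial_C, ofPolynomial_X, map_natCast, natCast_eq_germ]
    rfl
  rw [weierstrassPoly, Polynomial.derivative_add, Polynomial.derivative_sum, map_add, map_sum]
  simp only [h]
  rw [sum_germ fun i => (analyticAt_comp_fst (hw i)).fun_mul
      (analyticAt_const.fun_mul (analyticAt_snd.fun_pow (i - 1))),
    Polynomial.derivative_X_pow, map_mul, map_pow, ofPolynomial_C, ofPolynomial_X, map_natCast,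
    natCast_eq_germ]
  rfl

/-- Bézout relations over the polynomial ring, up to a power of `x`. -/
theorem exists_coordX_pow {c : analyticGerms ℝ} {A B V W : Polynomial (analyticGerms ℝ)}
    (hc : c ≠ 0) (h : A * V + B * W = Polynomial.C c) :
    ∃ (N : ℕ) (a b : analyticGerms (ℝ × ℝ)),
      a * ofPolynomial V + b * ofPolynomial W = coordX ^ N := by
  obtain ⟨N, u, rfl⟩ := exists_eq_param_pow_mul hc
  refine ⟨N, ofFst ↑u⁻¹ * ofPolynomial A, ofFst ↑u⁻¹ * ofPolynomial B, ?_⟩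
  have h1 := congrArg ofPolynomial h
  rw [map_add, map_mul, map_mul, ofPolynomial_C, map_mul, map_pow] at h1
  have h2 : ofFst ↑u⁻¹ * ofFst ↑u = 1 := by rw [← map_mul, Units.inv_mul, map_one]
  have h3 : ofFst param = coordX := rfl
  rw [h3] at h1
  linear_combination ofFst ↑u⁻¹ * h1 + coordX ^ N * h2

end analyticGerms

/-! ### Bézout relations for reduced germs -/

namespace ConstrainedGerm

open analyticGerms

theorem exists_x_pow_mul_weierstrass {f : ℝ × ℝ → ℝ} (hf : AnalyticAt ℝ f 0)
    (hne : ¬ ∀ᶠ q in 𝓝 (0 : ℝ × ℝ), f q = 0) :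
    ∃ (a d : ℕ) (w : ℕ → ℝ → ℝ) (U : ℝ × ℝ → ℝ), (∀ i, AnalyticAt ℝ (w i) 0) ∧ (∀ i, w i 0 = 0) ∧
      AnalyticAt ℝ U 0 ∧ U 0 ≠ 0 ∧ ∀ᶠ q in 𝓝 (0 : ℝ × ℝ),
        f q = q.1 ^ a * (U q * (q.2 ^ d + ∑ i ∈ Finset.range d, w i q.1 * q.2 ^ i)) := by
  -- Weights (1, 0) measure the order in x; dividing by x ^ D makes the germ nonzero on {x = 0}, as
  -- preparation requires.
  obtain ⟨D, hD, k, l, hkl, hc⟩ := exists_weighted_order hf hne 1 0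
  obtain ⟨r, hr⟩ := hf.hasDoubleSeries
  obtain ⟨F, hF, hFe⟩ := hr.exists_eq_x_pow_mul (K := D) fun k l hk => by
    by_contra hne
    have := hD k l hne
    omega
  have hF0 : ¬ ∀ᶠ y in 𝓝 (0 : ℝ), F (0, y) = 0 := by
    intro h
    refine hc ?_
    obtain ⟨r', hr'⟩ := hF.hasDoubleSeries
    rw [taylorCoeff_congr hFe, (hr'.x_pow_mul D).taylorCoeff_eq]
    have : k - D = 0 := by omega
    simp [this, taylorCoeff_x_zero h]
  obtain ⟨d, w, U, hw, hU, hU0, hFU⟩ := exists_weierstrass hF hF0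
  refine ⟨D, d, w, U, fun i => (hw i).1, fun i => (hw i).2, hU, hU0, ?_⟩
  filter_upwards [hFe, hFU] with q h1 h2
  rw [h1, h2]

variable {S : ConstrainedGerm}

theorem NoCommonFactor.eval_ne_zero (h : S.NoCommonFactor) {g : analyticGerms (ℝ × ℝ)}
    (hP : g ∣ germ S.P S.analytic_P) (hQ : g ∣ germ S.Q S.analytic_Q) : eval (ℝ × ℝ) g ≠ 0 := by
  intro h0
  obtain ⟨f, hf, rfl⟩ := exists_rep g
  obtain ⟨p, hp⟩ := hP
  obtain ⟨q, hq⟩ := hQ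
  obtain ⟨p, hpa, rfl⟩ := exists_rep p
  obtain ⟨q, hqa, rfl⟩ := exists_rep q
  rw [germ_mul, germ_eq_iff] at hp hq
  exact h ⟨f, p, q, hf, hpa, hqa, h0, hp, hq⟩

theorem fieldBezout_of_germs {N : ℕ} {a b : analyticGerms (ℝ × ℝ)}
    (h : a * germ S.P S.analytic_P + b * germ S.Q S.analytic_Q = coordX ^ N) : S.FieldBezout N := by
  obtain ⟨A, hA, rfl⟩ := exists_rep a
  obtain ⟨B, hB, rfl⟩ := exists_rep b
  rw [germ_mul, germ_mul, germ_add, coordX, germ_pow, germ_eq_iff] at h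
  exact ⟨A, B, hA, hB, h⟩

/-- Up to units and powers of x, P and Q are Weierstrass polynomials, and a common polynomial factor
vanishing at the origin would be a common factor of the germs. If one component is zero, the other
must be a unit. -/
theorem NoCommonFactor.fieldBezout (h : S.NoCommonFactor) : ∃ N, S.FieldBezout N := by
  by_cases hP : ∀ᶠ q in 𝓝 (0 : ℝ × ℝ), S.P q = 0
  · have hP0 : germ S.P S.analytic_P = 0 := germ_eq_zero_iff.2 hP
    obtain ⟨u, hu⟩ := isUnit_germ S.analytic_Q (h.eval_ne_zero (hP0 ▸ dvd_zero _) dvd_rfl)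
    refine ⟨0, fieldBezout_of_germs (a := 0) (b := ↑u⁻¹) ?_⟩
    rw [← hu, Units.inv_mul, zero_mul, zero_add, pow_zero]
  by_cases hQ : ∀ᶠ q in 𝓝 (0 : ℝ × ℝ), S.Q q = 0
  · have hQ0 : germ S.Q S.analytic_Q = 0 := germ_eq_zero_iff.2 hQ
    obtain ⟨u, hu⟩ := isUnit_germ S.analytic_P (h.eval_ne_zero dvd_rfl (hQ0 ▸ dvd_zero _))
    refine ⟨0, fieldBezout_of_germs (a := ↑u⁻¹) (b := 0) ?_⟩
    rw [← hu, Units.inv_mul, zero_mul, add_zero, pow_zero]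
  obtain ⟨m, d, w, U, hw, hw0, hU, hU0, hPe⟩ := exists_x_pow_mul_weierstrass S.analytic_P hP
  obtain ⟨n, e, w', U', hw', hw0', hU', hU0', hQe⟩ := exists_x_pow_mul_weierstrass S.analytic_Q hQ
  obtain ⟨u, hu⟩ := isUnit_germ hU hU0
  obtain ⟨u', hu'⟩ := isUnit_germ hU' hU0'
  have eP : germ S.P S.analytic_P = coordX ^ m * (u * ofPolynomial (weierstrassPoly d w hw)) := by
    rwa [hu, ofPolynomial_weierstrassPoly, coordX, germ_mul, germ_pow, germ_mul, germ_eq_iff]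
  have eQ : germ S.Q S.analytic_Q = coordX ^ n * (u' * ofPolynomial (weierstrassPoly e w' hw')) := by
    rwa [hu', ofPolynomial_weierstrassPoly, coordX, germ_mul, germ_pow, germ_mul, germ_eq_iff]
  obtain ⟨c, A, B, hc, hAB⟩ := (isWeierstrass_weierstrassPoly (hw := hw) (d := d) hw0).exists_bezout
    (isWeierstrass_weierstrassPoly (hw := hw') (d := e) hw0').monic (by
      rintro ⟨D, hD, hD', h0⟩
      refine h.eval_ne_zero (g := ofPolynomial D) ?_ ?_ (by rw [eval_ofPolynomial, h0])
      · rw [eP]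
        exact ((map_dvd ofPolynomial hD).mul_left _).mul_left _
      · rw [eQ]
        exact ((map_dvd ofPolynomial hD').mul_left _).mul_left _)
  obtain ⟨N, a, b, hab⟩ := exists_coordX_pow hc hAB
  refine ⟨N + m + n, fieldBezout_of_germs (a := coordX ^ n * a * ↑u⁻¹) (b := coordX ^ m * b * ↑u'⁻¹) ?_⟩
  have h1 : (↑u⁻¹ * u : analyticGerms (ℝ × ℝ)) = 1 := Units.inv_mul u
  have h2 : (↑u'⁻¹ * u' : analyticGerms (ℝ × ℝ)) = 1 := Units.inv_mul u'
  rw [eP, eQ, pow_add, pow_add]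
  linear_combination coordX ^ n * coordX ^ m * hab +
    coordX ^ n * coordX ^ m * a * ofPolynomial (weierstrassPoly d w hw) * h1 +
    coordX ^ n * coordX ^ m * b * ofPolynomial (weierstrassPoly e w' hw') * h2

theorem Reduced.impasseBezout (h : S.Reduced) : ∃ N, S.ImpasseBezout N := by
  have hne : ¬ ∀ᶠ q in 𝓝 (0 : ℝ × ℝ), S.δ q = 0 := fun h0 =>
    h ⟨fun _ => 0, fun _ => 0, analyticAt_const, analyticAt_const, rfl, by
      filter_upwards [h0] with q hq; simp [hq]⟩
  obtain ⟨m, d, w, U, hw, hw0, hU, hU0, he⟩ := exists_x_pow_mul_weierstrass S.analytic_δ hne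
  have eδ : germ S.δ S.analytic_δ = coordX ^ m * (germ U hU * ofPolynomial (weierstrassPoly d w hw)) := by
    rwa [ofPolynomial_weierstrassPoly, coordX, germ_mul, germ_pow, germ_mul, germ_eq_iff]
  obtain ⟨c, A, B, hc, hAB⟩ :=
    (isWeierstrass_weierstrassPoly (hw := hw) (d := d) hw0).exists_bezout_derivative (by
      rintro ⟨D, hD, h0⟩
      have hdvd : ofPolynomial D ^ 2 ∣ germ S.δ S.analytic_δ := by
        rw [eδ, ← map_pow]
        exact ((map_dvd ofPolynomial hD).mul_left _).mul_left _
      have h1 := eval_ofPolynomial D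
      rw [h0] at h1
      obtain ⟨f, hf, e⟩ := exists_rep (ofPolynomial D)
      rw [e] at hdvd h1
      obtain ⟨g, hg⟩ := hdvd
      obtain ⟨g, hga, rfl⟩ := exists_rep g
      rw [germ_pow, germ_mul, germ_eq_iff] at hg
      exact h ⟨f, g, hf, hga, h1, hg⟩)
  obtain ⟨N, a, b, hab⟩ := exists_coordX_pow hc hAB
  obtain ⟨α, hα, rfl⟩ := exists_rep a
  obtain ⟨β, hβ, rfl⟩ := exists_rep b
  rw [ofPolynomial_weierstrassPoly, ofPolynomial_derivative_weierstrassPoly, germ_mul, germ_mul,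
    germ_add, coordX, germ_pow, germ_eq_iff] at hab
  have aU' := analyticAt_fderiv_snd hU
  have aI := hU.fun_inv hU0
  -- With δ = x^m U W, the correction by ∂U/∂y cancels the term x^m W ∂U/∂y in ∂δ/∂y, leaving x^m
  -- times the relation for W and ∂W/∂y.
  refine ⟨N + m, fun q => (U q)⁻¹ * (α q - β q * fderiv ℝ U q (0, 1) * (U q)⁻¹),
    fun q => (U q)⁻¹ * β q, aI.fun_mul (hα.fun_sub ((hβ.fun_mul aU').fun_mul aI)),
    aI.fun_mul hβ, ?_⟩
  filter_upwards [hab, he.eventually_nhds, S.analytic_δ.eventually_analyticAt,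
    hU.eventually_analyticAt, hU.continuousAt.eventually_ne hU0] with q h1 h2 h3 h4 h5
  have hd : HasDerivAt (fun v => q.1 ^ m * (U (q.1, v) * (v ^ d +
      ∑ i ∈ Finset.range d, w i q.1 * v ^ i)))
      (q.1 ^ m * (fderiv ℝ U q (0, 1) * (q.2 ^ d + ∑ i ∈ Finset.range d, w i q.1 * q.2 ^ i) +
        U q * (d * q.2 ^ (d - 1) + ∑ i ∈ Finset.range d, w i q.1 * (i * q.2 ^ (i - 1))))) q.2 := by
    have hUd : HasDerivAt (fun v => U (q.1, v)) (fderiv ℝ U q (0, 1)) q.2 := by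
      rw [show fderiv ℝ U q (0, 1) = _ from
        fderiv_apply_snd (x := q.1) (y := q.2) h4.differentiableAt]
      exact (analyticAt_slice (x := q.1) (y := q.2) h4).differentiableAt.hasDerivAt
    refine (hUd.fun_mul ((hasDerivAt_pow d q.2).fun_add (HasDerivAt.fun_sum fun i _ =>
      (hasDerivAt_pow i q.2).const_mul (w i q.1)))).const_mul (q.1 ^ m)
  have e1 : fderiv ℝ S.δ q (0, 1) = _ :=
    (fderiv_apply_snd (x := q.1) (y := q.2) h3.differentiableAt).trans
      ((hd.congr_of_eventuallyEq (eventually_slice (x := q.1) (y := q.2) h2)).deriv)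
  rw [e1, h2.self_of_nhds, pow_add, ← h1]
  field_simp
  ring

end ConstrainedGerm

end

/-! ### Resolution and convergence from tameness -/

theorem theorem3 (S : ConstrainedGerm) (hX : S.NoCommonFactor) (hδ : S.Reduced)
    (hc : S.Controllable) :
    (∃ n : ℕ, S.ResolvedBy n) ∧
    (∀ (hy : ¬ S.divY) (T : ℕ → ConstrainedGerm) (α : ℕ → ℝ) (β : ℕ → ℕ), T 0 = S →
      (∀ n, (T n).HeightStalls (α n) (β n) ∧
        ∃ (hβ : 0 < β n) (hn : ¬ (T n).divY), T (n + 1) = (T n).monomialShear (α n) (β n) hβ hn) →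
      ∃ (φ : ℝ → ℝ) (hφ : AnalyticAt ℝ φ 0) (h0 : φ 0 = 0),
        (∀ᶠ x in 𝓝 (0 : ℝ), HasSum (fun n => α n * x ^ β n) (φ x)) ∧
        (S.shear φ hφ h0 hy).Controllable ∧ (S.shear φ hφ h0 hy).MainSegmentHorizontal) := by
  have hS : S.Tame := ⟨hX.fieldBezout, hδ.impasseBezout⟩
  exact ⟨hS.resolvable hc, fun hy T α β h0 hT => hS.convergence hc hy h0 hT⟩
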